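/- **Setting.** Let $G=(V,E)$ be a simple graph with $V=\{1,\dots,n\}$, $n\ge 1$, neighbourhoods $N_v$ and maximum degree $\Delta$. A single-site Metropolis chain on $[q]^V$ is given by distributions $\nu_v$ on $[q]$ and filters $f^v_{c,c'}:[q]^{N_v}\to[0,1]$. In each step it picks $v\in V$ uniformly at random, draws $c'\sim\nu_v$ and, with $c$ the current value at $v$, changes the value at $v$ to $c'$ with probability $f^v_{c,c'}(X(N_v))$, otherwise keeping the state. Let $X_k$ be the state after $k$ steps from $X_0$. The *Lipschitz condition* with constant $C>0$ says that for every edge $\{u,v\}$ (in both orientations) and all $a,b,c\in[q]$, $$\sum_{c'\in[q]}\nu_v(c')\,\max_{\sigma,\tau}\bigl|f^v_{c,c'}(\sigma)-f^v_{c,c'}(\tau)\bigr|\le \frac{C}{\Delta},$$ where $\sigma,\tau\in[q]^{N_v}$ range over the pairs with $\sigma_u=a$, $\tau_u=b$ and $\sigma=\tau$ elsewhere. **Model.** In the fully-asynchronous message-passing model all nodes start at time $0$ with independent private random bits, and every node runs the same event-driven program: at the start and upon each receipt of a message, it performs arbitrary local computation, sends bit strings to neighbours and possibly returns a value and terminates.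 Every message is delivered after a finite delay, and messages on the same directed channel are delivered in the order in which they are sent. The schedule assigns to the $k$-th message on each directed channel a delay. The time unit of an execution is the maximum time between the sending and the delivery of a message delivered before termination. **Theorem.** There are an algorithm in this model and a constant $B$ such that for every $C>0$ there is a constant $K$, depending only on $C$, with the following property. Take any $n\ge1$, $q$, $G$ and any chain as above that satisfies the Lipschitz condition with constant $C$, any threshold $T\ge0$ and any $X_0\in[q]^V$, and let each node $v$ receive as input $n$, $q$, the names of its neighbours, $T$, $X_0(v)$, $\nu_v$ and $(f^v_{c,c'})_{c,c'\in[q]}$. Then: 1. Almost surely, under every schedule (even one chosen with knowledge of the random bits), the algorithm terminates, and its output $\widehat X\in[q]^V$, with each $v$ returning $\widehat X(v)$, does not depend on the schedule. There is a random variable $N\in\mathbb N$, a function of the random bits only, such that the output is exactly $X_N$: $\Pr[N=k,\ \widehat X=\sigma]=\Pr[N=k]\cdot\Pr[X_k=\sigma]$ for all $k\in\mathbb N$ and $\sigma\in[q]^V$. 2. For every schedule of delays fixed in advance (it may depend on the entire input, but not on the random bits), with probability at least $1-1/n$ both $N\ge nT$ and the algorithm terminates within $K(T+\ln n)$ time units.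 3. Every message has at most $B\,(\ln n+\ln\max\{1,\lceil T\rceil\}+\ln q)$ bits. -/

import Mathlib

open MeasureTheory
open scoped NNReal ENNReal

noncomputable section

/-! ### Single-site Metropolis chains -/

/-- A coin that shows `true` with probability `p`. -/
def coin (p : unitInterval) : PMF Bool :=
  PMF.ofFintype (fun b => if b then ENNReal.ofReal p else ENNReal.ofReal (1 - p)) (by
    rw [Fintype.sum_bool, if_pos rfl, if_neg Bool.false_ne_true,
      ← ENNReal.ofReal_add p.2.1 (sub_nonneg.2 p.2.2)]
    simp)

/-- A graphical model on `n` sites with spins in `[q]`, together with the proposal distributions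
`ν v` and the Metropolis filters `f v c c' : [q]^{N(v)} → [0,1]`, where `c` is the current spin
and `c'` the proposed one. -/
structure MetropolisChain (n q : ℕ) where
  G : SimpleGraph (Fin n)
  ν : Fin n → PMF (Fin q)
  f : (v : Fin n) → Fin q → Fin q → (G.neighborSet v → Fin q) → unitInterval

namespace MetropolisChain

variable {n q : ℕ} (M : MetropolisChain n q)

/-- Update at a given site `v`: draw a proposal from `ν v` and accept it with the probability
given by the filter. -/
def siteUpdate (v : Fin n) (X : Fin n → Fin q) : PMF (Fin n → Fin q) :=
  (M.ν v).bind fun c' =>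
    (coin (M.f v (X v) c' fun u => X u)).bind fun accept =>
      PMF.pure (if accept then Function.update X v c' else X)

/-- One step of the chain: update a uniformly random site. -/
def step [NeZero n] (X : Fin n → Fin q) : PMF (Fin n → Fin q) :=
  (PMF.uniformOfFintype (Fin n)).bind fun v => M.siteUpdate v X

/-- The law of the state `X_k` after `k` steps, starting from `X₀`. -/
def law [NeZero n] (X₀ : Fin n → Fin q) (k : ℕ) : PMF (Fin n → Fin q) :=
  k.rec (PMF.pure X₀) fun _ p => p.bind M.step

/-- The influence `δ_{u,a,b} f^v_{c,c'}`: the maximum of `|f(σ) - f(τ)|` over all pairs `σ, τ` with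
`σ u = a`, `τ u = b` that agree elsewhere (a supremum over a finite nonempty set). -/
def influence (v : Fin n) (u : M.G.neighborSet v) (a b c c' : Fin q) : ℝ :=
  sSup {x : ℝ | ∃ σ τ : M.G.neighborSet v → Fin q, σ u = a ∧ τ u = b ∧
    (∀ w, w ≠ u → σ w = τ w) ∧ x = |(M.f v c c' σ : ℝ) - (M.f v c c' τ : ℝ)|}

open Classical in
/-- The Lipschitz condition with constant `C`. -/
def Lipschitz (C : ℝ) : Prop :=
  ∀ (v : Fin n) (u : M.G.neighborSet v) (a b c : Fin q),
    ∑ c', (M.ν v c').toReal * M.influence v u a b c c' ≤ C / (M.G.maxDegree : ℝ)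

end MetropolisChain

/-! ### Asynchronous message-passing algorithms -/

/-- Messages are bit strings. -/
abbrev Message := List Bool

/-- The private random tape of a node: i.i.d. uniform random numbers in `[0,1]`. -/
abbrev Tape := ℕ → unitInterval

/-- The joint law of the independent random tapes of `n` nodes. -/
def tapeMeasure (n : ℕ) : Measure (Fin n → Tape) :=
  Measure.pi fun _ => Measure.infinitePi fun _ => (volume : Measure unitInterval)

/-- What a node is told at the start (besides `n` and `q`): the names of its channels, the
threshold, its initial spin, its proposal distribution, and its Metropolis filters. -/
structure LocalInput (n q : ℕ) where
  nbrs : Set (Fin n)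
  T : ℝ≥0
  init : Fin q
  ν : PMF (Fin q)
  f : Fin q → Fin q → (nbrs → Fin q) → unitInterval

/-- A distributed algorithm: one event-driven program, run by every node. The events at a node are
the start and the receipt of a message. The program is given the local input, the private tape and
the history `h`, i.e. the (sender, message) pairs that the node has received so far, in order of
receipt. `send inp r h u` is the list of messages that the node sends to its neighbour `u` in
response to the latest event (the start when `h = []`). When `output inp r h` becomes `some c`, the
node returns `c` and terminates. The program is measurable in the random tape; local computation is
otherwise unrestricted. -/
structure DistAlgorithm where
  send : {n q : ℕ} → LocalInput n q → Tape → List (Fin n × Message) → Fin n → List Message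
  output : {n q : ℕ} → LocalInput n q → Tape → List (Fin n × Message) → Option (Fin q)
  measurable_send : ∀ {n q : ℕ} (inp : LocalInput n q) (h : List (Fin n × Message)) (u : Fin n)
    (l : List Message), MeasurableSet {r | send inp r h u = l}
  measurable_output : ∀ {n q : ℕ} (inp : LocalInput n q) (h : List (Fin n × Message))
    (o : Option (Fin q)), MeasurableSet {r | output inp r h = o}

/-- A message in transit. It may be delivered from time `readyAt` on. -/
structure Packet where
  body : Message
  sentAt : ℝ≥0
  readyAt : ℝ≥0

/-- A global configuration of an asynchronous execution. `chan u v` is the FIFO queue of messages in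
transit from `u` to `v` (oldest first), `sent u v` the number of messages ever sent from `u` to `v`,
and `timeUnit` the maximum time between sending and delivery over all messages delivered so far. -/
structure Config (n : ℕ) where
  now : ℝ≥0
  timeUnit : ℝ≥0
  hist : Fin n → List (Fin n × Message)
  chan : Fin n → Fin n → List Packet
  sent : Fin n → Fin n → ℕ

/-- A run of the algorithm `alg` for simulating the chain `M` from `X₀` with threshold `T`:
`tape` holds the random tapes of the nodes, and `delay u v k` is the delay that the scheduler
assigns to the `k`-th message sent from `u` to `v`. -/
structure Run (n q : ℕ) where
  alg : DistAlgorithm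
  M : MetropolisChain n q
  X₀ : Fin n → Fin q
  T : ℝ≥0
  tape : Fin n → Tape
  delay : Fin n → Fin n → ℕ → ℝ≥0

namespace Run

variable {n q : ℕ} (R : Run n q)

def localInput (v : Fin n) : LocalInput n q :=
  ⟨R.M.G.neighborSet v, R.T, R.X₀ v, R.M.ν v, R.M.f v⟩

/-- The value returned by node `v` in configuration `s`, if `v` has terminated. -/
def output (s : Config n) (v : Fin n) : Option (Fin q) :=
  R.alg.output (R.localInput v) (R.tape v) (s.hist v)

/-- The algorithm has terminated: every node has returned a value. -/
def Terminated (s : Config n) : Prop := ∀ v, (R.output s v).isSome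

/-- The messages that `u` sends to `v` in response to its latest event. -/
def batch (s : Config n) (u v : Fin n) : List Message :=
  R.alg.send (R.localInput u) (R.tape u) (s.hist u) v

open Classical in
/-- The nodes in `A` respond to their latest event: they put messages on their channels. -/
def emit (A : Set (Fin n)) (s : Config n) : Config n :=
  { s with
    chan := fun u v =>
      if u ∈ A ∧ R.M.G.Adj u v then
        s.chan u v ++ (R.batch s u v).mapIdx fun i m =>
          { body := m, sentAt := s.now, readyAt := s.now + R.delay u v (s.sent u v + i) }
      else s.chan u v
    sent := fun u v =>
      if u ∈ A ∧ R.M.G.Adj u v then s.sent u v + (R.batch s u v).length else s.sent u v }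

/-- The configuration right after all nodes have started at time `0`. -/
def start : Config n :=
  R.emit Set.univ
    { now := 0, timeUnit := 0, hist := fun _ => [], chan := fun _ _ => [], sent := fun _ _ => 0 }

open Classical in
/-- Delivery of the packet `p`, the oldest one on the channel from `u` to `v`, where `rest` are the
packets behind it. A node that has terminated ignores further messages. -/
def deliver (s : Config n) (u v : Fin n) (p : Packet) (rest : List Packet) : Config n :=
  let t := max s.now p.readyAt
  let s' : Config n :=
    { s with
      now := t
      timeUnit := max s.timeUnit (t - p.sentAt)
      chan := Function.update s.chan u (Function.update (s.chan u) v rest) }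
  if (R.output s v).isSome then s'
  else R.emit {v} { s' with hist := Function.update s.hist v (s.hist v ++ [(u, p.body)]) }

/-- One event of an execution that has not terminated: among the oldest messages on the nonempty
channels, one with the earliest delivery time is delivered (ties are broken arbitrarily). -/
def Step (s s' : Config n) : Prop :=
  ¬ R.Terminated s ∧ ∃ (u v : Fin n) (p : Packet) (rest : List Packet),
    s.chan u v = p :: rest ∧
    (∀ (u' v' : Fin n) (p' : Packet), (s.chan u' v').head? = some p' → p.readyAt ≤ p'.readyAt) ∧
    s' = R.deliver s u v p rest

/-- `s` occurs in some execution. -/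
def Reachable (s : Config n) : Prop := Relation.ReflTransGen R.Step R.start s

/-- `s` is the last configuration of some execution. -/
def Final (s : Config n) : Prop := R.Reachable s ∧ ∀ s', ¬ R.Step s s'

/-- Every execution is finite. -/
def AlwaysHalts : Prop :=
  ¬ ∃ e : ℕ → Config n, e 0 = R.start ∧ ∀ i, R.Step (e i) (e (i + 1))

end Run

end

/-! The chain is run in continuous time. Every node draws a Poisson number of updates, with mean `4
* (T + log n)`, at independent uniform times in `[0,1]`. Each update carries a proposed spin and a
uniform threshold, and it is accepted if the threshold lies below the value of the filter. In order
of time, and given their total number `N`, the updates of all nodes are `N` independent proposals at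
uniformly random sites (`tapeMeasure_superposition`). So the state after the last update is exactly
a sample of `X_N`. It is a function of the tapes alone, and a Chernoff bound gives `N ≥ n T` with
high probability.

To find this state in parallel, the nodes announce their update times and proposed spins. In each
round, a node decides its next update if the outcome is the same for all spins that its neighbours
may have at that time, given the outcomes announced so far; `resolved` is the global picture of
this. If an update is resolved in round `k + 2` and not before, then some earlier update that is
resolved exactly in round `k + 1` is pivotal for it (`exists_pivotal`): it is at the same site, or
its outcome settles the question. A single outcome removes at most one candidate spin of one site
(`box_hybrid_succ`), which changes the relevant filter values by at most an influence `δ`; a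
threshold for which this matters lies in one of two intervals of length `δ`
(`volume_separating_le`). The Lipschitz condition sums this to `2 * C` over the neighbours, and the
site itself adds 1, so a random proposal is pivotal with probability at most `(1 + 2 * C) / n`
(`proposalLaw_pivotal_le`). Summing over chains of pivotal updates, `N` updates fail to be resolved
in `k` rounds with probability at most `((1 + 2 * C) / n) ^ k * N.choose (k + 1)`
(`pi_exists_notMem_resolved_le`). Averaged over the Poisson number `N`, this is at most `1 / (4 n)`
for some `k = O(T + log n)`.

Times are announced in dyadic approximation. The initial precision makes a collision of cells
unlikely, and it grows in every round, so that the protocol terminates almost surely.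

Asynchrony is handled by a synchronizer: a node enters the next round once it knows the current
states of its neighbours. The state of round `k` is then sent by time `k` time units, so `m` rounds
take at most `m + 2` time units (`Invariant`). A state may be long, but it is sent at once as a
sequence of messages of at most one bit; this costs no extra time and makes the bound on the message
size immediate. -/

noncomputable section

/-! ### Functions with measurable fibres -/

/-- All fibres of `f` are measurable. For countable codomains this is measurability with respect to
the discrete `σ`-algebra. -/
def MeasurableFibers {Ω β : Type*} [MeasurableSpace Ω] (f : Ω → β) : Prop :=
  ∀ b, MeasurableSet {r | f r = b}

namespace MeasurableFibers

variable {Ω β γ : Type*} [MeasurableSpace Ω]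

lemma const (b : β) : MeasurableFibers (fun _ : Ω => b) := fun c => by
  by_cases h : b = c <;> simp [h]

/-- A countable intermediate value cuts a fibre into countably many pieces, and on each piece the
second function is a fixed one. This yields the measurability of programs that read the tape again
after a discrete result. -/
lemma bind [Countable β] {f : Ω → β} {g : β → Ω → γ} (hf : MeasurableFibers f)
    (hg : ∀ b, MeasurableFibers (g b)) : MeasurableFibers (fun r => g (f r) r) := fun c => by
  have : {r | g (f r) r = c} = ⋃ b, {r | f r = b} ∩ {r | g b r = c} := by
    ext r; simp
  rw [this]
  exact MeasurableSet.iUnion fun b => (hf b).inter (hg b c)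

lemma comp [Countable β] {f : Ω → β} (hf : MeasurableFibers f) (F : β → γ) :
    MeasurableFibers (fun r => F (f r)) :=
  hf.bind (g := fun b _ => F b) fun b => const (F b)

lemma comp₂ {δ : Type*} [Countable β] [Countable γ] {f : Ω → β} {g : Ω → γ}
    (hf : MeasurableFibers f) (hg : MeasurableFibers g) (F : β → γ → δ) :
    MeasurableFibers (fun r => F (f r) (g r)) :=
  hf.bind (g := fun b r => F b (g r)) fun b => hg.comp (F b)

lemma listMap [Countable β] {ι : Type*} {f : ι → Ω → β} (L : List ι)
    (hf : ∀ i ∈ L, MeasurableFibers (f i)) :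
    MeasurableFibers (fun r => L.map fun i => f i r) := by
  induction L with
  | nil => exact const []
  | cons i L ih =>
    simp only [List.map_cons]
    exact (hf i (by simp)).comp₂ (ih fun j hj => hf j (by simp [hj])) List.cons

lemma of_prop {p : Ω → Prop} (hp : MeasurableSet {r | p r}) : MeasurableFibers p := fun b => by
  by_cases hb : b
  · simpa [hb] using hp
  · have : {r | p r = b} = {r | p r}ᶜ := by ext r; simp [hb]
    rw [this]; exact hp.compl

lemma measurableSet {p : Ω → Prop} (hp : MeasurableFibers p) : MeasurableSet {r | p r} := by
  simpa using hp True

lemma forall_prop {ι : Sort*} [Countable ι] {p : ι → Ω → Prop}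
    (hp : ∀ i, MeasurableFibers (p i)) : MeasurableFibers fun r => ∀ i, p i r := by
  refine of_prop ?_
  rw [show {r | ∀ i, p i r} = ⋂ i, {r | p i r} by ext; simp]
  exact MeasurableSet.iInter fun i => (hp i).measurableSet

lemma sInf_nat {p : ℕ → Ω → Prop} (hp : ∀ i, MeasurableFibers (p i)) :
    MeasurableFibers fun r => sInf {k | p k r} := fun b => by
  -- The second alternative is there because the infimum of the empty set is 0.
  have : {r | sInf {k | p k r} = b} = {r | (p b r ∧ ∀ j, j < b → ¬ p j r) ∨
      ((∀ j, ¬ p j r) ∧ b = 0)} := by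
    ext r
    simp only [Set.mem_ofPred_eq]
    constructor
    · rintro rfl
      by_cases h : ∃ j, p j r
      · exact Or.inl ⟨Nat.sInf_mem (s := {k | p k r}) h, fun j hj hpj =>
          absurd (Nat.sInf_le (s := {k | p k r}) hpj) (not_le.2 hj)⟩
      · push Not at h
        refine Or.inr ⟨h, ?_⟩
        rw [show {k | p k r} = ∅ by ext k; simp [h k]]
        simp
    · rintro (⟨h1, h2⟩ | ⟨h1, rfl⟩)
      · refine le_antisymm (Nat.sInf_le h1) ?_
        by_contra hlt
        exact h2 _ (not_le.1 hlt) (Nat.sInf_mem (s := {k | p k r}) ⟨b, h1⟩)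
      · rw [show {k | p k r} = ∅ by ext k; simp [h1 k]]
        simp
  rw [this]
  refine measurableSet ?_
  have h1 : MeasurableFibers fun r => ∀ j, j < b → ¬ p j r :=
    forall_prop fun j => forall_prop fun _ => (hp j).comp Not
  have h2 : MeasurableFibers fun r => ∀ j, ¬ p j r := forall_prop fun j => (hp j).comp Not
  exact ((hp b).comp₂ h1 And).comp₂ (h2.comp fun x => x ∧ b = 0) Or

end MeasurableFibers

/-! ### Sending values bit by bit -/

section Wire

variable {α : Type} [Encodable α]

/-- The binary code of a value. -/
def bitCode (a : α) : List Bool := Computability.encodeNat (Encodable.encode a)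

/-- The value with a given binary code. -/
def ofBitCode (l : List Bool) : Option α := Encodable.decode (Computability.decodeNat l)

lemma ofBitCode_bitCode (a : α) : ofBitCode (bitCode a) = some a := by
  simp [ofBitCode, bitCode]

/-- A value is sent as a sequence of one-bit messages, followed by an empty message. -/
def wire (a : α) : List Message := (bitCode a).map (fun b => [b]) ++ [[]]

/-- The values that have been received completely, where `acc` holds the pending bits. -/
def parseFrom : List Bool → List Message → List α
  | _, [] => []
  | acc, [] :: l => (ofBitCode acc).toList ++ parseFrom [] l
  | acc, (b :: _) :: l => parseFrom (acc ++ [b]) l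

/-- The values that have been received completely. -/
def parse (l : List Message) : List α := parseFrom [] l

lemma parseFrom_bits (acc l : List Bool) (m : List Message) :
    (parseFrom acc (l.map (fun b => [b]) ++ m) : List α) = parseFrom (acc ++ l) m := by
  induction l generalizing acc with
  | nil => simp
  | cons b l ih => simp [parseFrom, ih]

lemma parse_wire_append (a : α) (m : List Message) : parse (wire a ++ m) = a :: parse m := by
  simp [parse, wire, parseFrom_bits, parseFrom, ofBitCode_bitCode]

lemma parseFrom_prefix {l l' : List Message} (h : l <+: l') (acc : List Bool) :
    (parseFrom acc l : List α) <+: parseFrom acc l' := by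
  obtain ⟨m, rfl⟩ := h
  induction l generalizing acc with
  | nil => simp [parseFrom]
  | cons x l ih =>
    cases x with
    | nil => simpa [parseFrom] using ih []
    | cons b x => simpa [parseFrom] using ih (acc ++ [b])

lemma parse_prefix {l l' : List Message} (h : l <+: l') : (parse l : List α) <+: parse l' :=
  parseFrom_prefix h []

lemma length_le_one_of_mem_wire {a : α} {m : Message} (h : m ∈ wire a) : m.length ≤ 1 := by
  simp only [wire, List.mem_append, List.mem_map, List.mem_singleton] at h
  rcases h with ⟨b, -, rfl⟩ | rfl <;> simp

/-- The messages that transmit the first `m` terms of a sequence. -/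
def stream (x : ℕ → α) (m : ℕ) : List Message := (List.range m).flatMap fun k => wire (x k)

lemma parse_stream (x : ℕ → α) (m : ℕ) : parse (stream x m) = (List.range m).map x := by
  have : ∀ (L : List ℕ), (parse (L.flatMap fun k => wire (x k)) : List α) = L.map x := by
    intro L
    induction L with
    | nil => simp [parse, parseFrom]
    | cons k L ih => simp [parse_wire_append, ih]
  exact this _

lemma stream_append (x : ℕ → α) {m m' : ℕ} (h : m ≤ m') :
    stream x m' = stream x m ++ (List.Ico m m').flatMap fun k => wire (x k) := by
  have : List.range m' = List.range m ++ List.Ico m m' := by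
    rw [← List.Ico.zero_bot, ← List.Ico.zero_bot, List.Ico.append_consecutive (Nat.zero_le m) h]
  rw [stream, this, List.flatMap_append]; rfl

/-- On a FIFO channel a receiver holds a prefix of the stream. It may end inside a code, and then
the pending bits yield no value. -/
lemma parse_eq_of_prefix_stream {l : List Message} {x : ℕ → α} {m : ℕ} (h : l <+: stream x m) :
    ∃ b ≤ m, parse l = (List.range b).map x := by
  have h1 := parse_prefix (α := α) h
  rw [parse_stream] at h1
  refine ⟨(parse l : List α).length, by simpa using h1.length_le, ?_⟩
  rw [List.prefix_iff_eq_take.1 h1, ← List.map_take, List.take_range]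
  have := h1.length_le
  simp at this
  simp [this]

end Wire

/-! ### Synchronous protocols and their asynchronous execution -/

/-- A synchronous protocol: in every round each node broadcasts its state to its neighbours and
then updates it. A node whose state has a `result` is done and keeps its state forever. -/
structure SyncProtocol (n q : ℕ) (α : Type) where
  init : LocalInput n q → Tape → α
  next : (inp : LocalInput n q) → Tape → α → (inp.nbrs → α) → α
  result : α → Option (Fin q)
  measurable_init : ∀ inp, MeasurableFibers (init inp)
  measurable_next : ∀ inp a g, MeasurableFibers fun r => next inp r a g

namespace SyncProtocol

variable {n q : ℕ} {α : Type} (P : SyncProtocol n q α)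

/-- The node is done. -/
def Done (a : α) : Prop := (P.result a).isSome

open Classical in
/-- The states in the synchronous execution. -/
def state (inp : Fin n → LocalInput n q) (tape : Fin n → Tape) : ℕ → Fin n → α
  | 0, v => P.init (inp v) (tape v)
  | k + 1, v =>
    if P.Done (state inp tape k v) then state inp tape k v
    else P.next (inp v) (tape v) (state inp tape k v) fun u => state inp tape k u

lemma Done.state_succ {P : SyncProtocol n q α} {inp : Fin n → LocalInput n q} {tape : Fin n → Tape}
    {k : ℕ} {v : Fin n} (h : P.Done (P.state inp tape k v)) :
    P.state inp tape (k + 1) v = P.state inp tape k v := by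
  simp [state, h]

lemma Done.state_eq {P : SyncProtocol n q α} {inp : Fin n → LocalInput n q} {tape : Fin n → Tape}
    {k m : ℕ} {v : Fin n} (h : P.Done (P.state inp tape k v)) (hkm : k ≤ m) :
    P.state inp tape m v = P.state inp tape k v := by
  induction m, hkm using Nat.le_induction with
  | base => rfl
  | succ m _ ih => rw [← ih]; exact Done.state_succ (by rwa [ih])

lemma exists_done_getLast {P : SyncProtocol n q α} {x : ℕ → α} {b : ℕ}
    (h : ∃ a ∈ ((List.range b).map x).getLast?, P.Done a) :
    0 < b ∧ P.Done (x (b - 1)) := by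
  obtain ⟨a, ha, hd⟩ := h
  cases b with
  | zero => simp at ha
  | succ b =>
    simp [List.range_succ] at ha
    subst ha
    simpa using hd

variable [Encodable α]

/-- The messages received from `u`. -/
def received (h : List (Fin n × Message)) (u : Fin n) : List Message :=
  (h.filter (·.1 = u)).map Prod.snd

/-- The states received from `u`. -/
def blocks (h : List (Fin n × Message)) (u : Fin n) : List α := parse (received h u)

/-- What is known of the state of `u` in round `k`; the last state received is extrapolated. -/
def view (h : List (Fin n × Message)) (a : α) (k : ℕ) (u : Fin n) : α :=
  (blocks h u).getD k ((blocks h u).getLastD a)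

open Classical in
/-- The states of a node as computed from its history. -/
def own (inp : LocalInput n q) (r : Tape) (h : List (Fin n × Message)) : ℕ → α
  | 0 => P.init inp r
  | k + 1 =>
    if P.Done (own inp r h k) then own inp r h k
    else P.next inp r (own inp r h k) fun u => view h (own inp r h k) k u

/-- The states of all neighbours in round `k` are known. -/
def Ready (inp : LocalInput n q) (h : List (Fin n × Message)) (k : ℕ) : Prop :=
  -- A node that is done sends nothing more, so its last state has to serve for all later rounds.
  ∀ u ∈ inp.nbrs, k < (blocks h u : List α).length ∨ ∃ a ∈ (blocks h u).getLast?, P.Done a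

/-- The current round: the first one that the node cannot leave. -/
def round (inp : LocalInput n q) (r : Tape) (h : List (Fin n × Message)) : ℕ :=
  sInf {k | P.Done (P.own inp r h k) ∨ ¬ P.Ready inp h k}

/-- The first round whose state was not sent before the latest event. -/
def firstUnsent (inp : LocalInput n q) (r : Tape) (h : List (Fin n × Message)) : ℕ :=
  -- The program is a function of the history, so the round reached before the latest event is
  -- recomputed from the history without its last entry.
  if h = [] then 0 else P.round inp r h.dropLast + 1

/-- The messages sent in response to the latest event. -/
def send (inp : LocalInput n q) (r : Tape) (h : List (Fin n × Message)) : List Message :=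
  (List.Ico (P.firstUnsent inp r h) (P.round inp r h + 1)).flatMap fun k => wire (P.own inp r h k)

/-- The value returned. -/
def output (inp : LocalInput n q) (r : Tape) (h : List (Fin n × Message)) : Option (Fin q) :=
  P.result (P.own inp r h (P.round inp r h))

section Measurability

variable (inp : LocalInput n q) (h : List (Fin n × Message))

lemma measurableFibers_own (k : ℕ) : MeasurableFibers fun r => P.own inp r h k := by
  classical
  induction k with
  | zero => exact P.measurable_init inp
  | succ k ih =>
    refine ih.bind (g := fun a r => if P.Done a then a else P.next inp r a fun u => view h a k u)
      fun a => ?_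
    by_cases ha : P.Done a
    · simpa [ha] using MeasurableFibers.const a
    · simpa [ha] using P.measurable_next inp a _

lemma measurableFibers_round : MeasurableFibers fun r => P.round inp r h :=
  MeasurableFibers.sInf_nat fun k =>
    (P.measurableFibers_own inp h k).comp fun a => P.Done a ∨ ¬ P.Ready inp h k

lemma measurableFibers_firstUnsent : MeasurableFibers fun r => P.firstUnsent inp r h := by
  by_cases hh : h = []
  · simpa [firstUnsent, hh] using MeasurableFibers.const 0
  · simpa [firstUnsent, hh] using (P.measurableFibers_round inp h.dropLast).comp (· + 1)

lemma measurableFibers_send : MeasurableFibers fun r => P.send inp r h := by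
  refine (P.measurableFibers_firstUnsent inp h).bind (g := fun i r =>
    (List.Ico i (P.round inp r h + 1)).flatMap fun k => wire (P.own inp r h k)) fun i => ?_
  refine (P.measurableFibers_round inp h).bind (g := fun j r =>
    (List.Ico i (j + 1)).flatMap fun k => wire (P.own inp r h k)) fun j => ?_
  simp only [List.flatMap_def]
  exact (MeasurableFibers.listMap (List.Ico i (j + 1)) (f := fun k r => wire (P.own inp r h k))
    fun k _ => (P.measurableFibers_own inp h k).comp wire).comp List.flatten

lemma measurableFibers_output : MeasurableFibers fun r => P.output inp r h :=
  (P.measurableFibers_round inp h).bind (g := fun j r => P.result (P.own inp r h j))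
    fun j => (P.measurableFibers_own inp h j).comp P.result

end Measurability

/-- The distributed algorithm that runs a family of synchronous protocols: every node enters the
next round as soon as it knows the states of all its neighbours. -/
def toAlgorithm {β : ℕ → Type} [∀ q, Encodable (β q)] (P : ∀ n q, SyncProtocol n q (β q)) :
    DistAlgorithm where
  send inp r h _ := (P _ _).send inp r h
  output inp r h := (P _ _).output inp r h
  measurable_send inp h _ l := (P _ _).measurableFibers_send inp h l
  measurable_output inp h o := (P _ _).measurableFibers_output inp h o

/-- The states received by `v` are true initial segments of the state sequences of its
neighbours. -/
def Genuine (inp : Fin n → LocalInput n q) (tape : Fin n → Tape) (v : Fin n)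
    (h : List (Fin n × Message)) : Prop :=
  ∀ u ∈ (inp v).nbrs, ∃ b, blocks h u = (List.range b).map fun k => P.state inp tape k u

section Genuine

variable {P} {inp : Fin n → LocalInput n q} {tape : Fin n → Tape} {v : Fin n}
  {h h' : List (Fin n × Message)}

/-- In each round the state of a neighbour has been received, or its last received state is done and
hence frozen, so that extrapolating it gives the true state. -/
lemma Genuine.own_eq (hg : P.Genuine inp tape v h) {k : ℕ} (hr : ∀ j < k, P.Ready (inp v) h j) :
    P.own (inp v) (tape v) h k = P.state inp tape k v := by
  induction k with
  | zero => rfl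
  | succ k ih =>
    have hk := ih fun j hj => hr j (by omega)
    simp only [own, state, hk]
    congr 2
    ext u
    obtain ⟨b, hb⟩ := hg u u.2
    rcases hr k (by omega) u u.2 with hlt | hlast
    · rw [hb] at hlt
      simp only [List.length_map, List.length_range] at hlt
      simp [view, hb, hlt, List.getD]
    · rw [hb] at hlast
      obtain ⟨hb0, hd⟩ := exists_done_getLast hlast
      by_cases hlt : k < b
      · simp [view, hb, hlt, List.getD]
      · rw [hd.state_eq (m := k) (by omega)]
        obtain ⟨b, rfl⟩ := Nat.exists_eq_succ_of_ne_zero hb0.ne'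
        simp only [Nat.succ_eq_add_one, not_lt] at hlt
        have hn : ((List.range (b + 1)).map fun k => P.state inp tape k u)[k]? = none := by
          simp; omega
        simp only [view, hb, List.getD, Nat.succ_eq_add_one, hn]
        simp [List.range_succ]

lemma Genuine.ready_mono (hg : P.Genuine inp tape v h) (hg' : P.Genuine inp tape v h')
    (hh : ∀ u, (blocks h u : List α) <+: blocks h' u) {k : ℕ} (hr : P.Ready (inp v) h k) :
    P.Ready (inp v) h' k := by
  intro u hu
  rcases hr u hu with h1 | h1
  · exact Or.inl (h1.trans_le (hh u).length_le)
  · obtain ⟨b, hb⟩ := hg u hu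
    obtain ⟨b', hb'⟩ := hg' u hu
    have hle := (hh u).length_le
    rw [hb] at h1
    obtain ⟨h0, hd⟩ := exists_done_getLast h1
    rw [hb, hb'] at hle
    simp only [List.length_map, List.length_range] at hle
    refine Or.inr ⟨P.state inp tape (b' - 1) u, ?_, ?_⟩
    · rw [hb']
      obtain ⟨c, rfl⟩ := Nat.exists_eq_succ_of_ne_zero (show b' ≠ 0 by omega)
      simp [List.range_succ]
    · rw [hd.state_eq (m := b' - 1) (by omega)]
      exact hd

/-- The current round is well defined when the synchronous execution terminates. -/
lemma Genuine.round_spec (hg : P.Genuine inp tape v h) {m : ℕ}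
    (hm : P.Done (P.state inp tape m v)) :
    (∀ j < P.round (inp v) (tape v) h, ¬ P.Done (P.state inp tape j v) ∧ P.Ready (inp v) h j) ∧
    (P.Done (P.state inp tape (P.round (inp v) (tape v) h) v) ∨
      ¬ P.Ready (inp v) h (P.round (inp v) (tape v) h)) := by
  have hne : {k | P.Done (P.own (inp v) (tape v) h k) ∨ ¬ P.Ready (inp v) h k}.Nonempty := by
    by_contra hcon
    rw [Set.not_nonempty_iff_eq_empty, Set.eq_empty_iff_forall_notMem] at hcon
    simp only [Set.mem_ofPred_eq, not_or, not_not] at hcon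
    exact (hcon m).1 (by rwa [hg.own_eq fun j _ => (hcon j).2])
  have hlt : ∀ j < P.round (inp v) (tape v) h,
      ¬ P.Done (P.own (inp v) (tape v) h j) ∧ P.Ready (inp v) h j := by
    intro j hj
    have := Nat.notMem_of_lt_sInf hj
    simpa only [Set.mem_ofPred_eq, not_or, not_not] using this
  have hown : ∀ j ≤ P.round (inp v) (tape v) h,
      P.own (inp v) (tape v) h j = P.state inp tape j v := fun j hj =>
    hg.own_eq fun i hi => (hlt i (by omega)).2
  refine ⟨fun j hj => ?_, ?_⟩
  · rw [← hown j hj.le]; exact hlt j hj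
  · have := Nat.sInf_mem hne
    rw [← hown _ le_rfl]
    exact this

lemma Genuine.own_eq_state (hg : P.Genuine inp tape v h) {m : ℕ}
    (hm : P.Done (P.state inp tape m v)) {k : ℕ} (hk : k ≤ P.round (inp v) (tape v) h) :
    P.own (inp v) (tape v) h k = P.state inp tape k v :=
  hg.own_eq fun j hj => ((hg.round_spec hm).1 j (by omega)).2

lemma Genuine.round_le (hg : P.Genuine inp tape v h) {m : ℕ}
    (hm : P.Done (P.state inp tape m v)) : P.round (inp v) (tape v) h ≤ m := by
  by_contra hlt
  exact ((hg.round_spec hm).1 m (by omega)).1 hm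

lemma Genuine.le_round (hg : P.Genuine inp tape v h) {m : ℕ}
    (hm : P.Done (P.state inp tape m v)) {k : ℕ}
    (hk : ∀ j < k, ¬ P.Done (P.state inp tape j v) ∧ P.Ready (inp v) h j) :
    k ≤ P.round (inp v) (tape v) h := by
  by_contra hlt
  obtain ⟨h1, h2⟩ := hk _ (not_le.1 hlt)
  rcases (hg.round_spec hm).2 with h3 | h3
  · exact h1 h3
  · exact h3 h2

lemma Genuine.round_mono (hg : P.Genuine inp tape v h) (hg' : P.Genuine inp tape v h')
    (hh : ∀ u, (blocks h u : List α) <+: blocks h' u) {m : ℕ}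
    (hm : P.Done (P.state inp tape m v)) :
    P.round (inp v) (tape v) h ≤ P.round (inp v) (tape v) h' :=
  hg'.le_round hm fun j hj =>
    ⟨((hg.round_spec hm).1 j hj).1, hg.ready_mono hg' hh ((hg.round_spec hm).1 j hj).2⟩

lemma Genuine.output_eq (hg : P.Genuine inp tape v h) {m : ℕ}
    (hm : P.Done (P.state inp tape m v)) : P.output (inp v) (tape v) h =
      P.result (P.state inp tape (P.round (inp v) (tape v) h) v) := by
  rw [output, hg.own_eq_state hm le_rfl]

end Genuine

end SyncProtocol

/-! ### Correctness and running time of the asynchronous execution. -/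

namespace Run

open SyncProtocol

variable {n q : ℕ} {α : Type} [Encodable α] (R : Run n q) (P : SyncProtocol n q α)

/-- The algorithm of the run is the asynchronous execution of `P`. -/
structure Executes : Prop where
  send_eq : ∀ inp r h u, R.alg.send inp r h u = P.send inp r h
  output_eq : ∀ inp r h, R.alg.output inp r h = P.output inp r h

/-- The states in the synchronous execution. -/
def syncState (k : ℕ) (v : Fin n) : α := P.state R.localInput R.tape k v

/-- The current round of `v`. -/
def roundOf (s : Config n) (v : Fin n) : ℕ := P.round (R.localInput v) (R.tape v) (s.hist v)

/-- All messages that `v` has sent on each of its channels. -/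
def sentStream (s : Config n) (v : Fin n) : List Message :=
  stream (fun k => R.syncState P k v) (R.roundOf P s v + 1)

variable {R P}

lemma map_mapIdx_eq_self {β γ : Type*} {f : ℕ → β → γ} {g : γ → β} (h : ∀ i b, g (f i b) = b)
    {l : List β} : (l.mapIdx f).map g = l :=
  List.ext_getElem (by simp) fun i _ _ => by simp [h]

lemma emit_chan_mem {A : Set (Fin n)} {s : Config n} {u v : Fin n} {p : Packet}
    (hp : p ∈ (R.emit A s).chan u v) :
    p ∈ s.chan u v ∨ p.body ∈ R.batch s u v := by
  simp only [emit] at hp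
  split_ifs at hp
  · rw [List.mem_append, List.mem_mapIdx] at hp
    rcases hp with hp | ⟨i, hi, rfl⟩
    · exact Or.inl hp
    · exact Or.inr (List.getElem_mem hi)
  · exact Or.inl hp

lemma deliver_chan_mem {s : Config n} {u v : Fin n} {p : Packet} {rest : List Packet}
    (hc : s.chan u v = p :: rest) {u' v' : Fin n} {p' : Packet}
    (hp : p' ∈ (R.deliver s u v p rest).chan u' v') :
    p' ∈ s.chan u' v' ∨ ∃ s' : Config n, p'.body ∈ R.batch s' u' v' := by
  have key : ∀ p' ∈ Function.update s.chan u (Function.update (s.chan u) v rest) u' v',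
      p' ∈ s.chan u' v' := by
    intro p' hp'
    by_cases hu : u' = u
    · subst hu
      by_cases hv : v' = v
      · subst hv; simp at hp'; simp [hc, hp']
      · simpa [hv] using hp'
    · simpa [hu] using hp'
  simp only [deliver] at hp
  split_ifs at hp
  · exact Or.inl (key _ hp)
  · rcases emit_chan_mem hp with hp | hp
    · exact Or.inl (key _ hp)
    · exact Or.inr ⟨_, hp⟩

/-- All messages have at most one bit. -/
lemma Executes.length_body_le_one (hR : R.Executes P) {s : Config n} (hs : R.Reachable s)
    {u v : Fin n} {p : Packet} (hp : p ∈ s.chan u v) : p.body.length ≤ 1 := by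
  have hb : ∀ (s : Config n) (u v : Fin n) (m : Message), m ∈ R.batch s u v → m.length ≤ 1 := by
    intro s u v m hm
    rw [batch, hR.send_eq, SyncProtocol.send, List.mem_flatMap] at hm
    obtain ⟨k, -, hk⟩ := hm
    exact length_le_one_of_mem_wire hk
  induction hs generalizing u v p with
  | refl =>
    rcases emit_chan_mem hp with hp | hp
    · simp at hp
    · exact hb _ _ _ _ hp
  | tail _ hstep ih =>
    obtain ⟨-, u', v', p', rest, hc, -, rfl⟩ := hstep
    rcases deliver_chan_mem hc hp with hp | ⟨s', hp⟩
    · exact ih hp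
    · exact hb _ _ _ _ hp

variable (R P)

/-- The invariant of asynchronous executions of `P`, provided that the synchronous execution takes
at most `m` rounds. -/
structure Invariant (m : ℕ) (s : Config n) : Prop where
  chan_not_adj : ∀ u v, ¬ R.M.G.Adj u v → s.chan u v = []
  sent_not_adj : ∀ u v, ¬ R.M.G.Adj u v → s.sent u v = 0
  -- Here `d` is the part of the stream that has been delivered. The history may fall behind it only
  -- when `v` is done, since a terminated node ignores messages.
  split : ∀ u v, R.M.G.Adj u v → ∃ d,
    d ++ (s.chan u v).map Packet.body = R.sentStream P s u ∧ received (s.hist v) u <+: d ∧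
    (¬ P.Done (R.syncState P (R.roundOf P s v) v) → received (s.hist v) u = d)
  sent : ∀ u v, R.M.G.Adj u v → s.sent u v = (R.sentStream P s u).length
  -- Here `x` is the position of `p` in the stream, so the number of complete codes before it is the
  -- round whose state `p` helps to transmit. The state of round `k` is thus sent by time `k` time
  -- units.
  timing : ∀ u v, R.M.G.Adj u v → ∀ pre p post, s.chan u v = pre ++ p :: post →
    ∃ x, x + post.length + 1 = (R.sentStream P s u).length ∧
      p.sentAt ≤ (parse ((R.sentStream P s u).take x) : List α).length * s.timeUnit
  now_le : s.now ≤ (m + 2) * s.timeUnit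

variable {R P}

lemma Invariant.genuine {m : ℕ} {s : Config n} (hI : R.Invariant P m s) (v : Fin n) :
    P.Genuine R.localInput R.tape v (s.hist v) := by
  intro u hu
  have hadj : R.M.G.Adj u v := SimpleGraph.Adj.symm hu
  obtain ⟨d, hd, hpre, -⟩ := hI.split u v hadj
  have : received (s.hist v) u <+: R.sentStream P s u := hpre.trans ⟨_, hd⟩
  obtain ⟨b, -, hb⟩ := parse_eq_of_prefix_stream this
  exact ⟨b, hb⟩

variable {m : ℕ}

lemma Invariant.roundOf_le (hm : ∀ v, P.Done (R.syncState P m v)) {s : Config n} (hI : R.Invariant P m s) (v : Fin n) :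
    R.roundOf P s v ≤ m := (hI.genuine v).round_le (hm v)

lemma Invariant.output_eq (hR : R.Executes P) (hm : ∀ v, P.Done (R.syncState P m v)) {s : Config n} (hI : R.Invariant P m s) (v : Fin n) :
    R.output s v = P.result (R.syncState P (R.roundOf P s v) v) := by
  rw [output, hR.output_eq]; exact (hI.genuine v).output_eq (hm v)

lemma Invariant.start (hR : R.Executes P) (hm : ∀ v, P.Done (R.syncState P m v)) :
    R.Invariant P m R.start := by
  have hg : ∀ v, P.Genuine R.localInput R.tape v [] := fun v u _ =>
    ⟨0, by simp [blocks, received, parse, parseFrom]⟩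
  have hsend : ∀ u, P.send (R.localInput u) (R.tape u) [] =
      stream (fun k => R.syncState P k u) (P.round (R.localInput u) (R.tape u) [] + 1) := by
    intro u
    rw [SyncProtocol.send, stream, ← List.Ico.zero_bot, firstUnsent, if_pos rfl,
      List.flatMap_def, List.flatMap_def]
    congr 1
    refine List.map_congr_left fun k hk => ?_
    rw [(hg u).own_eq_state (hm u) (by have := (List.Ico.mem.1 hk).2; omega)]
    rfl
  have hbody : ∀ u v, R.M.G.Adj u v → (R.start.chan u v).map Packet.body =
      R.sentStream P R.start u := by
    intro u v huv
    simp only [Run.start, emit, Set.mem_univ, true_and, huv, if_true, List.nil_append, sentStream,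
      roundOf, batch, hR.send_eq, hsend]
    exact map_mapIdx_eq_self fun _ _ => rfl
  refine ⟨fun u v huv => by simp [Run.start, emit, huv], fun u v huv => by
    simp [Run.start, emit, huv], fun u v huv => ⟨[], ?_, ?_, ?_⟩, fun u v huv => ?_,
    fun u v huv pre p post hp => ?_, by simp [Run.start, emit]⟩
  · simpa using hbody u v huv
  · simp [Run.start, emit, received]
  · simp [Run.start, emit, received]
  · simp [Run.start, emit, huv, sentStream, roundOf, batch, hR.send_eq, hsend]
  · have h1 := congrArg List.length (hbody u v huv)
    refine ⟨(R.sentStream P R.start u).length - (post.length + 1), ?_, ?_⟩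
    · rw [← h1, hp]; simp; omega
    · have : p ∈ R.start.chan u v := by rw [hp]; simp
      simp only [Run.start, emit, Set.mem_univ, true_and, huv, if_true, List.nil_append,
        List.mem_mapIdx] at this
      obtain ⟨i, hi, rfl⟩ := this
      simp

/-- The messages sent by a node in response to a delivery. -/
lemma send_append (hm : ∀ v, P.Done (R.syncState P m v)) {v : Fin n}
    {h : List (Fin n × Message)} {x : Fin n × Message}
    (hg : P.Genuine R.localInput R.tape v h) (hg' : P.Genuine R.localInput R.tape v (h ++ [x])) :
    P.round (R.localInput v) (R.tape v) h ≤ P.round (R.localInput v) (R.tape v) (h ++ [x]) ∧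
    stream (fun k => R.syncState P k v) (P.round (R.localInput v) (R.tape v) (h ++ [x]) + 1) =
      stream (fun k => R.syncState P k v) (P.round (R.localInput v) (R.tape v) h + 1) ++
        P.send (R.localInput v) (R.tape v) (h ++ [x]) := by
  have hle := hg.round_mono hg' (fun u => parse_prefix (by simp [received])) (hm v)
  refine ⟨hle, ?_⟩
  rw [stream_append _ (Nat.add_le_add_right hle 1), SyncProtocol.send, firstUnsent,
    if_neg (by simp), List.dropLast_concat, List.flatMap_def, List.flatMap_def]
  congr 2
  refine List.map_congr_left fun k hk => ?_
  rw [hg'.own_eq_state (hm v) (by have := (List.Ico.mem.1 hk).2; omega)]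
  rfl

section Deliver

variable {s : Config n} {u v : Fin n} {p : Packet} {rest : List Packet}

/-- The state of the channels after the delivery of a packet, before new messages are sent. -/
lemma Invariant.of_dequeue (hm : ∀ v, P.Done (R.syncState P m v)) (hI : R.Invariant P m s)
    (hc : s.chan u v = p :: rest) :
    R.M.G.Adj u v ∧
    (p.sentAt ≤ (parse ((R.sentStream P s u).take
      ((R.sentStream P s u).length - (rest.length + 1))) : List α).length * s.timeUnit ∧
    max s.now p.readyAt ≤
      (m + 2) * max s.timeUnit (max s.now p.readyAt - p.sentAt)) := by
  have hadj : R.M.G.Adj u v := by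
    by_contra h
    rw [hI.chan_not_adj u v h] at hc
    cases hc
  refine ⟨hadj, ?_⟩
  obtain ⟨x, hx, hp⟩ := hI.timing u v hadj [] p rest (by simpa using hc)
  rw [show (R.sentStream P s u).length - (rest.length + 1) = x by omega]
  refine ⟨hp, ?_⟩
  set D := max s.timeUnit (max s.now p.readyAt - p.sentAt)
  obtain ⟨b, hb, hpb⟩ := parse_eq_of_prefix_stream (x := fun k => R.syncState P k u)
    (m := R.roundOf P s u + 1) (List.take_prefix x (R.sentStream P s u))
  rw [hpb] at hp
  have hbm : b ≤ m + 1 := hb.trans (Nat.add_le_add_right (hI.roundOf_le hm u) 1)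
  have hbm' : (b : ℝ≥0) ≤ m + 1 := by exact_mod_cast hbm
  have hD : s.timeUnit ≤ D := le_max_left _ _
  -- At most `m + 1` codes precede `p`, so it was sent by time `(m + 1) * D`, and its own transit
  -- takes at most `D`.
  calc max s.now p.readyAt ≤ p.sentAt + (max s.now p.readyAt - p.sentAt) := le_add_tsub
    _ ≤ (m + 1) * D + D := by
        refine add_le_add (hp.trans ?_) (le_max_right _ _)
        simp only [List.length_map, List.length_range]
        gcongr
    _ = (m + 2) * D := by ring

/-- The point is the timing of new packets. If the delivery lets the receiver leave round `r`, then
the sender's state of round `r` was what was missing, so the delivered packet belongs to a round at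
most `r` and was sent by time `r * D`. It arrives by time `(r + 1) * D`, and the packets sent in
response belong to round `r + 1` or later. -/
lemma Invariant.deliver (hR : R.Executes P) (hm : ∀ v, P.Done (R.syncState P m v))
    (hI : R.Invariant P m s) (hc : s.chan u v = p :: rest) :
    R.Invariant P m (R.deliver s u v p rest) := by
  obtain ⟨hadj, hsentAt, hnow⟩ := hI.of_dequeue hm hc
  have huv : u ≠ v := hadj.ne
  set t := max s.now p.readyAt with ht
  set D := max s.timeUnit (t - p.sentAt) with hD
  have hDs : s.timeUnit ≤ D := le_max_left _ _
  set ch := Function.update s.chan u (Function.update (s.chan u) v rest) with hch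
  have hchuv : ch u v = rest := by simp [hch]
  have hchne : ∀ a b, (a ≠ u ∨ b ≠ v) → ch a b = s.chan a b := by
    intro a b hab
    by_cases ha : a = u
    · subst ha
      simp [hch, show b ≠ v by simpa using hab]
    · simp [hch, ha]
  have hchv : ∀ b, ch v b = s.chan v b := fun b => hchne v b (Or.inl huv.symm)
  -- facts on the channels that do not depend on whether `v` responds
  have hchnot : ∀ a b, ¬ R.M.G.Adj a b → ch a b = [] := by
    intro a b hab
    rw [hchne a b ?_]
    · exact hI.chan_not_adj a b hab
    · by_contra hcon
      push Not at hcon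
      exact hab (hcon.1 ▸ hcon.2 ▸ hadj)
  have htiming : ∀ a b, R.M.G.Adj a b → ∀ pre p' post, ch a b = pre ++ p' :: post →
      ∃ x, x + post.length + 1 = (R.sentStream P s a).length ∧
      p'.sentAt ≤ (parse ((R.sentStream P s a).take x) : List α).length * D := by
    intro a b hab pre p' post hp'
    have : ∃ pre', s.chan a b = pre' ++ p' :: post := by
      by_cases hne : a ≠ u ∨ b ≠ v
      · exact ⟨pre, by rw [← hchne a b hne, hp']⟩
      · push Not at hne
        obtain ⟨rfl, rfl⟩ := hne
        refine ⟨p :: pre, ?_⟩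
        rw [hchuv] at hp'
        rw [hc, hp']; rfl
    obtain ⟨pre', hpre'⟩ := this
    obtain ⟨x, hx, hle⟩ := hI.timing a b hab pre' p' post hpre'
    exact ⟨x, hx, hle.trans (by gcongr)⟩
  by_cases hout : (R.output s v).isSome
  · have hdel : R.deliver s u v p rest = { s with now := t, timeUnit := D, chan := ch } := by
      simp only [Run.deliver, hout, if_true]; rfl
    rw [hdel]
    refine ⟨hchnot, hI.sent_not_adj, fun a b hab => ?_, hI.sent, htiming, hnow⟩
    obtain ⟨d, hd, hpre, heq⟩ := hI.split a b hab
    by_cases hne : a ≠ u ∨ b ≠ v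
    · refine ⟨d, ?_, hpre, heq⟩
      change d ++ (ch a b).map Packet.body = _
      rw [hchne a b hne]
      exact hd
    · push Not at hne
      obtain ⟨rfl, rfl⟩ := hne
      refine ⟨d ++ [p.body], ?_, hpre.trans (List.prefix_append _ _), fun hnd => ?_⟩
      · simp only [hchuv]
        rw [hc] at hd
        rw [List.append_assoc]
        exact hd
      · rw [hI.output_eq hR hm] at hout
        exact absurd hout hnd
  · set h' := s.hist v ++ [(u, p.body)] with hh'
    set s₁ : Config n := { s with
      now := t
      timeUnit := D
      chan := ch
      hist := Function.update s.hist v h' } with hs₁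
    have hdel : R.deliver s u v p rest = R.emit {v} s₁ := by
      simp only [Run.deliver, hout]; rfl
    have hnd : ¬ P.Done (R.syncState P (R.roundOf P s v) v) := by
      rw [hI.output_eq hR hm] at hout
      exact hout
    have hrecne : ∀ b, b ≠ u → received h' b = received (s.hist v) b := by
      intro b hb
      simp [received, hh', List.filter_append, hb.symm]
    have hrecu : received h' u = received (s.hist v) u ++ [p.body] := by
      simp [received, hh', List.filter_append]
    have hgen' : P.Genuine R.localInput R.tape v h' := by
      intro b hb
      have hbv : R.M.G.Adj b v := SimpleGraph.Adj.symm hb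
      obtain ⟨d, hd, hpre, heq⟩ := hI.split b v hbv
      have hpref : received h' b <+: R.sentStream P s b := by
        by_cases hbu : b = u
        · subst hbu
          rw [hrecu, heq hnd, ← hd, hc]
          simp
        · rw [hrecne b hbu]
          exact hpre.trans ⟨_, hd⟩
      obtain ⟨k, -, hk⟩ := parse_eq_of_prefix_stream hpref
      exact ⟨k, hk⟩
    obtain ⟨hrle, hstr⟩ := send_append hm (hI.genuine v) hgen'
    set batch := P.send (R.localInput v) (R.tape v) h' with hbatch
    have hstr' : R.sentStream P (R.emit {v} s₁) v = R.sentStream P s v ++ batch := by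
      simpa [sentStream, roundOf, emit, hs₁] using hstr
    have hstrne : ∀ a, a ≠ v → R.sentStream P (R.emit {v} s₁) a = R.sentStream P s a := by
      intro a ha
      simp [sentStream, roundOf, emit, hs₁, ha]
    have hb₁ : ∀ b, R.batch s₁ v b = batch := by
      intro b; simp [Run.batch, hR.send_eq, hs₁, hbatch]
    have hchanne : ∀ a b, a ≠ v → (R.emit {v} s₁).chan a b = ch a b := by
      intro a b ha; simp [emit, ha, hs₁]
    have hchanv : ∀ b, R.M.G.Adj v b → (R.emit {v} s₁).chan v b = s.chan v b ++
        batch.mapIdx fun i m =>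
          { body := m, sentAt := t, readyAt := t + R.delay v b (s.sent v b + i) } := by
      intro b hb
      rw [← hb₁ b, ← hchv b]
      simp only [emit, Set.mem_singleton_iff, true_and, hb, if_true]
      rfl
    have hhistne : ∀ b, b ≠ v → (R.emit {v} s₁).hist b = s.hist b := by
      intro b hb; simp [emit, hs₁, hb]
    have hhistv : (R.emit {v} s₁).hist v = h' := by simp [emit, hs₁]
    rw [hdel]
    refine ⟨fun a b hab => ?_, fun a b hab => ?_, fun a b hab => ?_, fun a b hab => ?_,
      fun a b hab pre p' post hp' => ?_, hnow⟩
    · simp only [emit, hab, and_false, if_false]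
      exact hchnot a b hab
    · simp only [emit, hab, and_false, if_false]
      exact hI.sent_not_adj a b hab
    · obtain ⟨d, hd, hpre, heq⟩ := hI.split a b hab
      by_cases hav : a = v
      · subst hav
        have hba : b ≠ a := hab.ne'
        refine ⟨d, ?_, by rwa [hhistne b hba], fun h => ?_⟩
        · rw [hchanv b hab, hstr', List.map_append, ← List.append_assoc, hd,
            map_mapIdx_eq_self fun _ _ => rfl]
        · rw [hhistne b hba]
          apply heq
          simpa [roundOf, hhistne b hba] using h
      · rw [hchanne a b hav, hstrne a hav]
        by_cases hbv : b = v
        · subst hbv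
          rw [hhistv]
          by_cases hau : a = u
          · subst hau
            refine ⟨d ++ [p.body], ?_, ?_, fun _ => ?_⟩
            · rw [hchuv, List.append_assoc, ← hd, hc]; rfl
            · rw [hrecu, heq hnd]
            · rw [hrecu, heq hnd]
          · rw [hrecne a hau, hchne a b (Or.inl hau)]
            exact ⟨d, hd, hpre, fun _ => heq hnd⟩
        · rw [hhistne b hbv, hchne a b (Or.inr hbv)]
          refine ⟨d, hd, hpre, fun h => heq ?_⟩
          simpa [roundOf, hhistne b hbv] using h
    · by_cases hav : a = v
      · subst hav
        rw [hstr', List.length_append, ← hI.sent a b hab]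
        rw [← hb₁ b]
        simp only [emit, Set.mem_singleton_iff, true_and, hab, if_true]
        rfl
      · rw [hstrne a hav, ← hI.sent a b hab]
        simp [emit, hs₁, hav]
    · by_cases hav : a = v
      · subst hav
        rw [hchanv b hab] at hp'
        rw [hstr']
        obtain ⟨d, hd, -, -⟩ := hI.split a b hab
        have hlen : (s.chan a b).length ≤ (R.sentStream P s a).length := by
          rw [← hd]; simp
        have hcases : ∀ {l l' : List Packet}, l ++ l' = pre ++ p' :: post →
            (∃ c, pre = l ++ c ∧ l' = c ++ p' :: post) ∨
            ∃ c, l = pre ++ p' :: c ∧ post = c ++ l' := by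
          intro l l' h
          rcases List.append_eq_append_iff.1 h with ⟨c, h1, h2⟩ | ⟨c, h1, h2⟩
          · exact Or.inl ⟨c, h1, h2⟩
          · cases c with
            | nil => exact Or.inl ⟨[], by simp [h1], by simpa using h2.symm⟩
            | cons p'' c =>
              simp only [List.cons_append, List.cons.injEq] at h2
              obtain ⟨rfl, rfl⟩ := h2
              exact Or.inr ⟨c, h1, rfl⟩
        rcases hcases hp' with ⟨c, hc1, hc2⟩ | ⟨c, hc1, hc2⟩
        · -- `p'` is new
          have hmem : p' ∈ batch.mapIdx fun i m =>
              ({ body := m, sentAt := t, readyAt := t + R.delay a b (s.sent a b + i) } :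
                Packet) := by rw [hc2]; simp
          obtain ⟨i, hi, rfl⟩ := List.mem_mapIdx.1 hmem
          have hl := congrArg List.length hc2
          simp only [List.length_mapIdx, List.length_append, List.length_cons] at hl
          refine ⟨(R.sentStream P s a).length + c.length, by
            rw [List.length_append]; omega, ?_⟩
          have hpre : R.sentStream P s a <+:
              (R.sentStream P s a ++ batch).take ((R.sentStream P s a).length + c.length) := by
            rw [List.take_append, List.take_of_length_le (by omega)]
            exact List.prefix_append _ _
          have hparse := (parse_prefix (α := α) hpre).length_le
          rw [sentStream, parse_stream, List.length_map, List.length_range] at hparse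
          -- If the round had not advanced, the stream would not have grown and there would be no
          -- new packet.
          have hlt : R.roundOf P s a < P.round (R.localInput a) (R.tape a) h' := by
            by_contra hcon
            have heq : P.round (R.localInput a) (R.tape a) (s.hist a) =
              P.round (R.localInput a) (R.tape a) h' := le_antisymm hrle (not_lt.1 hcon)
            have := congrArg List.length hstr
            rw [← heq, List.length_append] at this
            omega
          have hr' := ((hgen'.round_spec (hm a)).1 _ hlt).2
          have hr : ¬ P.Ready (R.localInput a) (s.hist a) (R.roundOf P s a) :=
            ((hI.genuine a).round_spec (hm a)).2.resolve_left hnd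
          -- The node was not ready and now it is, while only the messages from `u` have changed.
          have hbu : (blocks (s.hist a) u : List α).length ≤ R.roundOf P s a := by
            by_contra hcon
            refine hr fun w hw => ?_
            by_cases hwu : w = u
            · subst hwu; exact Or.inl (not_le.1 hcon)
            · have := hr' w hw
              rwa [blocks, hrecne w hwu] at this
          obtain ⟨d', hd', -, heq'⟩ := hI.split u a hadj
          have htake : (R.sentStream P s u).take
              ((R.sentStream P s u).length - (rest.length + 1)) = received (s.hist a) u := by
            rw [heq' hnd, ← hd', hc]
            simp
          rw [htake] at hsentAt
          rw [blocks] at hbu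
          have hbu' : ((parse (received (s.hist a) u) : List α).length : ℝ≥0) ≤
            R.roundOf P s a := by exact_mod_cast hbu
          have hparse' : ((R.roundOf P s a : ℝ≥0) + 1) ≤ ((parse
              ((R.sentStream P s a ++ batch).take ((R.sentStream P s a).length + c.length)) :
                List α).length : ℝ≥0) := by exact_mod_cast hparse
          calc t ≤ p.sentAt + (t - p.sentAt) := le_add_tsub
            _ ≤ R.roundOf P s a * D + D :=
                add_le_add (hsentAt.trans (by gcongr)) (le_max_right _ _)
            _ = (R.roundOf P s a + 1) * D := by ring
            _ ≤ _ := by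
              change _ ≤ _ * D
              gcongr
        · obtain ⟨x, hx, hle⟩ := htiming a b hab pre p' c (by rw [hchv, hc1])
          refine ⟨x, ?_, ?_⟩
          · rw [hc2, List.length_append, List.length_mapIdx, List.length_append]; omega
          · rw [List.take_append_of_le_length (by omega)]
            exact hle
      · rw [hchanne a b hav] at hp'
        rw [hstrne a hav]
        exact htiming a b hab pre p' post hp'

lemma Invariant.of_reachable (hR : R.Executes P) (hm : ∀ v, P.Done (R.syncState P m v))
    {s : Config n} (hs : R.Reachable s) : R.Invariant P m s := by
  induction hs with
  | refl => exact Invariant.start hR hm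
  | tail _ hstep ih =>
    obtain ⟨-, u', v', p', rest, hc, -, rfl⟩ := hstep
    exact ih.deliver hR hm hc

/-- The number of messages that have been delivered. -/
def delivered (s : Config n) : ℕ := ∑ u, ∑ v, (s.sent u v - (s.chan u v).length)

lemma Invariant.length_chan_le (hI : R.Invariant P m s) (a b : Fin n) :
    (s.chan a b).length ≤ s.sent a b := by
  by_cases hab : R.M.G.Adj a b
  · obtain ⟨d, hd, -, -⟩ := hI.split a b hab
    rw [hI.sent a b hab, ← hd]; simp
  · simp [hI.chan_not_adj a b hab]

lemma Invariant.delivered_deliver (hI : R.Invariant P m s) {u v : Fin n} {p : Packet}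
    {rest : List Packet} (hc : s.chan u v = p :: rest) :
    delivered (R.deliver s u v p rest) = delivered s + 1 := by
  have key : ∀ a b, (R.deliver s u v p rest).sent a b -
      ((R.deliver s u v p rest).chan a b).length = s.sent a b -
      (Function.update s.chan u (Function.update (s.chan u) v rest) a b).length := by
    intro a b
    simp only [Run.deliver]
    split_ifs with h
    · rfl
    · simp only [emit]
      split_ifs with hab
      · simp only [List.length_append, List.length_mapIdx]
        omega
      · rfl
  have hlen := hI.length_chan_le u v
  rw [hc] at hlen
  simp only [List.length_cons] at hlen
  simp only [delivered, key]
  rw [← Finset.add_sum_erase _ _ (Finset.mem_univ u), ← Finset.add_sum_erase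
    _ (fun a => ∑ b, (s.sent a b - (s.chan a b).length)) (Finset.mem_univ u),
    ← Finset.add_sum_erase _ _ (Finset.mem_univ v), ← Finset.add_sum_erase
    _ (fun b => (s.sent u b - (s.chan u b).length)) (Finset.mem_univ v)]
  have h1 : ∑ x ∈ Finset.univ.erase v, (s.sent u x - (Function.update s.chan u
      (Function.update (s.chan u) v rest) u x).length) =
      ∑ x ∈ Finset.univ.erase v, (s.sent u x - (s.chan u x).length) :=
    Finset.sum_congr rfl fun x hx => by simp [Finset.ne_of_mem_erase hx]
  have h2 : ∑ x ∈ Finset.univ.erase u, ∑ b, (s.sent x b - (Function.update s.chan u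
      (Function.update (s.chan u) v rest) x b).length) =
      ∑ x ∈ Finset.univ.erase u, ∑ b, (s.sent x b - (s.chan x b).length) :=
    Finset.sum_congr rfl fun x hx => by simp [Finset.ne_of_mem_erase hx]
  rw [h1, h2, hc]
  simp only [Function.update_self, List.length_cons]
  omega

lemma stream_length_mono (x : ℕ → α) {k k' : ℕ} (h : k ≤ k') :
    (stream x k).length ≤ (stream x k').length := by
  rw [stream_append x h]; simp

lemma Invariant.delivered_le (hm : ∀ v, P.Done (R.syncState P m v)) (hI : R.Invariant P m s) :
    delivered s ≤ ∑ u : Fin n, ∑ _v : Fin n,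
      (stream (fun k => R.syncState P k u) (m + 1)).length := by
  refine Finset.sum_le_sum fun u _ => Finset.sum_le_sum fun v _ => (Nat.sub_le _ _).trans ?_
  by_cases huv : R.M.G.Adj u v
  · rw [hI.sent u v huv]
    exact stream_length_mono _ (Nat.add_le_add_right (hI.roundOf_le hm u) 1)
  · simp [hI.sent_not_adj u v huv]

/-- Every asynchronous execution of a terminating synchronous protocol is finite. -/
theorem Executes.alwaysHalts (hR : R.Executes P) (hm : ∀ v, P.Done (R.syncState P m v)) :
    R.AlwaysHalts := by
  rintro ⟨e, he0, he⟩
  have hreach : ∀ i, R.Reachable (e i) := by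
    intro i
    induction i with
    | zero => rw [he0]; exact Relation.ReflTransGen.refl
    | succ i ih => exact ih.tail (he i)
  -- Every event delivers exactly one message, but no node sends more than the codes of its states
  -- of rounds `0, …, m` on any channel.
  have hdel : ∀ i, delivered (e i) = delivered (e 0) + i := by
    intro i
    induction i with
    | zero => rfl
    | succ i ih =>
      obtain ⟨-, u', v', p', rest, hc, -, heq⟩ := he i
      rw [heq, (Invariant.of_reachable hR hm (hreach i)).delivered_deliver hc, ih]
      ring
  set bound := ∑ u : Fin n, ∑ _v : Fin n, (stream (fun k => R.syncState P k u) (m + 1)).length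
  have h1 := hdel (bound + 1)
  have h2 : _ ≤ bound := (Invariant.of_reachable hR hm (hreach (bound + 1))).delivered_le hm
  omega

/-- A final configuration has no messages in transit unless all nodes have terminated. -/
lemma Final.chan_eq_nil (hs : R.Final s) (ht : ¬ R.Terminated s) (u v : Fin n) :
    s.chan u v = [] := by
  by_contra hne
  have hne' : (Finset.univ.filter fun x : Fin n × Fin n => s.chan x.1 x.2 ≠ []).Nonempty :=
    ⟨(u, v), by simpa using hne⟩
  let ready : Fin n × Fin n → ℝ≥0 := fun x =>
    match (s.chan x.1 x.2).head? with
    | some p => p.readyAt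
    | none => 0
  obtain ⟨⟨a, b⟩, hab, hmin⟩ := Finset.exists_min_image _ ready hne'
  simp only [Finset.mem_filter, Finset.mem_univ, true_and] at hab
  obtain ⟨p, rest, hc⟩ := List.exists_cons_of_ne_nil hab
  refine hs.2 _ ⟨ht, a, b, p, rest, hc, fun u' v' p' hp' => ?_, rfl⟩
  have := hmin (u', v') (by
    simp only [Finset.mem_filter, Finset.mem_univ, true_and]
    rintro h; simp [h] at hp')
  simpa [ready, hc, hp'] using this

/-- There is no deadlock. Consider an unterminated node in the lowest round among such nodes. With
all channels empty, it has received everything that its neighbours sent; each of these is done or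
has sent its state of that round, so the node is ready to go on. -/
lemma Executes.terminated_of_final (hR : R.Executes P) (hm : ∀ v, P.Done (R.syncState P m v))
    (hs : R.Final s) : R.Terminated s := by
  by_contra ht
  have hI := Invariant.of_reachable hR hm hs.1
  have hempty := hs.chan_eq_nil ht
  have hne : (Finset.univ.filter fun v => ¬ (R.output s v).isSome).Nonempty := by
    simp only [Terminated, not_forall] at ht
    obtain ⟨v, hv⟩ := ht
    exact ⟨v, by simpa using hv⟩
  obtain ⟨v, hv, hmin⟩ := Finset.exists_min_image _ (fun v => R.roundOf P s v) hne
  simp only [Finset.mem_filter, Finset.mem_univ, true_and] at hv hmin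
  have hnd : ¬ P.Done (R.syncState P (R.roundOf P s v) v) := by
    rw [hI.output_eq hR hm] at hv; exact hv
  refine ((hI.genuine v).round_spec (hm v)).2.elim hnd fun hr => hr fun u hu => ?_
  have hadj : R.M.G.Adj u v := SimpleGraph.Adj.symm hu
  obtain ⟨d, hd, -, heq⟩ := hI.split u v hadj
  rw [hempty, List.map_nil, List.append_nil, ← heq hnd] at hd
  have hb : (blocks (s.hist v) u : List α) =
      (List.range (R.roundOf P s u + 1)).map fun k => R.syncState P k u := by
    rw [blocks, hd, sentStream, parse_stream]
  by_cases hu' : (R.output s u).isSome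
  · refine Or.inr ⟨R.syncState P (R.roundOf P s u) u, ?_, ?_⟩
    · rw [hb]; simp [List.range_succ]
    · rw [hI.output_eq hR hm] at hu'; exact hu'
  · left
    have := hmin u hu'
    rw [hb]
    simp only [List.length_map, List.length_range]
    exact Nat.lt_succ_of_le this

/-- When an asynchronous execution ends, the output is that of the synchronous one, and the running
time is at most the number of rounds, up to a constant. -/
theorem Executes.of_final (hR : R.Executes P) (hm : ∀ v, P.Done (R.syncState P m v))
    (hs : R.Final s) :
    (∀ v, R.output s v = P.result (R.syncState P m v)) ∧ s.now ≤ (m + 2) * s.timeUnit := by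
  have hI := Invariant.of_reachable hR hm hs.1
  refine ⟨fun v => ?_, hI.now_le⟩
  have ht := hR.terminated_of_final hm hs v
  rw [hI.output_eq hR hm] at ht ⊢
  rw [syncState, syncState, Done.state_eq ht (hI.roundOf_le hm v)]

end Deliver

end Run

/-! ### Sequences of proposals -/

/-- A proposed update: a site, a spin, and the set of states in which the update is accepted. -/
abbrev Proposal (n q : ℕ) := Fin n × Fin q × ((Fin n → Fin q) → Bool)

namespace Proposal

variable {n q : ℕ}

/-- The state after the update. -/
def apply (p : Proposal n q) (X : Fin n → Fin q) : Fin n → Fin q :=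
  if p.2.2 X then Function.update X p.1 p.2.1 else X

/-- The states in `B` do not suffice to decide whether the update is accepted. -/
def Ambiguous (B : Set (Fin n → Fin q)) (p : Proposal n q) : Prop :=
  ∃ σ ∈ B, ∃ τ ∈ B, p.2.2 σ = true ∧ p.2.2 τ = false

lemma Ambiguous.mono {B B' : Set (Fin n → Fin q)} {p : Proposal n q} (h : p.Ambiguous B)
    (hB : B ⊆ B') : p.Ambiguous B' := by
  obtain ⟨σ, hσ, τ, hτ, h⟩ := h
  exact ⟨σ, hB hσ, τ, hB hτ, h⟩

lemma apply_of_ne (p : Proposal n q) (X : Fin n → Fin q) {u : Fin n} (h : p.1 ≠ u) :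
    p.apply X u = X u := by
  unfold apply
  split_ifs <;> simp [h.symm]

lemma apply_self (p : Proposal n q) (X : Fin n → Fin q) :
    p.apply X p.1 = if p.2.2 X then p.2.1 else X p.1 := by
  unfold apply
  split_ifs <;> simp

end Proposal

namespace ProposalSeq

open Proposal

variable {n q : ℕ} (X₀ : Fin n → Fin q) (e : ℕ → Proposal n q)

/-- The states of the chain driven by the proposals. -/
def trajectory : ℕ → Fin n → Fin q
  | 0 => X₀
  | j + 1 => (e j).apply (trajectory j)

/-- The possible spins of `u` just before the `j`-th update, when only the outcomes of the updates
in `D` are known. -/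
def candidates (D : Set ℕ) (j : ℕ) (u : Fin n) : Set (Fin q) :=
  {x | x = trajectory X₀ e j u ∨
    ∃ i < j, (e i).1 = u ∧ i ∉ D ∧ (x = trajectory X₀ e i u ∨ x = (e i).2.1)}

/-- The possible states just before the `j`-th update. -/
def box (D : Set ℕ) (j : ℕ) : Set (Fin n → Fin q) := {σ | ∀ u, σ u ∈ candidates X₀ e D j u}

/-- The updates that are resolved in the first `k` rounds. In a round, an update is resolved if the
earlier ones at its site are, and if its outcome is determined by those resolved before. -/
def resolved : ℕ → Set ℕ
  | 0 => ∅
  | k + 1 => {j | (∀ i < j, (e i).1 = (e j).1 → i ∈ resolved k) ∧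
      ¬ (e j).Ambiguous (box X₀ e (resolved k) j)}

variable {X₀ e}

lemma trajectory_eq_of_no_update {i j : ℕ} (hij : i ≤ j) {u : Fin n}
    (h : ∀ l, i ≤ l → l < j → (e l).1 ≠ u) : trajectory X₀ e j u = trajectory X₀ e i u := by
  induction j, hij using Nat.le_induction with
  | base => rfl
  | succ j hij ih =>
    rw [trajectory, apply_of_ne _ _ (h j hij (Nat.lt_succ_self j))]
    exact ih fun l h1 h2 => h l h1 (h2.trans (Nat.lt_succ_self j))

lemma trajectory_congr {e' : ℕ → Proposal n q} {j : ℕ} (h : ∀ i < j, e i = e' i) :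
    trajectory X₀ e j = trajectory X₀ e' j := by
  induction j with
  | zero => rfl
  | succ j ih =>
    rw [trajectory, trajectory, ih fun i hi => h i (by omega), h j (by omega)]

lemma candidates_congr {e' : ℕ → Proposal n q} {D D' : Set ℕ} {j : ℕ} (h : ∀ i < j, e i = e' i)
    (hD : ∀ i < j, i ∈ D ↔ i ∈ D') (u : Fin n) :
    candidates X₀ e D j u = candidates X₀ e' D' j u := by
  ext x
  simp only [candidates, Set.mem_ofPred_eq, trajectory_congr h]
  refine or_congr Iff.rfl (exists_congr fun i => and_congr_right fun hi => ?_)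
  rw [hD i hi, h i hi, trajectory_congr fun l hl => h l (hl.trans hi)]

lemma box_congr {e' : ℕ → Proposal n q} {D D' : Set ℕ} {j : ℕ} (h : ∀ i < j, e i = e' i)
    (hD : ∀ i < j, i ∈ D ↔ i ∈ D') : box X₀ e D j = box X₀ e' D' j := by
  ext σ
  simp only [box, Set.mem_ofPred_eq, candidates_congr h hD]

/-- The round in which an update is resolved does not look at later proposals. In the probabilistic
argument, a later proposal is therefore still fresh given that round. -/
lemma resolved_congr {e' : ℕ → Proposal n q} {k j : ℕ} (h : ∀ i ≤ j, e i = e' i) :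
    j ∈ resolved X₀ e k ↔ j ∈ resolved X₀ e' k := by
  induction k generalizing j with
  | zero => rfl
  | succ k ih =>
    simp only [resolved, Set.mem_ofPred_eq]
    have hlt : ∀ i < j, i ∈ resolved X₀ e k ↔ i ∈ resolved X₀ e' k := fun i hi =>
      ih fun l hl => h l (hl.trans hi.le)
    rw [box_congr (fun i hi => h i hi.le) hlt, h j le_rfl]
    refine and_congr (forall_congr' fun i => ?_) Iff.rfl
    refine forall_congr' fun hi => ?_
    rw [h i hi.le, hlt i hi]

lemma box_anti {D D' : Set ℕ} {j : ℕ} (hD : ∀ i < j, i ∈ D → i ∈ D') :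
    box X₀ e D' j ⊆ box X₀ e D j := by
  intro σ hσ u
  rcases hσ u with h | ⟨i, hi, h1, h2, h3⟩
  · exact Or.inl h
  · exact Or.inr ⟨i, hi, h1, fun hd => h2 (hD i hi hd), h3⟩

lemma trajectory_mem_box (D : Set ℕ) (j : ℕ) : trajectory X₀ e j ∈ box X₀ e D j :=
  fun _ => Or.inl rfl

lemma resolved_subset_succ (k : ℕ) : resolved X₀ e k ⊆ resolved X₀ e (k + 1) := by
  induction k with
  | zero => exact Set.empty_subset _
  | succ k ih =>
    rintro j ⟨h1, h2⟩
    exact ⟨fun i hi hs => ih (h1 i hi hs), fun ha => h2 (ha.mono (box_anti fun i _ hd => ih hd))⟩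

lemma resolved_mono {k k' : ℕ} (h : k ≤ k') : resolved X₀ e k ⊆ resolved X₀ e k' :=
  monotone_nat_of_le_succ (f := resolved X₀ e) resolved_subset_succ h

lemma mem_resolved_of_same_site {k i j : ℕ} (hj : j ∈ resolved X₀ e k) (hij : i < j)
    (hs : (e i).1 = (e j).1) : i ∈ resolved X₀ e k := by
  cases k with
  | zero => exact hj.elim
  | succ k => exact resolved_subset_succ k (hj.1 i hij hs)

/-- Once all earlier updates are resolved, the box contains only the true state. This crude bound on
the rounds suffices for almost sure termination. -/
lemma mem_resolved_of_lt {j k : ℕ} (h : j < k) : j ∈ resolved X₀ e k := by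
  induction k generalizing j with
  | zero => omega
  | succ k ih =>
    refine ⟨fun i hi _ => ih (by omega), ?_⟩
    have hbox : ∀ σ ∈ box X₀ e (resolved X₀ e k) j, σ = trajectory X₀ e j := by
      intro σ hσ
      ext1 u
      rcases hσ u with h | ⟨i, hi, -, h2, -⟩
      · exact h
      · exact absurd (ih (by omega)) h2
    rintro ⟨σ, hσ, τ, hτ, h1, h2⟩
    rw [hbox σ hσ] at h1
    rw [hbox τ hτ, h1] at h2
    cases h2

/-- The updates before `l` are known as in `D'`, and those after it as in `D`. -/
def hybrid (D D' : Set ℕ) (l : ℕ) : Set ℕ := D ∪ D' ∩ Set.Iio l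

/-- Learning the outcome of update `i` permits to resolve the `j`-th update, here called `p`. -/
def Pivotal (X₀ : Fin n → Fin q) (e : ℕ → Proposal n q) (k i j : ℕ) (p : Proposal n q) : Prop :=
  -- Keeping `p` apart from `e` allows the `j`-th proposal to be drawn afresh with the earlier ones
  -- fixed. That the spin at its own site is known fixes the current spin in the filter, as the
  -- Lipschitz condition requires.
  (e i).1 = p.1 ∨ ((∀ σ ∈ box X₀ e (hybrid (resolved X₀ e k) (resolved X₀ e (k + 1)) i) j,
      σ p.1 = trajectory X₀ e j p.1) ∧
    p.Ambiguous (box X₀ e (hybrid (resolved X₀ e k) (resolved X₀ e (k + 1)) i) j) ∧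
    ¬ p.Ambiguous (box X₀ e (hybrid (resolved X₀ e k) (resolved X₀ e (k + 1)) (i + 1)) j))

lemma pivotal_congr {e' : ℕ → Proposal n q} {k i j : ℕ} (hij : i < j) (h : ∀ l < j, e l = e' l)
    (p : Proposal n q) : Pivotal X₀ e k i j p ↔ Pivotal X₀ e' k i j p := by
  have hres : ∀ l < j, ∀ k, l ∈ resolved X₀ e k ↔ l ∈ resolved X₀ e' k := fun l hl k =>
    resolved_congr fun a ha => h a (by omega)
  have hh : ∀ i, box X₀ e (hybrid (resolved X₀ e k) (resolved X₀ e (k + 1)) i) j =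
      box X₀ e' (hybrid (resolved X₀ e' k) (resolved X₀ e' (k + 1)) i) j := fun i =>
    box_congr h fun l hl => by simp [hybrid, hres l hl]
  rw [Pivotal, Pivotal, hh, hh, h i hij, trajectory_congr h]

/-- An update that takes more than one round waits for another one that takes one round less. -/
lemma exists_pivotal {k j : ℕ} (hj : j ∈ resolved X₀ e (k + 2)) (hj' : j ∉ resolved X₀ e (k + 1)) :
    ∃ i < j, (i ∈ resolved X₀ e (k + 1) ∧ i ∉ resolved X₀ e k) ∧ Pivotal X₀ e k i j (e j) := by
  set D := resolved X₀ e k with hD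
  set D' := resolved X₀ e (k + 1) with hD'
  -- What delayed update `j` was either an ambiguous outcome or an earlier update at the same site.
  by_cases hs : ∀ i < j, (e i).1 = (e j).1 → i ∈ D
  · have hamb : (e j).Ambiguous (box X₀ e D j) := by
      by_contra h
      exact hj' ⟨hs, h⟩
    have h0 : (e j).Ambiguous (box X₀ e (hybrid D D' 0) j) := by
      rwa [box_congr (D' := D) (fun _ _ => rfl) fun i _ => by simp [hybrid]]
    have h1 : ¬ (e j).Ambiguous (box X₀ e (hybrid D D' j) j) := by
      rw [box_congr (D' := D') (fun _ _ => rfl) fun i hi => by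
        simp only [hybrid, Set.mem_union, Set.mem_inter_iff, Set.mem_Iio, hi, and_true]
        exact ⟨fun h => h.elim (fun h => resolved_subset_succ k h) id, Or.inr⟩]
      exact hj.2
    classical
    -- The hybrids lead from `D` to `D'` one update at a time. The step at which the ambiguity
    -- disappears is the pivotal update `i`; it lies in `D'` but not in `D`, as otherwise that step
    -- would change nothing.
    have hex : ∃ l, ¬ (e j).Ambiguous (box X₀ e (hybrid D D' l) j) := ⟨j, h1⟩
    obtain ⟨i, hi⟩ : ∃ i, Nat.find hex = i + 1 := Nat.exists_eq_succ_of_ne_zero fun h => by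
      have := Nat.find_spec hex
      rw [h] at this
      exact this h0
    have hi1 : ¬ (e j).Ambiguous (box X₀ e (hybrid D D' (i + 1)) j) := by
      rw [← hi]; exact Nat.find_spec hex
    have hi0 : (e j).Ambiguous (box X₀ e (hybrid D D' i) j) := by
      by_contra h
      have := Nat.find_le (h := hex) h
      omega
    have hij : i < j := by
      have := Nat.find_le (h := hex) h1
      omega
    have hmem : i ∈ D' ∧ i ∉ D := by
      by_contra hcon
      apply hi1
      rwa [box_congr (D' := hybrid D D' i) (fun _ _ => rfl) fun l _ => ?_]
      simp only [hybrid, Set.mem_union, Set.mem_inter_iff, Set.mem_Iio, Nat.lt_succ_iff_lt_or_eq]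
      constructor
      · rintro (h | ⟨h, h' | rfl⟩)
        · exact Or.inl h
        · exact Or.inr ⟨h, h'⟩
        · left
          by_contra hl
          exact hcon ⟨h, hl⟩
      · rintro (h | ⟨h, h'⟩)
        · exact Or.inl h
        · exact Or.inr ⟨h, Or.inl h'⟩
    refine ⟨i, hij, hmem, Or.inr ⟨fun σ hσ => ?_, hi0, hi1⟩⟩
    rcases hσ (e j).1 with h | ⟨l, hl, h2, h3, -⟩
    · exact h
    · exact absurd (Or.inl (hs l hl h2)) h3
  · push Not at hs
    obtain ⟨i, hi, h1, h2⟩ := hs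
    exact ⟨i, hi, ⟨hj.1 i hi h1, h2⟩, Or.inl h1⟩

/-- Pivotal updates are followed backwards, one round at a time. No round before the last is idle.
-/
lemma exists_resolved_in_round {k m : ℕ} (hkm : k ≤ m) {j : ℕ} (hj : j ∈ resolved X₀ e (m + 1))
    (hj' : j ∉ resolved X₀ e m) :
    ∃ i ≤ j, i ∈ resolved X₀ e (k + 1) ∧ i ∉ resolved X₀ e k := by
  induction m, hkm using Nat.le_induction generalizing j with
  | base => exact ⟨j, le_rfl, hj, hj'⟩
  | succ m _ ih =>
    obtain ⟨i, hi, h, -⟩ := exists_pivotal hj hj'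
    obtain ⟨l, hl, h'⟩ := ih h.1 h.2
    exact ⟨l, hl.trans hi.le, h'⟩

/-- If not all of the first `N` updates are resolved in `k` rounds, then one of them is resolved in
the next round. -/
lemma exists_resolved_of_notMem {k N j : ℕ} (hj : j < N) (hj' : j ∉ resolved X₀ e k) :
    ∃ i < N, i ∈ resolved X₀ e (k + 1) ∧ i ∉ resolved X₀ e k := by
  classical
  have hex : ∃ m, j ∈ resolved X₀ e m := ⟨j + 1, mem_resolved_of_lt (Nat.lt_succ_self j)⟩
  have hk : k < Nat.find hex := by
    by_contra h
    exact hj' (resolved_mono (not_lt.1 h) (Nat.find_spec hex))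
  obtain ⟨m, hm⟩ := Nat.exists_eq_succ_of_ne_zero (show Nat.find hex ≠ 0 by omega)
  obtain ⟨i, hi, h⟩ := exists_resolved_in_round (k := k) (m := m) (j := j) (X₀ := X₀) (e := e)
    (by omega) (by have := Nat.find_spec hex; rwa [hm] at this)
    (Nat.find_min hex (by omega))
  exact ⟨i, by omega, h⟩

/-- Learning the outcome of a single update removes at most one candidate. -/
lemma box_hybrid_succ {k i j : ℕ} (hij : i < j) (hi : i ∈ resolved X₀ e (k + 1))
    (hi' : i ∉ resolved X₀ e k) :
    box X₀ e (hybrid (resolved X₀ e k) (resolved X₀ e (k + 1)) (i + 1)) j ⊆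
      box X₀ e (hybrid (resolved X₀ e k) (resolved X₀ e (k + 1)) i) j ∧
    ∃ a b, ∀ σ ∈ box X₀ e (hybrid (resolved X₀ e k) (resolved X₀ e (k + 1)) i) j,
      σ ∈ box X₀ e (hybrid (resolved X₀ e k) (resolved X₀ e (k + 1)) (i + 1)) j ∨
      (σ (e i).1 = a ∧ Function.update σ (e i).1 b ∈
        box X₀ e (hybrid (resolved X₀ e k) (resolved X₀ e (k + 1)) (i + 1)) j) := by
  set D := resolved X₀ e k
  set D' := resolved X₀ e (k + 1)
  set u := (e i).1 with hu
  refine ⟨box_anti fun l _ hl => hl.imp_right fun h => ⟨h.1, h.2.trans (Nat.lt_succ_self i)⟩, ?_⟩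
  have hcand : ∀ w ≠ u, candidates X₀ e (hybrid D D' i) j w ⊆
      candidates X₀ e (hybrid D D' (i + 1)) j w := by
    intro w hw x hx
    rcases hx with h | ⟨l, hl, h1, h2, h3⟩
    · exact Or.inl h
    · refine Or.inr ⟨l, hl, h1, fun h4 => h2 (h4.imp_right fun h => ⟨h.1, ?_⟩), h3⟩
      have hlt : l < i + 1 := h.2
      rcases Nat.lt_succ_iff_lt_or_eq.1 hlt with h | rfl
      · exact h
      · exact absurd h1.symm hw
  -- the outcome of update `i` remains a candidate
  have hb : trajectory X₀ e (i + 1) u ∈ candidates X₀ e (hybrid D D' (i + 1)) j u := by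
    classical
    -- The next update at `u`, if there is one before `j`, is unresolved in the hybrid: otherwise
    -- `i`, at the same site, would have been resolved in round `k`. So the spin before that update,
    -- which is the outcome of `i`, is a candidate.
    by_cases hex : ∃ l, i < l ∧ l < j ∧ (e l).1 = u
    · obtain ⟨h1, h2, h3⟩ := Nat.find_spec hex
      refine Or.inr ⟨Nat.find hex, h2, h3, ?_, Or.inl ?_⟩
      · rintro (h | h)
        · exact hi' (mem_resolved_of_same_site h h1 h3.symm)
        · have : Nat.find hex < i + 1 := h.2
          omega
      · refine (trajectory_eq_of_no_update h1 fun l hl1 hl2 hl3 => ?_).symm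
        exact Nat.find_min hex hl2 ⟨hl1, hl2.trans h2, hl3⟩
    · push Not at hex
      exact Or.inl (trajectory_eq_of_no_update hij fun l hl1 hl2 => hex l hl1 hl2).symm
  -- Update `i` contributes two spins, the old one and the proposed one. One of them is its outcome
  -- and remains; `a` is the other.
  have ha : ∃ a, ∀ x ∈ candidates X₀ e (hybrid D D' i) j u,
      x ∈ candidates X₀ e (hybrid D D' (i + 1)) j u ∨ x = a := by
    have hval : trajectory X₀ e (i + 1) u = trajectory X₀ e i u ∨
        trajectory X₀ e (i + 1) u = (e i).2.1 := by
      rw [trajectory, hu, apply_self]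
      split_ifs
      · exact Or.inr rfl
      · exact Or.inl rfl
    have hother : ∀ x ∈ candidates X₀ e (hybrid D D' i) j u,
        x ∈ candidates X₀ e (hybrid D D' (i + 1)) j u ∨
          (x = trajectory X₀ e i u ∨ x = (e i).2.1) := by
      intro x hx
      rcases hx with h | ⟨l, hl, h1, h2, h3⟩
      · exact Or.inl (Or.inl h)
      · by_cases hli : l = i
        · subst hli; exact Or.inr h3
        · refine Or.inl (Or.inr ⟨l, hl, h1, fun h4 => h2 (h4.imp_right fun h => ⟨h.1, ?_⟩), h3⟩)
          have hlt : l < i + 1 := h.2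
          exact lt_of_le_of_ne (Nat.lt_succ_iff.1 hlt) hli
    rcases hval with hv | hv
    · refine ⟨(e i).2.1, fun x hx => ?_⟩
      rcases hother x hx with h | h | h
      · exact Or.inl h
      · left; rw [h, ← hv]; exact hb
      · exact Or.inr h
    · refine ⟨trajectory X₀ e i u, fun x hx => ?_⟩
      rcases hother x hx with h | h | h
      · exact Or.inl h
      · exact Or.inr h
      · left; rw [h, ← hv]; exact hb
  obtain ⟨a, ha⟩ := ha
  refine ⟨a, trajectory X₀ e (i + 1) u, fun σ hσ => ?_⟩
  rcases ha _ (hσ u) with h | h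
  · left
    intro w
    by_cases hw : w = u
    · rw [hw]; exact h
    · exact hcand w hw (hσ w)
  · refine Or.inr ⟨h, fun w => ?_⟩
    by_cases hw : w = u
    · subst hw; simpa using hb
    · rw [Function.update_of_ne hw]; exact hcand w hw (hσ w)

end ProposalSeq

/-! ### Random proposals -/

namespace MetropolisChain

open ProposalSeq

variable {n q : ℕ} (M : MetropolisChain n q)

/-- The proposal made by `v` upon drawing the spin `m.1` and the number `m.2`. -/
def proposal (v : Fin n) (m : Fin q × unitInterval) : Proposal n q :=
  (v, m.1, fun X => decide (m.2 < M.f v (X v) m.1 fun u => X u))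

lemma measurable_proposal (v : Fin n) : Measurable (M.proposal v) := by
  refine measurable_const.prodMk (measurable_fst.prodMk (measurable_pi_lambda _ fun X => ?_))
  refine measurable_to_bool ?_
  have : (fun m : Fin q × unitInterval => decide (m.2 < M.f v (X v) m.1 fun u => X u)) ⁻¹' {true} =
      {m | m.2 < M.f v (X v) m.1 fun u => X u} := by ext; simp
  rw [this]
  exact measurableSet_lt measurable_snd
    ((measurable_of_finite fun c => M.f v (X v) c fun u => X u).comp measurable_fst)

/-- The law of the random draws of `v`. -/
def drawLaw (v : Fin n) : Measure (Fin q × unitInterval) := (M.ν v).toMeasure.prod volume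

instance (v : Fin n) : IsProbabilityMeasure (M.drawLaw v) := by
  unfold drawLaw; infer_instance

/-- The law of the proposals of `v`. -/
def proposalAt (v : Fin n) : Measure (Proposal n q) := (M.drawLaw v).map (M.proposal v)

instance (v : Fin n) : IsProbabilityMeasure (M.proposalAt v) :=
  Measure.isProbabilityMeasure_map (M.measurable_proposal v).aemeasurable

lemma proposalAt_apply (v : Fin n) (A : Set (Proposal n q)) :
    M.proposalAt v A = ∑ c, M.ν v c * volume {β | M.proposal v (c, β) ∈ A} := by
  have hA : MeasurableSet A := A.to_countable.measurableSet
  rw [proposalAt, Measure.map_apply (M.measurable_proposal v) hA, drawLaw,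
    Measure.prod_apply (M.measurable_proposal v hA), lintegral_fintype]
  refine Finset.sum_congr rfl fun c _ => ?_
  rw [PMF.toMeasure_apply_singleton _ _ (measurableSet_singleton c), mul_comm]
  rfl

/-- The law of the proposals of a uniformly random site. -/
def proposalLaw : Measure (Proposal n q) := (n : ℝ≥0∞)⁻¹ • ∑ v, M.proposalAt v

lemma proposalLaw_apply (A : Set (Proposal n q)) :
    M.proposalLaw A = (n : ℝ≥0∞)⁻¹ * ∑ v, M.proposalAt v A := by
  simp [proposalLaw]

instance [NeZero n] : IsProbabilityMeasure M.proposalLaw where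
  measure_univ := by
    rw [proposalLaw_apply]
    simp only [measure_univ, Finset.sum_const, Finset.card_univ, Fintype.card_fin, nsmul_eq_mul,
      mul_one]
    exact ENNReal.inv_mul_cancel (by simp [NeZero.ne n]) (by simp)

lemma volume_lt_eq_coin (p : unitInterval) :
    volume {β : unitInterval | β < p} = coin p true ∧
      volume {β : unitInterval | ¬ β < p} = coin p false := by
  constructor
  · rw [show {β : unitInterval | β < p} = Set.Iio p from rfl, unitInterval.volume_Iio]
    simp [coin]
  · rw [show {β : unitInterval | ¬ β < p} = Set.Ici p by ext; simp, unitInterval.volume_Ici]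
    simp [coin]

/-- A random proposal drives one step of the chain. -/
lemma proposalLaw_apply_eq_step [NeZero n] (X σ : Fin n → Fin q) :
    M.proposalLaw {p | p.apply X = σ} = M.step X σ := by
  rw [proposalLaw_apply, step, PMF.bind_apply, tsum_fintype, Finset.mul_sum]
  refine Finset.sum_congr rfl fun v _ => ?_
  rw [PMF.uniformOfFintype_apply, Fintype.card_fin, proposalAt_apply, siteUpdate, PMF.bind_apply,
    tsum_fintype]
  congr 1
  refine Finset.sum_congr rfl fun c _ => ?_
  congr 1
  rw [PMF.bind_apply, tsum_fintype, Fintype.sum_bool]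
  obtain ⟨h1, h2⟩ := volume_lt_eq_coin (M.f v (X v) c fun u => X u)
  have hset : {β | M.proposal v (c, β) ∈ {p : Proposal n q | p.apply X = σ}} =
      ({β | β < M.f v (X v) c fun u => X u} ∩ {_β | Function.update X v c = σ}) ∪
      ({β | ¬ β < M.f v (X v) c fun u => X u} ∩ {_β | X = σ}) := by
    ext β
    by_cases hβ : β < M.f v (X v) c fun u => X u
    · simp [proposal, Proposal.apply, hβ]
    · simp [proposal, Proposal.apply, hβ, not_lt.1 hβ]
  have hm : MeasurableSet {β : unitInterval | ¬ β < M.f v (X v) c fun u => X u} :=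
    (measurableSet_lt measurable_id measurable_const).compl
  rw [hset, measure_union (Set.disjoint_left.2 fun β h h' => h'.1 h.1)
    (hm.inter (MeasurableSet.const _)), ← h1, ← h2]
  congr 1
  · by_cases h : Function.update X v c = σ
    · simp [h]
    · simp [h, eq_comm (a := σ)]
  · by_cases h : X = σ
    · simp [h]
    · simp [h, eq_comm (a := σ)]

/-- If every value of `F` on `B` is within `δ` of a value on `B'`, then a random threshold separates
values on `B` but not on `B'` with probability at most `2δ`. -/
lemma volume_separating_le {S : Type*} [Finite S] {B B' : Set S} {F : S → unitInterval} {δ : ℝ}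
    (hB : B.Nonempty) (h : ∀ σ ∈ B, ∃ σ' ∈ B', |(F σ : ℝ) - F σ'| ≤ δ) :
    volume {β : unitInterval | (∃ σ ∈ B, ∃ τ ∈ B, β < F σ ∧ ¬ β < F τ) ∧
      ¬ ∃ σ ∈ B', ∃ τ ∈ B', β < F σ ∧ ¬ β < F τ} ≤ ENNReal.ofReal (2 * δ) := by
  -- A separating threshold lies between the extreme values of `F` on `B`. If it does not separate
  -- `B'`, the approximations in `B'` of the two extremal states are on the same side of it, so it
  -- is within `δ` of the minimum or of the maximum.
  obtain ⟨σ₀, hσ₀, hmin⟩ := Set.exists_min_image B F B.toFinite hB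
  obtain ⟨σ₁, hσ₁, hmax⟩ := Set.exists_max_image B F B.toFinite hB
  have hδ : 0 ≤ δ := by
    obtain ⟨σ', -, h'⟩ := h σ₀ hσ₀
    exact (abs_nonneg _).trans h'
  have hclip : ∀ x y : ℝ, volume {β : unitInterval | x ≤ (β : ℝ) ∧ (β : ℝ) < y} ≤
      ENNReal.ofReal (y - x) := by
    intro x y
    have hs : {β : unitInterval | x ≤ (β : ℝ) ∧ (β : ℝ) < y} = Subtype.val ⁻¹' Set.Ico x y := rfl
    rw [hs, unitInterval.measurePreserving_coe.measure_preimage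
      measurableSet_Ico.nullMeasurableSet, ← Real.volume_Ico]
    exact Measure.restrict_apply_le _ _
  have hsub : {β : unitInterval | (∃ σ ∈ B, ∃ τ ∈ B, β < F σ ∧ ¬ β < F τ) ∧
      ¬ ∃ σ ∈ B', ∃ τ ∈ B', β < F σ ∧ ¬ β < F τ} ⊆
      {β | (F σ₀ : ℝ) ≤ (β : ℝ) ∧ (β : ℝ) < F σ₀ + δ} ∪
      {β | (F σ₁ : ℝ) - δ ≤ (β : ℝ) ∧ (β : ℝ) < F σ₁} := by
    rintro β ⟨⟨σ, hσ, τ, hτ, h1, h2⟩, h3⟩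
    obtain ⟨σ', hσ', hd⟩ := h σ₀ hσ₀
    obtain ⟨τ', hτ', hd'⟩ := h σ₁ hσ₁
    rw [abs_le] at hd hd'
    have hle : (F σ₀ : ℝ) ≤ β := by exact_mod_cast (hmin τ hτ).trans (not_lt.1 h2)
    have hlt : (β : ℝ) < F σ₁ := by exact_mod_cast h1.trans_le (hmax σ hσ)
    by_cases hacc : β < F σ'
    · left
      have : (β : ℝ) < F σ' := by exact_mod_cast hacc
      exact ⟨hle, by linarith⟩
    · right
      have hna : ¬ β < F τ' := fun hlt => h3 ⟨τ', hτ', σ', hσ', hlt, hacc⟩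
      have : (F τ' : ℝ) ≤ β := by exact_mod_cast not_lt.1 hna
      exact ⟨by linarith, hlt⟩
  calc _ ≤ _ := measure_mono hsub
    _ ≤ _ := measure_union_le _ _
    _ ≤ ENNReal.ofReal δ + ENNReal.ofReal δ := by
        refine add_le_add ((hclip _ _).trans (by simp)) ((hclip _ _).trans (by simp))
    _ = _ := by rw [← ENNReal.ofReal_add hδ hδ, two_mul]

lemma abs_sub_le_influence (v : Fin n) (u : M.G.neighborSet v) (a b c c' : Fin q)
    {σ τ : M.G.neighborSet v → Fin q} (hσ : σ u = a) (hτ : τ u = b)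
    (h : ∀ w, w ≠ u → σ w = τ w) :
    |(M.f v c c' σ : ℝ) - M.f v c c' τ| ≤ M.influence v u a b c c' := by
  refine le_csSup ⟨1, ?_⟩ ⟨σ, τ, hσ, hτ, h, rfl⟩
  rintro x ⟨σ, τ, -, -, -, rfl⟩
  have h1 := (M.f v c c' σ).2
  have h2 := (M.f v c c' τ).2
  rw [abs_le]
  constructor <;> linarith [h1.1, h1.2, h2.1, h2.2]

lemma influence_nonneg (v : Fin n) (u : M.G.neighborSet v) (a b c c' : Fin q) :
    0 ≤ M.influence v u a b c c' := by
  refine Real.sSup_nonneg ?_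
  rintro x ⟨σ, τ, -, -, -, rfl⟩
  exact abs_nonneg _

variable {M}

open Classical in
/-- The probability that a random proposal at `u` or a neighbour of `u` is decided by the spin
of `u`, where the two sets of states differ at most in the presence of one spin of `u`. -/
lemma proposalLaw_pivotal_le [NeZero n] {C : ℝ} (hC : 0 < C) (hL : M.Lipschitz C) (u : Fin n)
    (a b : Fin q) (B B' : Set (Fin n → Fin q)) (X : Fin n → Fin q) (hX : X ∈ B) (hB' : B' ⊆ B)
    (h : ∀ σ ∈ B, σ ∈ B' ∨ (σ u = a ∧ Function.update σ u b ∈ B')) :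
    M.proposalLaw {p | u = p.1 ∨ ((∀ σ ∈ B, σ p.1 = X p.1) ∧ p.Ambiguous B ∧
      ¬ p.Ambiguous B')} ≤ ENNReal.ofReal ((1 + 2 * C) / n) := by
  set A := {p : Proposal n q | u = p.1 ∨ ((∀ σ ∈ B, σ p.1 = X p.1) ∧ p.Ambiguous B ∧
      ¬ p.Ambiguous B')} with hA
  -- Such a site does not see the spin of `u`, so moving a state from `B` into `B'` leaves the
  -- decision unchanged.
  have hnadj : ∀ v, v ≠ u → ¬ M.G.Adj u v → M.proposalAt v A = 0 := by
    intro v hvu hadj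
    rw [proposalAt_apply]
    refine Finset.sum_eq_zero fun c _ => ?_
    have : {β | M.proposal v (c, β) ∈ A} = ∅ := by
      rw [Set.eq_empty_iff_forall_notMem]
      rintro β (h1 | ⟨-, ⟨σ, hσ, τ, hτ, h1, h2⟩, h3⟩)
      · exact hvu h1.symm
      · have hinv : ∀ σ ∈ B, ∃ σ' ∈ B', (M.proposal v (c, β)).2.2 σ' =
            (M.proposal v (c, β)).2.2 σ := by
          intro σ hσ
          rcases h σ hσ with h' | ⟨-, h'⟩
          · exact ⟨σ, h', rfl⟩
          · refine ⟨_, h', ?_⟩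
            have : (fun w : M.G.neighborSet v => Function.update σ u b w) =
                fun w : M.G.neighborSet v => σ w := by
              ext1 w
              rw [Function.update_of_ne]
              rintro hw
              exact hadj (hw ▸ SimpleGraph.Adj.symm w.2)
            simp only [proposal, this, Function.update_of_ne hvu]
        obtain ⟨σ', hσ', e1⟩ := hinv σ hσ
        obtain ⟨τ', hτ', e2⟩ := hinv τ hτ
        exact h3 ⟨σ', hσ', τ', hτ', e1.trans h1, e2.trans h2⟩
    simp [this]
  have hadj : ∀ v, M.G.Adj u v → M.proposalAt v A ≤
      ENNReal.ofReal (2 * C / M.G.maxDegree) := by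
    intro v hadj
    set u' : M.G.neighborSet v := ⟨u, hadj.symm⟩
    have hvu : v ≠ u := hadj.ne'
    have hvol : ∀ c, volume {β | M.proposal v (c, β) ∈ A} ≤
        ENNReal.ofReal (2 * M.influence v u' a b (X v) c) := by
      intro c
      -- With the spin at `v` known, acceptance is a threshold test of the single filter with
      -- current spin `X v`.
      by_cases hXv : ∀ σ ∈ B, σ v = X v
      · refine le_trans (measure_mono ?_) (volume_separating_le (B := B) (B' := B')
          (F := fun σ => M.f v (X v) c fun w => σ w) ⟨X, hX⟩ fun σ hσ => ?_)
        · rintro β (h1 | ⟨-, ⟨σ, hσ, τ, hτ, h1, h2⟩, h3⟩)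
          · exact absurd h1.symm hvu
          · simp only [proposal, hXv σ hσ, hXv τ hτ, decide_eq_true_eq, decide_eq_false_iff_not]
              at h1 h2
            refine ⟨⟨σ, hσ, τ, hτ, h1, h2⟩, ?_⟩
            rintro ⟨σ', hσ', τ', hτ', h1', h2'⟩
            refine h3 ⟨σ', hσ', τ', hτ', ?_, ?_⟩
            · simpa [proposal, hXv σ' (hB' hσ')] using h1'
            · simpa [proposal, hXv τ' (hB' hτ')] using h2'
        · rcases h σ hσ with h' | ⟨h1, h'⟩
          · exact ⟨σ, h', by simpa using M.influence_nonneg v u' a b (X v) c⟩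
          · refine ⟨_, h', M.abs_sub_le_influence v u' a b (X v) c h1 (by simp [u']) ?_⟩
            intro w hw
            rw [Function.update_of_ne]
            intro h; exact hw (Subtype.ext h)
      · have : {β | M.proposal v (c, β) ∈ A} = ∅ := by
          rw [Set.eq_empty_iff_forall_notMem]
          rintro β (h1 | ⟨h1, -⟩)
          · exact hvu h1.symm
          · exact hXv h1
        simp [this]
    rw [proposalAt_apply]
    calc ∑ c, M.ν v c * volume {β | M.proposal v (c, β) ∈ A}
        ≤ ∑ c, ENNReal.ofReal ((M.ν v c).toReal * (2 * M.influence v u' a b (X v) c)) := by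
          refine Finset.sum_le_sum fun c _ => ?_
          rw [ENNReal.ofReal_mul ENNReal.toReal_nonneg,
            ENNReal.ofReal_toReal (PMF.apply_ne_top _ _)]
          gcongr
          exact hvol c
      _ = ENNReal.ofReal (2 * ∑ c, (M.ν v c).toReal * M.influence v u' a b (X v) c) := by
          rw [← ENNReal.ofReal_sum_of_nonneg fun c _ => mul_nonneg ENNReal.toReal_nonneg
            (mul_nonneg zero_le_two (M.influence_nonneg _ _ _ _ _ _)), Finset.mul_sum]
          congr 1
          exact Finset.sum_congr rfl fun c _ => by ring
      _ ≤ _ := by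
          apply ENNReal.ofReal_le_ofReal
          rw [mul_div_assoc]
          have := hL v u' a b (X v)
          gcongr
  -- The site `u` contributes at most 1, and each of its at most `Δ` neighbours at most `2 * C / Δ`.
  have hsum : ∑ v, M.proposalAt v A ≤ ENNReal.ofReal (1 + 2 * C) := by
    have hle : ∀ v, M.proposalAt v A ≤ (if v = u then 1 else 0) +
        if M.G.Adj u v then ENNReal.ofReal (2 * C / M.G.maxDegree) else 0 := by
      intro v
      by_cases hvu : v = u
      · rw [if_pos hvu]
        exact prob_le_one.trans le_self_add
      · by_cases huv : M.G.Adj u v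
        · rw [if_pos huv]
          exact (hadj v huv).trans le_add_self
        · rw [hnadj v hvu huv]; exact zero_le
    refine (Finset.sum_le_sum fun v _ => hle v).trans ?_
    rw [Finset.sum_add_distrib, Finset.sum_ite_eq', if_pos (Finset.mem_univ u), ← Finset.sum_filter,
      Finset.sum_const, nsmul_eq_mul, ENNReal.ofReal_add zero_le_one (by positivity)]
    have hdeg : (Finset.univ.filter fun v => M.G.Adj u v).card ≤ M.G.maxDegree := by
      refine le_trans (le_of_eq ?_) (M.G.degree_le_maxDegree u)
      rw [← SimpleGraph.card_neighborFinset_eq_degree]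
      congr 1
      ext v; simp
    gcongr
    · simp
    · calc _ ≤ (M.G.maxDegree : ℝ≥0∞) * ENNReal.ofReal (2 * C / M.G.maxDegree) := by gcongr
        _ = ENNReal.ofReal (M.G.maxDegree * (2 * C / M.G.maxDegree)) := by
            rw [ENNReal.ofReal_mul (by positivity), ENNReal.ofReal_natCast]
        _ ≤ _ := by
            apply ENNReal.ofReal_le_ofReal
            rcases Nat.eq_zero_or_pos M.G.maxDegree with h0 | h0
            · simp [h0]; exact hC.le
            · have : (M.G.maxDegree : ℝ) ≠ 0 := by positivity
              rw [mul_div_cancel₀ _ this]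
  have hn : (0 : ℝ) < n := by exact_mod_cast Nat.pos_of_ne_zero (NeZero.ne n)
  rw [proposalLaw_apply, div_eq_inv_mul, ENNReal.ofReal_mul (by positivity),
    ENNReal.ofReal_inv_of_pos hn, ENNReal.ofReal_natCast]
  gcongr

/-! ### Finite sequences of independent random proposals -/

/-- Resampling one coordinate does not change the law. In this form, one can fix all other
coordinates and average over a fresh one. -/
lemma lintegral_pi_update {N : ℕ} {E : Type*} [MeasurableSpace E] (μ : Measure E)
    [IsProbabilityMeasure μ] (j : Fin N) {F : (Fin N → E) → ℝ≥0∞} (hF : Measurable F) :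
    ∫⁻ x, F x ∂Measure.pi (fun _ => μ) =
      ∫⁻ x, ∫⁻ y, F (Function.update x j y) ∂μ ∂Measure.pi (fun _ => μ) := by
  have hs : ∀ G : (Fin N → E) → ℝ≥0∞, (∫⋯∫⁻_{j}, G ∂fun _ => μ) =
      fun x => ∫⁻ y, G (Function.update x j y) ∂μ := fun G => lmarginal_singleton _ _
  rw [← hs F]
  refine lintegral_eq_of_lmarginal_eq {j} hF (hF.lmarginal _) ?_
  rw [hs (∫⋯∫⁻_{j}, F ∂fun _ => μ), hs F]
  ext x
  simp

/-- The infinite sequence that continues a finite one (in an arbitrary manner). -/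
def extend [NeZero n] (X₀ : Fin n → Fin q) {N : ℕ} (x : Fin N → Proposal n q) (j : ℕ) :
    Proposal n q :=
  if h : j < N then x ⟨j, h⟩ else (0, X₀ 0, fun _ => false)

lemma extend_update_of_ne [NeZero n] (X₀ : Fin n → Fin q) {N : ℕ} (x : Fin N → Proposal n q)
    (j : Fin N) (y : Proposal n q) {i : ℕ} (h : i ≠ j) :
    extend X₀ (Function.update x j y) i = extend X₀ x i := by
  unfold extend
  split_ifs with hi
  · rw [Function.update_of_ne]
    rintro rfl
    exact h rfl
  · rfl

lemma extend_update_self [NeZero n] (X₀ : Fin n → Fin q) {N : ℕ} (x : Fin N → Proposal n q)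
    (j : Fin N) (y : Proposal n q) : extend X₀ (Function.update x j y) j = y := by
  simp [extend]

lemma measure_pi_eq_lintegral {N : ℕ} {E : Type*} [MeasurableSpace E] (μ : Measure E)
    [IsProbabilityMeasure μ] (j : Fin N) {A : Set (Fin N → E)} (hA : MeasurableSet A) :
    Measure.pi (fun _ => μ) A =
      ∫⁻ x, μ {y | Function.update x j y ∈ A} ∂Measure.pi (fun _ => μ) := by
  rw [← lintegral_indicator_one hA, lintegral_pi_update μ j (measurable_one.indicator hA)]
  refine lintegral_congr fun x => ?_
  have hm : MeasurableSet {y | Function.update x j y ∈ A} := (measurable_update x) hA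
  rw [← lintegral_indicator_one hm]
  rfl

variable (M) in
/-- The states of the chain driven by independent random proposals have the right law. -/
lemma pi_trajectory_eq_law [NeZero n] (X₀ : Fin n → Fin q) {N j : ℕ} (hj : j ≤ N)
    (σ : Fin n → Fin q) :
    Measure.pi (fun _ : Fin N => M.proposalLaw) {x | trajectory X₀ (extend X₀ x) j = σ} =
      M.law X₀ j σ := by
  induction j generalizing σ with
  | zero =>
    by_cases h : X₀ = σ
    · simp [trajectory, law, h]
    · simp [trajectory, law, h, eq_comm (a := σ)]
  | succ j ih =>
    have hdisc : ∀ A : Set (Fin N → Proposal n q), MeasurableSet A := fun A =>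
      A.to_countable.measurableSet
    rw [measure_pi_eq_lintegral _ ⟨j, hj⟩ (hdisc _)]
    have hset : ∀ x : Fin N → Proposal n q, M.proposalLaw {y | Function.update x ⟨j, hj⟩ y ∈
        {x | trajectory X₀ (extend X₀ x) (j + 1) = σ}} =
        ∑ τ, {x : Fin N → Proposal n q | trajectory X₀ (extend X₀ x) j = τ}.indicator
          (fun _ => M.step τ σ) x := by
      intro x
      rw [Finset.sum_eq_single (trajectory X₀ (extend X₀ x) j) (fun τ _ hτ => ?_) (by simp)]
      · rw [Set.indicator_of_mem (by simp), ← proposalLaw_apply_eq_step]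
        congr 1
        ext y
        have h1 : trajectory X₀ (extend X₀ (Function.update x ⟨j, hj⟩ y)) j =
            trajectory X₀ (extend X₀ x) j :=
          trajectory_congr fun i hi => extend_update_of_ne X₀ x _ y (by simpa using hi.ne)
        have h2 := extend_update_self X₀ x ⟨j, hj⟩ y
        simp only [Set.mem_ofPred_eq, trajectory]
        rw [h1, h2]
      · rw [Set.indicator_of_notMem]
        exact fun h => hτ h.symm
    simp_rw [hset]
    rw [lintegral_finsetSum _ fun τ _ => (measurable_const.indicator (hdisc _))]
    rw [show M.law X₀ (j + 1) = (M.law X₀ j).bind M.step from rfl, PMF.bind_apply, tsum_fintype]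
    refine Finset.sum_congr rfl fun τ _ => ?_
    rw [lintegral_indicator_const (hdisc _), ih (by omega), mul_comm]

/-- The hockey-stick identity counts the increasing chains of pivotal updates. -/
lemma sum_range_choose_eq (j k : ℕ) : ∑ i ∈ Finset.range j, i.choose k = j.choose (k + 1) := by
  induction j with
  | zero => simp
  | succ j ih => rw [Finset.sum_range_succ, ih, Nat.choose_succ_succ, add_comm]

/-- The probability that a given update is resolved in a given round. -/
lemma pi_resolved_le [NeZero n] {C : ℝ} (hC : 0 < C) (hL : M.Lipschitz C) (X₀ : Fin n → Fin q)
    {N : ℕ} (k : ℕ) {j : ℕ} (hj : j < N) :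
    Measure.pi (fun _ : Fin N => M.proposalLaw) {x | j ∈ resolved X₀ (extend X₀ x) (k + 1) ∧
      j ∉ resolved X₀ (extend X₀ x) k} ≤ ENNReal.ofReal ((1 + 2 * C) / n) ^ k * (j.choose k) := by
  have hdisc : ∀ A : Set (Fin N → Proposal n q), MeasurableSet A := fun A =>
    A.to_countable.measurableSet
  set α := ENNReal.ofReal ((1 + 2 * C) / n)
  induction k generalizing j with
  | zero => simpa using prob_le_one
  | succ k ih =>
    set R : ℕ → Set (Fin N → Proposal n q) := fun i =>
      {x | i ∈ resolved X₀ (extend X₀ x) (k + 1) ∧ i ∉ resolved X₀ (extend X₀ x) k} with hR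
    set Q : ℕ → Set (Fin N → Proposal n q) := fun i =>
      {x | x ∈ R i ∧ Pivotal X₀ (extend X₀ x) k i j (extend X₀ x j)} with hQ
    -- Proposal `j` is resampled. Membership in `R i` and the boxes depend only on the proposals
    -- before `j`, so only the probability that a fresh proposal is pivotal remains.
    have hstep : ∀ i < j, Measure.pi (fun _ : Fin N => M.proposalLaw) (Q i) ≤
        α * Measure.pi (fun _ : Fin N => M.proposalLaw) (R i) := by
      intro i hij
      rw [measure_pi_eq_lintegral _ ⟨j, hj⟩ (hdisc _), ← lintegral_indicator_one (hdisc (R i)),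
        ← lintegral_const_mul _ (measurable_one.indicator (hdisc _))]
      refine lintegral_mono fun x => ?_
      have hext : ∀ y, ∀ l < j, extend X₀ (Function.update x ⟨j, hj⟩ y) l = extend X₀ x l :=
        fun y l hl => extend_update_of_ne X₀ x _ y (by simpa using hl.ne)
      have hRmem : ∀ y, Function.update x ⟨j, hj⟩ y ∈ R i ↔ x ∈ R i := by
        intro y
        have := fun k => resolved_congr (X₀ := X₀) (k := k) (j := i) fun l (hl : l ≤ i) =>
          hext y l (by omega)
        simp only [hR, Set.mem_ofPred_eq, this]
      by_cases hx : x ∈ R i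
      · obtain ⟨hsub, a, b, hab⟩ := box_hybrid_succ hij hx.1 hx.2
        rw [Set.indicator_of_mem hx, Pi.one_apply, mul_one]
        refine le_trans (measure_mono ?_) (proposalLaw_pivotal_le hC hL (extend X₀ x i).1 a b _ _
          (trajectory X₀ (extend X₀ x) j) (trajectory_mem_box _ j) hsub hab)
        rintro y ⟨-, hy⟩
        rw [extend_update_self X₀ x ⟨j, hj⟩ y, pivotal_congr hij (hext y)] at hy
        exact hy
      · rw [Set.indicator_of_notMem hx]
        have : {y | Function.update x ⟨j, hj⟩ y ∈ Q i} = ∅ := by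
          rw [Set.eq_empty_iff_forall_notMem]
          rintro y ⟨hy, -⟩
          exact hx ((hRmem y).1 hy)
        simp [this]
    calc _ ≤ Measure.pi (fun _ : Fin N => M.proposalLaw) (⋃ i ∈ Finset.range j, Q i) := by
          refine measure_mono ?_
          rintro x ⟨h1, h2⟩
          obtain ⟨i, hi, h3, h4⟩ := exists_pivotal h1 h2
          simp only [Set.mem_iUnion, Finset.mem_range]
          exact ⟨i, hi, h3, h4⟩
      _ ≤ ∑ i ∈ Finset.range j, Measure.pi (fun _ : Fin N => M.proposalLaw) (Q i) :=
          measure_biUnion_finset_le _ _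
      _ ≤ ∑ i ∈ Finset.range j, α ^ (k + 1) * (i.choose k : ℝ≥0∞) := by
          refine Finset.sum_le_sum fun i hi => ?_
          have hi' := Finset.mem_range.1 hi
          refine (hstep i hi').trans ?_
          rw [pow_succ', mul_assoc]
          gcongr
          exact ih (hi'.trans hj)
      _ = _ := by
          rw [← Finset.mul_sum, ← sum_range_choose_eq]
          push_cast
          rfl

/-- The probability that not all of `N` random updates are resolved in `k` rounds. -/
lemma pi_exists_notMem_resolved_le [NeZero n] {C : ℝ} (hC : 0 < C) (hL : M.Lipschitz C)
    (X₀ : Fin n → Fin q) (N k : ℕ) :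
    Measure.pi (fun _ : Fin N => M.proposalLaw) {x | ∃ j < N, j ∉ resolved X₀ (extend X₀ x) k} ≤
      ENNReal.ofReal ((1 + 2 * C) / n) ^ k * (N.choose (k + 1)) := by
  calc _ ≤ Measure.pi (fun _ : Fin N => M.proposalLaw) (⋃ i ∈ Finset.range N,
        {x | i ∈ resolved X₀ (extend X₀ x) (k + 1) ∧ i ∉ resolved X₀ (extend X₀ x) k}) := by
        refine measure_mono ?_
        rintro x ⟨j, hj, h⟩
        obtain ⟨i, hi, h'⟩ := exists_resolved_of_notMem hj h
        simp only [Set.mem_iUnion, Finset.mem_range]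
        exact ⟨i, hi, h'⟩
    _ ≤ _ := measure_biUnion_finset_le _ _
    _ ≤ ∑ i ∈ Finset.range N, ENNReal.ofReal ((1 + 2 * C) / n) ^ k * (i.choose k : ℝ≥0∞) :=
        Finset.sum_le_sum fun i hi => pi_resolved_le hC hL X₀ k (Finset.mem_range.1 hi)
    _ = _ := by
        rw [← Finset.mul_sum, ← sum_range_choose_eq]
        push_cast
        rfl

end MetropolisChain

/-! ### Independence of the coordinates of the tapes -/

instance (n : ℕ) : IsProbabilityMeasure (tapeMeasure n) := by
  unfold tapeMeasure; infer_instance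

lemma measurable_tape {n : ℕ} (x : Fin n × ℕ) :
    Measurable fun ω : Fin n → Tape => ω x.1 x.2 :=
  (measurable_pi_apply x.2).comp (measurable_pi_apply x.1)

/-- Distinct coordinates of the tapes are independent and uniformly distributed. -/
lemma tapeMeasure_map {n : ℕ} {ι : Type*} [Fintype ι] {c : ι → Fin n × ℕ}
    (hc : Function.Injective c) :
    (tapeMeasure n).map (fun ω x => ω (c x).1 (c x).2) =
      Measure.pi fun _ : ι => (volume : Measure unitInterval) := by
  classical
  refine (Measure.pi_eq fun S hS => ?_).symm
  rw [Measure.map_apply (measurable_pi_lambda _ fun x => measurable_tape (c x))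
    (MeasurableSet.univ_pi hS)]
  set F : Finset ℕ := Finset.univ.image fun x => (c x).2
  set t : Fin n → ℕ → Set unitInterval := fun v i => ⋂ x, ⋂ _ : c x = (v, i), S x
  have ht : ∀ v i, MeasurableSet (t v i) := fun v i =>
    MeasurableSet.iInter fun x => MeasurableSet.iInter fun _ => hS x
  have hset : (fun (ω : Fin n → Tape) x => ω (c x).1 (c x).2) ⁻¹' Set.univ.pi S =
      Set.univ.pi fun v => (F : Set ℕ).pi (t v) := by
    ext ω
    simp only [Set.mem_preimage, Set.mem_pi, Set.mem_univ, true_imp_iff, t, Set.mem_iInter, F,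
      Finset.coe_image, Finset.coe_univ, Set.image_univ, Set.mem_range]
    constructor
    · rintro h v i ⟨-, -⟩ x hx
      have := h x
      rwa [hx] at this
    · intro h x
      exact h (c x).1 (c x).2 ⟨x, rfl⟩ x rfl
  rw [hset, tapeMeasure, Measure.pi_pi]
  have h1 : ∀ v, Measure.infinitePi (fun _ : ℕ => (volume : Measure unitInterval))
      ((F : Set ℕ).pi (t v)) = ∏ i ∈ F, volume (t v i) := fun v =>
    Measure.infinitePi_pi _ fun i _ => ht v i
  simp_rw [h1]
  rw [← Finset.prod_product' (Finset.univ) F fun v i => (volume (t v i))]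
  have h2 : ∀ x, volume (t (c x).1 (c x).2) = volume (S x) := by
    intro x
    congr 1
    ext y
    simp only [t, Set.mem_iInter]
    exact ⟨fun h => h x rfl, fun h x' hx' => by rwa [hc (a₁ := x') (a₂ := x) hx']⟩
  have h3 : ∏ x, volume (S x) = ∏ y ∈ Finset.univ.image c, volume (t y.1 y.2) := by
    rw [Finset.prod_image fun x _ y _ h => hc h]
    exact Finset.prod_congr rfl fun x _ => (h2 x).symm
  rw [h3]
  symm
  refine Finset.prod_subset (fun y hy => ?_) fun y _ hy => ?_
  · obtain ⟨x, -, rfl⟩ := Finset.mem_image.1 hy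
    simp [F]
  · have : t y.1 y.2 = Set.univ := by
      simp only [t, Set.iInter_eq_univ]
      intro x hx
      exact absurd (Finset.mem_image.2 ⟨x, Finset.mem_univ x, hx⟩) hy
    rw [this, measure_univ]

lemma pi_apply_eq_null {k : ℕ} {i j : Fin k} (hij : i ≠ j) :
    Measure.pi (fun _ : Fin k => (volume : Measure unitInterval)) {x | x i = x j} = 0 := by
  have hm : MeasurableSet {x : Fin k → unitInterval | x i = x j} :=
    measurableSet_eq_fun (measurable_pi_apply i) (measurable_pi_apply j)
  rw [MetropolisChain.measure_pi_eq_lintegral _ j hm]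
  refine (lintegral_congr fun x => ?_).trans lintegral_zero
  have : {y : unitInterval | Function.update x j y ∈ {x : Fin k → unitInterval | x i = x j}} =
      {x i} := by
    ext y
    simp [hij, eq_comm]
  rw [this, measure_singleton]

lemma tape_apply_eq_null {n : ℕ} {x y : Fin n × ℕ} (hxy : x ≠ y) :
    tapeMeasure n {ω | ω x.1 x.2 = ω y.1 y.2} = 0 := by
  have hc : Function.Injective ![x, y] := by
    intro i j h
    fin_cases i <;> fin_cases j <;> simp_all
  have hm : MeasurableSet {z : Fin 2 → unitInterval | z 0 = z 1} :=
    measurableSet_eq_fun (measurable_pi_apply 0) (measurable_pi_apply 1)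
  have := pi_apply_eq_null (k := 2) (i := 0) (j := 1) (by simp)
  rw [← tapeMeasure_map hc, Measure.map_apply
    (measurable_pi_lambda _ fun x => measurable_tape _) hm] at this
  exact this

lemma StrictMono.perm_eq {k : ℕ} {γ : Type*} [PartialOrder γ] {U : Fin k → γ}
    {σ τ : Equiv.Perm (Fin k)} (hσ : StrictMono (U ∘ σ)) (hτ : StrictMono (U ∘ τ)) : σ = τ := by
  have h1 : U ∘ σ = U ∘ τ := (StrictMono.range_inj hσ hτ).1 (by
    rw [σ.surjective.range_comp, τ.surjective.range_comp])
  have hU : Function.Injective U := by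
    have := hσ.injective
    rwa [EquivLike.injective_comp] at this
  ext i
  exact congrArg Fin.val (hU (congrFun h1 i))

lemma measurableSet_strictMono (k : ℕ) :
    MeasurableSet {U : Fin k → unitInterval | StrictMono U} := by
  have : {U : Fin k → unitInterval | StrictMono U} =
      ⋂ i, ⋂ j, ⋂ _ : i < j, {U | U i < U j} := by
    ext U; simp [StrictMono]
  rw [this]
  exact MeasurableSet.iInter fun i => MeasurableSet.iInter fun j => MeasurableSet.iInter fun _ =>
    measurableSet_lt (measurable_pi_apply i) (measurable_pi_apply j)

/-- Independent uniform random numbers are increasing with probability `1 / k!`. -/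
lemma pi_strictMono (k : ℕ) : Measure.pi (fun _ : Fin k => (volume : Measure unitInterval))
    {U | StrictMono U} = (k.factorial : ℝ≥0∞)⁻¹ := by
  set μ := Measure.pi (fun _ : Fin k => (volume : Measure unitInterval)) with hμ
  have hcomp : ∀ σ : Equiv.Perm (Fin k), Measurable fun U : Fin k → unitInterval => U ∘ σ :=
    fun σ => measurable_pi_lambda _ fun i => measurable_pi_apply _
  have hmap : ∀ σ : Equiv.Perm (Fin k), μ.map (fun U => U ∘ σ) = μ := by
    intro σ
    refine (Measure.pi_eq fun S hS => ?_).symm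
    rw [Measure.map_apply (hcomp σ) (MeasurableSet.univ_pi hS)]
    have : (fun U : Fin k → unitInterval => U ∘ σ) ⁻¹' Set.univ.pi S =
        Set.univ.pi fun i => S (σ.symm i) := by
      ext U
      simp only [Set.mem_preimage, Set.mem_pi, Set.mem_univ, true_imp_iff, Function.comp]
      exact ⟨fun h i => by simpa using h (σ.symm i), fun h i => by simpa using h (σ i)⟩
    rw [this, hμ, Measure.pi_pi]
    exact Equiv.prod_comp σ.symm fun i => volume (S i)
  -- The `k!` possible orders are equally likely by exchangeability and mutually exclusive, and they
  -- cover everything but ties, which form a null set.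
  have heq : ∀ σ : Equiv.Perm (Fin k), μ {U | StrictMono (U ∘ σ)} = μ {U | StrictMono U} := by
    intro σ
    conv_rhs => rw [← hmap σ, Measure.map_apply (hcomp σ) (measurableSet_strictMono k)]
    rfl
  have hae : ∀ᵐ U ∂μ, U ∈ ⋃ σ : Equiv.Perm (Fin k), {U | StrictMono (U ∘ σ)} := by
    have hinj : ∀ᵐ U ∂μ, ∀ i j : Fin k, i ≠ j → U i ≠ U j :=
      ae_all_iff.2 fun i => ae_all_iff.2 fun j => by
        by_cases hij : i = j
        · simp [hij]
        · have := pi_apply_eq_null hij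
          filter_upwards [measure_eq_zero_iff_ae_notMem.1 this] with U hU _
          exact hU
    filter_upwards [hinj] with U hU
    simp only [Set.mem_iUnion, Set.mem_ofPred_eq]
    refine ⟨Tuple.sort U, (Tuple.monotone_sort U).strictMono_of_injective ?_⟩
    have : Function.Injective U := fun i j h => by
      by_contra hij
      exact hU i j hij h
    exact this.comp (Tuple.sort U).injective
  have hsum : ∑ σ : Equiv.Perm (Fin k), μ {U | StrictMono (U ∘ σ)} = 1 := by
    have hdisj : Pairwise (Function.onFun Disjoint fun σ : Equiv.Perm (Fin k) =>
        {U : Fin k → unitInterval | StrictMono (U ∘ σ)}) := fun σ τ hστ =>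
      Set.disjoint_left.2 fun U hσ hτ => hστ (StrictMono.perm_eq hσ hτ)
    rw [← tsum_fintype (L := .unconditional _),
      ← measure_iUnion hdisj fun σ => hcomp σ (measurableSet_strictMono k)]
    exact (mem_ae_iff_prob_eq_one (MeasurableSet.iUnion fun σ =>
      hcomp σ (measurableSet_strictMono k))).1 hae
  simp_rw [heq] at hsum
  rw [Finset.sum_const, Finset.card_univ, Fintype.card_perm, Fintype.card_fin, nsmul_eq_mul] at hsum
  exact ENNReal.eq_inv_of_mul_eq_one_left (by rw [mul_comm]; exact hsum)

/-! ### Merging the updates of all nodes -/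

section Merge

variable {n : ℕ}

/-- The (unsorted) update times of the nodes. -/
def timeAt (ω : Fin n → Tape) (x : Fin n × ℕ) : unitInterval := ω x.1 (2 * x.2 + 1)

/-- The number of occurrences of a label. -/
def mult {k : ℕ} (s : Fin k → Fin n) (v : Fin n) : ℕ := Fintype.card {j // s j = v}

/-- The `j`-th update overall, in order of time, is the one that node `s j` calls `i j`. The numbers
of updates of the nodes are given by `cnt`. -/
structure IsMerge (cnt : unitInterval → ℕ) (ω : Fin n → Tape) {k : ℕ} (s : Fin k → Fin n)
    (i : Fin k → ℕ) : Prop where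
  count : ∀ v, cnt (ω v 0) = mult s v
  lt_mult : ∀ j, i j < mult s (s j)
  strictMono : StrictMono fun j => timeAt ω (s j, i j)

lemma sum_mult {k : ℕ} (s : Fin k → Fin n) : ∑ v, mult s v = k := by
  simp only [mult]
  rw [← Fintype.card_sigma, Fintype.card_congr (Equiv.sigmaFiberEquiv s), Fintype.card_fin]

variable {cnt : unitInterval → ℕ} {ω : Fin n → Tape} {k : ℕ} {s : Fin k → Fin n} {i : Fin k → ℕ}

lemma IsMerge.injective (h : IsMerge cnt ω s i) : Function.Injective fun j => (s j, i j) :=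
  fun _ _ hj => h.strictMono.injective (congrArg (timeAt ω) hj)

lemma IsMerge.sum_count (h : IsMerge cnt ω s i) : ∑ v, cnt (ω v 0) = k := by
  rw [Finset.sum_congr rfl fun v _ => h.count v, sum_mult]

lemma IsMerge.exists_eq (h : IsMerge cnt ω s i) {v : Fin n} {a : ℕ} (ha : a < cnt (ω v 0)) :
    ∃ j, s j = v ∧ i j = a := by
  let g : {j // s j = v} → Fin (mult s v) := fun j => ⟨i j, by
    have := h.lt_mult j; rwa [j.2] at this⟩
  have hg : Function.Injective g := by
    intro j j' hj
    refine Subtype.ext (h.injective (Prod.ext (j.2.trans j'.2.symm) ?_))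
    exact congrArg Fin.val hj
  have hsurj := ((Fintype.bijective_iff_injective_and_card g).2 ⟨hg, by
    rw [Fintype.card_fin]; rfl⟩).2
  obtain ⟨j, hj⟩ := hsurj ⟨a, by rwa [← h.count v]⟩
  exact ⟨j, j.2, congrArg Fin.val hj⟩

lemma IsMerge.range_eq (h : IsMerge cnt ω s i) :
    Set.range (fun j => (s j, i j)) = {x | x.2 < cnt (ω x.1 0)} := by
  ext x
  constructor
  · rintro ⟨j, rfl⟩
    change i j < cnt (ω (s j) 0)
    rw [h.count]; exact h.lt_mult j
  · intro hx
    obtain ⟨j, h1, h2⟩ := h.exists_eq hx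
    exact ⟨j, Prod.ext h1 h2⟩

/-- Both sequences of times are increasing with the same range, the set of all update times, so they
agree; times determine the updates by strict monotonicity. -/
lemma IsMerge.unique {s' : Fin k → Fin n} {i' : Fin k → ℕ} (h : IsMerge cnt ω s i)
    (h' : IsMerge cnt ω s' i') : s = s' ∧ i = i' := by
  have h1 : (fun j => timeAt ω (s j, i j)) = fun j => timeAt ω (s' j, i' j) := by
    refine (StrictMono.range_inj h.strictMono h'.strictMono).1 ?_
    have e : ∀ (s : Fin k → Fin n) (i : Fin k → ℕ), Set.range (fun j => timeAt ω (s j, i j)) =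
        timeAt ω '' Set.range fun j => (s j, i j) := fun s i => by
      rw [← Set.range_comp]; rfl
    rw [e, e, h.range_eq, h'.range_eq]
  have h2 : ∀ j, (s j, i j) = (s' j, i' j) := by
    intro j
    have hmem : (s' j, i' j) ∈ Set.range fun j => (s j, i j) := by
      rw [h.range_eq, ← h'.range_eq]; exact ⟨j, rfl⟩
    obtain ⟨j', hj'⟩ := hmem
    have hj'' := congrArg (timeAt ω) hj'
    have := congrFun h1 j
    simp only at this hj''
    rw [← this] at hj''
    have hjj := h.strictMono.injective hj''
    rw [← hj', hjj]
  exact ⟨funext fun j => congrArg Prod.fst (h2 j), funext fun j => congrArg Prod.snd (h2 j)⟩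

/-- Updates at distinct times can be merged. -/
lemma exists_isMerge (hω : Function.Injective (timeAt ω)) (hk : ∑ v, cnt (ω v 0) = k) :
    ∃ (s : Fin k → Fin n) (i : Fin k → ℕ), IsMerge cnt ω s i := by
  classical
  set P : Finset (Fin n × ℕ) := (Finset.univ.sigma fun v => Finset.range (cnt (ω v 0))).image
    fun x => (x.1, x.2) with hP
  have hmemP : ∀ x, x ∈ P ↔ x.2 < cnt (ω x.1 0) := by
    rintro ⟨v, a⟩
    simp only [hP, Finset.mem_image, Finset.mem_sigma, Finset.mem_univ, true_and,
      Finset.mem_range, Sigma.exists, Prod.mk.injEq]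
    constructor
    · rintro ⟨v', a', h, rfl, rfl⟩; exact h
    · intro h; exact ⟨v, a, h, rfl, rfl⟩
  have hcard : (P.image (timeAt ω)).card = k := by
    rw [Finset.card_image_of_injective _ hω, hP, Finset.card_image_of_injective, Finset.card_sigma,
      ← hk]
    · simp
    · rintro ⟨v, a⟩ ⟨v', a'⟩ h
      simp only [Prod.mk.injEq] at h
      obtain ⟨rfl, rfl⟩ := h
      rfl
  set τ := (P.image (timeAt ω)).orderEmbOfFin hcard
  have hex : ∀ j, ∃ x ∈ P, timeAt ω x = τ j := fun j =>
    Finset.mem_image.1 (Finset.orderEmbOfFin_mem _ hcard j)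
  choose x hxP hx using hex
  have hxinj : Function.Injective x := fun j j' h => τ.injective (by rw [← hx, ← hx, h])
  have hxsurj : ∀ y ∈ P, ∃ j, x j = y := by
    intro y hy
    have : timeAt ω y ∈ Set.range τ := by
      rw [Finset.range_orderEmbOfFin]
      exact_mod_cast Finset.mem_image_of_mem _ hy
    obtain ⟨j, hj⟩ := this
    exact ⟨j, hω (by rw [hx, hj])⟩
  have hcount : ∀ v, cnt (ω v 0) = mult (fun j => (x j).1) v := by
    intro v
    let g : {j // (x j).1 = v} → Fin (cnt (ω v 0)) := fun j => ⟨(x j).2, by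
      have := (hmemP _).1 (hxP j); rwa [j.2] at this⟩
    have hg : Function.Bijective g := by
      constructor
      · intro j j' h
        exact Subtype.ext (hxinj (Prod.ext (j.2.trans j'.2.symm) (congrArg Fin.val h)))
      · intro a
        obtain ⟨j, hj⟩ := hxsurj (v, a) ((hmemP _).2 a.2)
        exact ⟨⟨j, by rw [hj]⟩, Fin.ext (by simp [g, hj])⟩
    rw [mult, Fintype.card_of_bijective hg, Fintype.card_fin]
  refine ⟨fun j => (x j).1, fun j => (x j).2, hcount, fun j => ?_, fun j j' hjj => ?_⟩
  · rw [← hcount]; exact (hmemP _).1 (hxP j)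
  · simp only [Prod.mk.eta, hx]
    exact τ.strictMono hjj

lemma ae_injective_timeAt (n : ℕ) : ∀ᵐ ω ∂tapeMeasure n, Function.Injective (timeAt ω) := by
  have : ∀ᵐ ω ∂tapeMeasure n, ∀ x y : Fin n × ℕ, x ≠ y → timeAt ω x ≠ timeAt ω y :=
    ae_all_iff.2 fun x => ae_all_iff.2 fun y => by
      by_cases hxy : x = y
      · simp [hxy]
      · have h : (x.1, 2 * x.2 + 1) ≠ (y.1, 2 * y.2 + 1) := by
          intro h
          simp only [Prod.mk.injEq] at h
          exact hxy (Prod.ext h.1 (by omega))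
        filter_upwards [measure_eq_zero_iff_ae_notMem.1 (tape_apply_eq_null h)] with ω hω _
        exact hω
  filter_upwards [this] with ω hω x y h
  by_contra hne
  exact hω x y hne h

end Merge

/-! ### The superposition of independent Poisson processes -/

section Superposition

variable {n : ℕ} {E : Type*} [MeasurableSpace E]

/-- The power of a mixture over sites is expanded into a sum over all sequences of sites. -/
lemma pi_smul_sum (κ : Fin n → Measure E) [∀ v, IsProbabilityMeasure (κ v)] (c : ℝ≥0∞)
    (hc : c ≠ ∞) (k : ℕ) (A : Set (Fin k → E)) :
    Measure.pi (fun _ : Fin k => c • ∑ v, κ v) A =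
      c ^ k * ∑ s : Fin k → Fin n, Measure.pi (fun j => κ (s j)) A := by
  have hfin : IsFiniteMeasure (c • ∑ v, κ v) := ⟨by
    simp [ENNReal.mul_lt_top_iff, hc.lt_top]⟩
  have : Measure.pi (fun _ : Fin k => c • ∑ v, κ v) =
      c ^ k • ∑ s : Fin k → Fin n, Measure.pi (fun j => κ (s j)) := by
    refine Measure.pi_eq fun S hS => ?_
    simp only [Measure.smul_apply, Measure.finsetSum_apply, Measure.pi_pi, smul_eq_mul]
    rw [Finset.prod_mul_distrib, Finset.prod_const, Finset.card_univ, Fintype.card_fin,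
      Finset.prod_univ_sum, Fintype.piFinset_univ]
  rw [this]
  simp

variable {cnt : unitInterval → ℕ} {smp : Fin n → unitInterval → E} {rate : ℝ≥0}
  {κ : Fin n → Measure E}

/-- The law of the merged updates, for a given order of the sites and given names of the
updates. -/
lemma tapeMeasure_isMerge (hcnt : Measurable cnt)
    (hcnt' : (volume : Measure unitInterval).map cnt = ProbabilityTheory.poissonMeasure rate)
    (hsmp : ∀ v, Measurable (smp v))
    (hsmp' : ∀ v, (volume : Measure unitInterval).map (smp v) = κ v)
    {k : ℕ} {s : Fin k → Fin n} {i : Fin k → ℕ} (hi : ∀ j, i j < mult s (s j))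
    (hinj : Function.Injective fun j => (s j, i j)) {A : Set (Fin k → E)} (hA : MeasurableSet A) :
    MeasurableSet {ω | IsMerge cnt ω s i ∧ (fun j => smp (s j) (ω (s j) (2 * i j + 2))) ∈ A} ∧
    tapeMeasure n {ω | IsMerge cnt ω s i ∧ (fun j => smp (s j) (ω (s j) (2 * i j + 2))) ∈ A} =
      (∏ v, ProbabilityTheory.poissonMeasure rate {mult s v}) * (k.factorial : ℝ≥0∞)⁻¹ *
        Measure.pi (fun j => κ (s j)) A := by
  -- Coordinate 0 of a tape gives the number of updates, the odd ones give their times, and the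
  -- positive even ones their draws. The coordinates in use are distinct, so numbers, order and
  -- draws are independent.
  let c : Fin n ⊕ Fin k ⊕ Fin k → Fin n × ℕ :=
    Sum.elim (fun v => (v, 0)) (Sum.elim (fun j => (s j, 2 * i j + 1)) fun j => (s j, 2 * i j + 2))
  have hc : Function.Injective c := by
    have h1 : ∀ j j', s j = s j' → i j = i j' → j = j' := fun j j' h h' =>
      hinj (Prod.ext h h')
    rintro (v | j | j) (v' | j' | j') h <;> simp only [c, Sum.elim_inl, Sum.elim_inr,
      Prod.mk.injEq] at h
    · rw [h.1]
    · omega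
    · omega
    · omega
    · rw [h1 j j' h.1 (by omega)]
    · omega
    · omega
    · omega
    · rw [h1 j j' h.1 (by omega)]
  have hcm : Measurable fun (ω : Fin n → Tape) x => ω (c x).1 (c x).2 :=
    measurable_pi_lambda _ fun x => measurable_tape (c x)
  set S₁ : Set (Fin n → unitInterval) := Set.univ.pi fun v => cnt ⁻¹' {mult s v}
  set S₂ : Set (Fin k → unitInterval) := {U | StrictMono U}
  set S₃ : Set (Fin k → unitInterval) := (fun x j => smp (s j) (x j)) ⁻¹' A
  have hfm : Measurable fun (x : Fin k → unitInterval) j => smp (s j) (x j) :=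
    measurable_pi_lambda _ fun j => (hsmp _).comp (measurable_pi_apply j)
  have hS₁ : MeasurableSet S₁ := MeasurableSet.univ_pi fun v => hcnt (measurableSet_singleton _)
  have hS₂ : MeasurableSet S₂ := measurableSet_strictMono k
  have hS₃ : MeasurableSet S₃ := hfm hA
  set e₁ := MeasurableEquiv.sumPiEquivProdPi fun _ : Fin n ⊕ Fin k ⊕ Fin k => unitInterval
  set e₂ := MeasurableEquiv.sumPiEquivProdPi fun _ : Fin k ⊕ Fin k => unitInterval
  have hset : {ω | IsMerge cnt ω s i ∧ (fun j => smp (s j) (ω (s j) (2 * i j + 2))) ∈ A} =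
      (fun (ω : Fin n → Tape) x => ω (c x).1 (c x).2) ⁻¹'
        (e₁ ⁻¹' (S₁ ×ˢ (e₂ ⁻¹' (S₂ ×ˢ S₃)))) := by
    ext ω
    constructor
    · rintro ⟨h, hA⟩
      exact ⟨fun v _ => h.count v, h.strictMono, hA⟩
    · rintro ⟨h1, h2, h3⟩
      exact ⟨⟨fun v => h1 v trivial, hi, h2⟩, h3⟩
  have hm₂ : MeasurableSet (e₂ ⁻¹' (S₂ ×ˢ S₃)) := e₂.measurable (hS₂.prod hS₃)
  have hm₁ : MeasurableSet (e₁ ⁻¹' (S₁ ×ˢ (e₂ ⁻¹' (S₂ ×ˢ S₃)))) := e₁.measurable (hS₁.prod hm₂)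
  refine ⟨hset ▸ hcm hm₁, ?_⟩
  rw [hset, ← Measure.map_apply hcm hm₁, tapeMeasure_map hc,
    (measurePreserving_sumPiEquivProdPi fun _ : Fin n ⊕ Fin k ⊕ Fin k =>
      (volume : Measure unitInterval)).measure_preimage_equiv, Measure.prod_prod,
    (measurePreserving_sumPiEquivProdPi fun _ : Fin k ⊕ Fin k =>
      (volume : Measure unitInterval)).measure_preimage_equiv, Measure.prod_prod, Measure.pi_pi,
    pi_strictMono, mul_assoc]
  congr 1
  · refine Finset.prod_congr rfl fun v _ => ?_
    rw [← Measure.map_apply hcnt (measurableSet_singleton _), hcnt']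
  · congr 1
    have := Measure.pi_map_pi (μ := fun _ : Fin k => (volume : Measure unitInterval))
      (f := fun j => smp (s j)) fun j => (hsmp (s j)).aemeasurable
    simp only [hsmp'] at this
    rw [← this, Measure.map_apply hfm hA]

/-- The number of ways to name the updates, given their sites. -/
lemma card_namings {k : ℕ} (s : Fin k → Fin n) :
    Fintype.card (∀ v, {j // s j = v} ↪ Fin (mult s v)) = ∏ v, (mult s v).factorial := by
  rw [Fintype.card_pi]
  refine Finset.prod_congr rfl fun v _ => ?_
  rw [Fintype.card_embedding_eq, Fintype.card_fin, mult, Nat.descFactorial_self]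

/-- The superposition of independent Poisson processes: their total number is Poisson distributed,
and given that it is `k`, the merged updates are `k` independent updates of random sites. -/
theorem tapeMeasure_superposition (hcnt : Measurable cnt)
    (hcnt' : (volume : Measure unitInterval).map cnt = ProbabilityTheory.poissonMeasure rate)
    (hsmp : ∀ v, Measurable (smp v))
    (hsmp' : ∀ v, (volume : Measure unitInterval).map (smp v) = κ v) [NeZero n]
    [∀ v, IsProbabilityMeasure (κ v)]
    {k : ℕ} {A : Set (Fin k → E)} (hA : MeasurableSet A) {B : Set (Fin n → Tape)}
    (hB : ∀ ω s i, IsMerge cnt ω s i →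
      (ω ∈ B ↔ (fun j => smp (s j) (ω (s j) (2 * i j + 2))) ∈ A)) :
    tapeMeasure n ({ω | ∑ v, cnt (ω v 0) = k} ∩ B) =
      ProbabilityTheory.poissonMeasure (n * rate) {k} *
        Measure.pi (fun _ : Fin k => (n : ℝ≥0∞)⁻¹ • ∑ v, κ v) A := by
  -- The event is split according to the sites in order of time and the names of the updates. The
  -- embeddings are bijections, since both sides have the same size.
  let ι := Σ s : Fin k → Fin n, ∀ v, {j // s j = v} ↪ Fin (mult s v)
  let name : ι → Fin k → ℕ := fun x j => x.2 (x.1 j) ⟨j, rfl⟩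
  let L : ι → Set (Fin n → Tape) := fun x =>
    {ω | IsMerge cnt ω x.1 (name x) ∧ (fun j => smp (x.1 j) (ω (x.1 j) (2 * name x j + 2))) ∈ A}
  have hlt : ∀ (x : ι) j, name x j < mult x.1 (x.1 j) := fun x j => Fin.is_lt _
  have hinj : ∀ x : ι, Function.Injective fun j => (x.1 j, name x j) := by
    rintro ⟨s, g⟩ j j' h
    simp only [name, Prod.mk.injEq] at h
    obtain ⟨h1, h2⟩ := h
    have key : ∀ v (hj : s j = v) (hj' : s j' = v),
        ((g v ⟨j, hj⟩ : Fin _) : ℕ) = g v ⟨j', hj'⟩ → j = j' := fun v hj hj' h =>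
      congrArg Subtype.val ((g v).injective (Fin.ext h))
    refine key (s j') h1 rfl ?_
    rw [← h2]
    have : ∀ v (hv : s j = v), ((g v ⟨j, hv⟩ : Fin _) : ℕ) = g (s j) ⟨j, rfl⟩ := by
      rintro v rfl; rfl
    exact this _ h1
  have hL : ∀ x, MeasurableSet (L x) ∧ tapeMeasure n (L x) = _ := fun x =>
    tapeMeasure_isMerge hcnt hcnt' hsmp hsmp' (hlt x) (hinj x) hA
  have hdisj : Pairwise (Function.onFun Disjoint L) := by
    rintro ⟨s, g⟩ ⟨s', g'⟩ hne
    refine Set.disjoint_left.2 fun ω h h' => hne ?_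
    obtain ⟨h1, h2⟩ := h.1.unique h'.1
    simp only at h1
    subst h1
    congr 1
    ext v ⟨j, hj⟩
    subst hj
    exact congrFun h2 j
  have hae : ({ω | ∑ v, cnt (ω v 0) = k} ∩ B : Set (Fin n → Tape)) =ᵐ[tapeMeasure n]
      ⋃ x, L x := by
    filter_upwards [ae_injective_timeAt n] with ω hω
    refine propext ?_
    change (ω ∈ {ω | ∑ v, cnt (ω v 0) = k} ∩ B) ↔ ω ∈ ⋃ x, L x
    simp only [Set.mem_iUnion]
    constructor
    · rintro ⟨hk, hωB⟩
      obtain ⟨s, i, h⟩ := exists_isMerge hω hk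
      refine ⟨⟨s, fun v => ⟨fun j => ⟨i j, by have := h.lt_mult j; rwa [j.2] at this⟩, ?_⟩⟩, h,
        (hB ω s i h).1 hωB⟩
      intro j j' hj
      exact Subtype.ext (h.injective (Prod.ext (j.2.trans j'.2.symm) (congrArg Fin.val hj)))
    · rintro ⟨x, h, hxA⟩
      exact ⟨h.sum_count, (hB ω _ _ h).2 hxA⟩
  rw [measure_congr hae, measure_iUnion hdisj fun x => (hL x).1, tsum_fintype,
    Finset.sum_congr rfl fun x _ => (hL x).2, Fintype.sum_sigma]
  simp only [Finset.sum_const, Finset.card_univ, nsmul_eq_mul, card_namings]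
  -- The number of namings cancels the factorials of the Poisson weights. What remains is `exp (-n *
  -- rate) * rate ^ k / k!`, independent of `s`: every sequence of sites has the same weight.
  have hpois : ∀ s : Fin k → Fin n, ((∏ v, (mult s v).factorial : ℕ) : ℝ≥0∞) *
      ((∏ v, ProbabilityTheory.poissonMeasure rate {mult s v}) * (k.factorial : ℝ≥0∞)⁻¹ *
        Measure.pi (fun j => κ (s j)) A) =
      (ProbabilityTheory.poissonMeasure (n * rate) {k} * ((n : ℝ≥0∞)⁻¹) ^ k) *
        Measure.pi (fun j => κ (s j)) A := by
    intro s
    rw [← mul_assoc, ← mul_assoc]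
    congr 1
    rw [Nat.cast_prod, ← Finset.prod_mul_distrib]
    have h1 : ∀ v, ((mult s v).factorial : ℝ≥0∞) *
        ProbabilityTheory.poissonMeasure rate {mult s v} =
        ENNReal.ofReal (Real.exp (-rate) * rate ^ mult s v) := by
      intro v
      rw [ProbabilityTheory.poissonMeasure_singleton, ← ENNReal.ofReal_natCast,
        ← ENNReal.ofReal_mul (by positivity)]
      congr 1
      field_simp
    have hn : (n : ℝ) ≠ 0 := by exact_mod_cast NeZero.ne n
    rw [Finset.prod_congr rfl fun v _ => h1 v, ← ENNReal.ofReal_prod_of_nonneg fun v _ => by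
      positivity, Finset.prod_mul_distrib, Finset.prod_pow_eq_pow_sum, sum_mult, Finset.prod_const,
      Finset.card_univ, Fintype.card_fin, ProbabilityTheory.poissonMeasure_singleton,
      ← ENNReal.ofReal_natCast (k.factorial), ← ENNReal.ofReal_inv_of_pos (by positivity),
      ← ENNReal.ofReal_mul (by positivity), ← ENNReal.ofReal_natCast n,
      ← ENNReal.ofReal_inv_of_pos (by positivity), ← ENNReal.ofReal_pow (by positivity),
      ← ENNReal.ofReal_mul (by positivity), ← Real.exp_nat_mul]
    congr 1
    push_cast
    rw [mul_pow, inv_pow]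
    field_simp
  rw [Finset.sum_congr rfl fun s _ => hpois s, ← Finset.mul_sum, pi_smul_sum κ _ (by simp [NeZero.ne n])]
  ring

end Superposition

/-! ### Sampling -/

/-- A Poisson distributed number, from a uniformly distributed one. -/
def poissonSample (rate : ℝ≥0) : unitInterval → ℕ :=
  (ProbabilityTheory.poissonMeasure rate).exists_measurable_map_eq.choose

lemma measurable_poissonSample (rate : ℝ≥0) : Measurable (poissonSample rate) :=
  (ProbabilityTheory.poissonMeasure rate).exists_measurable_map_eq.choose_spec.1

lemma map_poissonSample (rate : ℝ≥0) : (volume : Measure unitInterval).map (poissonSample rate) =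
    ProbabilityTheory.poissonMeasure rate :=
  (ProbabilityTheory.poissonMeasure rate).exists_measurable_map_eq.choose_spec.2

lemma exists_drawSampler {q : ℕ} (ν : PMF (Fin q)) :
    ∃ f : unitInterval → Fin q × unitInterval, Measurable f ∧
      (volume : Measure unitInterval).map f = ν.toMeasure.prod volume := by
  have : Nonempty (Fin q) := ⟨ν.support_nonempty.some⟩
  exact Measure.exists_measurable_map_eq _

/-- A random spin and an independent uniform random number, from a single one. -/
def drawSample {q : ℕ} (ν : PMF (Fin q)) : unitInterval → Fin q × unitInterval :=
  (exists_drawSampler ν).choose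

lemma measurable_drawSample {q : ℕ} (ν : PMF (Fin q)) : Measurable (drawSample ν) :=
  (exists_drawSampler ν).choose_spec.1

lemma map_drawSample {q : ℕ} (ν : PMF (Fin q)) :
    (volume : Measure unitInterval).map (drawSample ν) = ν.toMeasure.prod volume :=
  (exists_drawSampler ν).choose_spec.2

namespace MeasurableFibers

variable {Ω β : Type*} [MeasurableSpace Ω]

lemma of_measurable [MeasurableSpace β] [MeasurableSingletonClass β] {f : Ω → β}
    (hf : Measurable f) : MeasurableFibers f := fun b => hf (measurableSet_singleton b)

end MeasurableFibers

/-! ### The updates of a node -/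

/-- The cell of the dyadic grid of precision `p` that contains `t`. -/
def dyadicCell (p : ℕ) (t : unitInterval) : ℕ := ⌊2 ^ p * (t : ℝ)⌋₊

lemma dyadicCell_mono (p : ℕ) : Monotone (dyadicCell p) := fun s t h => by
  apply Nat.floor_mono
  have : (s : ℝ) ≤ t := h
  gcongr

/-- The coarse cell is a function of the fine one, by integer division. -/
lemma dyadicCell_ne_of_le {p p' : ℕ} (h : p ≤ p') {s t : unitInterval}
    (hst : dyadicCell p s ≠ dyadicCell p t) : dyadicCell p' s ≠ dyadicCell p' t := by
  have key : ∀ t : unitInterval, dyadicCell p t = dyadicCell p' t / 2 ^ (p' - p) := by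
    intro t
    have h2 : ((2 ^ (p' - p) : ℕ) : ℝ) = 2 ^ (p' - p) := by push_cast; rfl
    rw [dyadicCell, dyadicCell, ← Nat.floor_div_natCast, h2]
    congr 1
    rw [eq_div_iff (by positivity)]
    have : (2 : ℝ) ^ p' = 2 ^ p * 2 ^ (p' - p) := by rw [← pow_add, Nat.add_sub_cancel' h]
    rw [this]; ring
  intro heq
  exact hst (by rw [key, key, heq])

lemma exists_dyadicCell_ne {s t : unitInterval} (h : s ≠ t) :
    ∃ p, dyadicCell p s ≠ dyadicCell p t := by
  wlog hlt : s < t generalizing s t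
  · obtain ⟨p, hp⟩ := this h.symm (lt_of_le_of_ne (not_lt.1 hlt) h.symm)
    exact ⟨p, hp.symm⟩
  have hlt' : (s : ℝ) < t := hlt
  obtain ⟨p, hp⟩ := pow_unbounded_of_one_lt ((t - s : ℝ)⁻¹) (one_lt_two : (1 : ℝ) < 2)
  refine ⟨p, fun heq => ?_⟩
  have h1 : (2 : ℝ) ^ p * t < dyadicCell p t + 1 := Nat.lt_floor_add_one _
  have h2 : (dyadicCell p s : ℝ) ≤ 2 ^ p * s :=
    Nat.floor_le (mul_nonneg (by positivity) s.2.1)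
  rw [← heq] at h1
  have h3 : 1 < (2 : ℝ) ^ p * (t - s) := by
    rw [inv_lt_iff_one_lt_mul₀ (by linarith)] at hp
    linarith
  linarith

/-- The rate of the Poisson processes. -/
def updateRate (n : ℕ) (T : ℝ≥0) : ℝ≥0 := 4 * (T + (Real.log n).toNNReal)

/-- The number of earlier ones among the first `m` updates of a node. -/
def updateRank (r : Tape) (m i : ℕ) : ℕ :=
  ∑ a ∈ Finset.range m, if r (2 * a + 1) < r (2 * i + 1) then 1 else 0

/-- The `j`-th of the first `m` updates of a node in order of time. -/
def sortedIndex (r : Tape) (m j : ℕ) : ℕ := sInf {i | i < m ∧ updateRank r m i = j}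

namespace LocalInput

variable {n q : ℕ} (inp : LocalInput n q) (r : Tape)

/-- The number of updates of a node. -/
def updateCount : ℕ := poissonSample (updateRate n inp.T) (r 0)

/-- The time of the `j`-th update. -/
def time (j : ℕ) : unitInterval := r (2 * sortedIndex r (inp.updateCount r) j + 1)

/-- The random draws of the `j`-th update. -/
def draw (j : ℕ) : Fin q × unitInterval :=
  drawSample inp.ν (r (2 * sortedIndex r (inp.updateCount r) j + 2))

/-- The approximate times and the proposed spins of all updates. -/
def updateLog (p : ℕ) : List (ℕ × Fin q) :=
  (List.range (inp.updateCount r)).map fun j => (dyadicCell p (inp.time r j), (inp.draw r j).1)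

end LocalInput

/-! ### The protocol -/

/-- The state that a node announces to its neighbours: the precision `prec` of the update times,
the initial spin, the list of updates in order of time, and the outcomes of those resolved. -/
structure Report (q : ℕ) where
  prec : ℕ
  spin : Fin q
  log : List (ℕ × Fin q)
  outcomes : List Bool

instance (q : ℕ) : Encodable (Report q) :=
  Encodable.ofLeftInverse (fun R => (R.prec, R.spin, R.log, R.outcomes))
    (fun x => ⟨x.1, x.2.1, x.2.2.1, x.2.2.2⟩) fun _ => rfl

/-- The spin after a sequence of proposals with given outcomes. -/
def settle {q : ℕ} (x : Fin q) (cs : List (Fin q)) (as : List Bool) : Fin q :=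
  (cs.zip as).foldl (fun x c => if c.2 then c.1 else x) x

namespace Report

variable {q : ℕ} (R : Report q)

/-- The proposals before the time cell `z`. -/
def proposalsBefore (z : ℕ) : List (Fin q) := (R.log.filter (·.1 < z)).map Prod.snd

/-- The possible spins at a time in the cell `z`. -/
def possible (z : ℕ) : List (Fin q) :=
  settle R.spin (R.proposalsBefore z) R.outcomes :: (R.proposalsBefore z).drop R.outcomes.length

/-- The current spin. -/
def current : Fin q := settle R.spin (R.log.map Prod.snd) R.outcomes

/-- The final spin, once all updates are resolved. -/
def final : Option (Fin q) :=
  if R.log.length ≤ R.outcomes.length then some R.current else none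

end Report

open Classical in
/-- `true` or `false` according to which of `a` and `b` holds, provided that `p` does. -/
def decision (p a b : Prop) : List Bool :=
  if p then if a then [true] else if b then [false] else [] else []

namespace LocalInput

variable {n q : ℕ} (inp : LocalInput n q) (r : Tape)

/-- The reported time cells of the neighbours' updates differ from those of one's own. -/
def Separated (S : inp.nbrs → Report q) : Prop :=
  ∀ u, ∀ j < inp.updateCount r, ∀ a ∈ (S u).log, a.1 ≠ dyadicCell (S u).prec (inp.time r j)

/-- The spins of the neighbours at the time of the `j`-th update may be `σ`. -/
def Possible (S : inp.nbrs → Report q) (j : ℕ) (σ : inp.nbrs → Fin q) : Prop :=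
  ∀ u, σ u ∈ (S u).possible (dyadicCell (S u).prec (inp.time r j))

/-- The `j`-th update is accepted if the current spin is `x` and those of the neighbours are `σ`. -/
def Accepts (j : ℕ) (x : Fin q) (σ : inp.nbrs → Fin q) : Prop :=
  (inp.draw r j).2 < inp.f x (inp.draw r j).1 σ

/-- The outcome of the next update, if it is determined. -/
def resolve (R : Report q) (S : inp.nbrs → Report q) : List Bool :=
  decision (R.outcomes.length < inp.updateCount r ∧ inp.Separated r S)
    (∀ σ, inp.Possible r S R.outcomes.length σ → inp.Accepts r R.outcomes.length R.current σ)
    (∀ σ, inp.Possible r S R.outcomes.length σ → ¬ inp.Accepts r R.outcomes.length R.current σ)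

/-- The report in the next round. -/
def nextReport (R : Report q) (S : inp.nbrs → Report q) : Report q where
  -- Since the precision grows without bound while the node is active, distinct times are separated
  -- in the end, even if the initial precision does not suffice.
  prec := R.prec + 1
  spin := R.spin
  log := inp.updateLog r (R.prec + 1)
  outcomes := R.outcomes ++ inp.resolve r R S

section Measurability

lemma measurableFibers_updateCount : MeasurableFibers fun r => inp.updateCount r :=
  .of_measurable ((measurable_poissonSample _).comp (measurable_pi_apply 0))

lemma measurableFibers_sortedIndex (m j : ℕ) : MeasurableFibers fun r => sortedIndex r m j := by
  refine .sInf_nat fun i => ?_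
  have : Measurable fun r : Tape => updateRank r m i := by
    refine Finset.measurable_sum _ fun a _ => ?_
    exact Measurable.ite (measurableSet_lt (measurable_pi_apply _) (measurable_pi_apply _))
      measurable_const measurable_const
  exact (MeasurableFibers.of_measurable this).comp fun x => i < m ∧ x = j

lemma measurableFibers_of_sortedIndex {β : Type*} (j : ℕ) {g : ℕ → Tape → β}
    (hg : ∀ i, MeasurableFibers (g i)) :
    MeasurableFibers fun r => g (sortedIndex r (inp.updateCount r) j) r :=
  (inp.measurableFibers_updateCount.bind (g := fun m r => sortedIndex r m j) fun m =>
    measurableFibers_sortedIndex m j).bind hg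

lemma measurableFibers_dyadicCell (p j : ℕ) :
    MeasurableFibers fun r => dyadicCell p (inp.time r j) :=
  inp.measurableFibers_of_sortedIndex j (g := fun i r => dyadicCell p (r (2 * i + 1))) fun _ =>
    .of_measurable (Nat.measurable_floor.comp
      (measurable_const.mul (measurable_subtype_coe.comp (measurable_pi_apply _))))

lemma measurableFibers_draw_fst (j : ℕ) : MeasurableFibers fun r => (inp.draw r j).1 :=
  inp.measurableFibers_of_sortedIndex j (g := fun i r => (drawSample inp.ν (r (2 * i + 2))).1)
    fun _ => .of_measurable (measurable_fst.comp
      ((measurable_drawSample inp.ν).comp (measurable_pi_apply _)))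

lemma measurableFibers_accepts (j : ℕ) (x : Fin q) (σ : inp.nbrs → Fin q) :
    MeasurableFibers fun r => inp.Accepts r j x σ := by
  refine (inp.measurableFibers_draw_fst j).bind
    (g := fun c r => (inp.draw r j).2 < inp.f x c σ) fun c => ?_
  refine inp.measurableFibers_of_sortedIndex j
    (g := fun i r => (drawSample inp.ν (r (2 * i + 2))).2 < inp.f x c σ) fun i => ?_
  exact .of_prop (measurableSet_lt (measurable_snd.comp
    ((measurable_drawSample inp.ν).comp (measurable_pi_apply _))) measurable_const)

lemma measurableFibers_updateLog (p : ℕ) : MeasurableFibers fun r => inp.updateLog r p := by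
  refine inp.measurableFibers_updateCount.bind (g := fun m r =>
    (List.range m).map fun j => (dyadicCell p (inp.time r j), (inp.draw r j).1)) fun m => ?_
  exact .listMap _ fun j _ =>
    (inp.measurableFibers_dyadicCell p j).comp₂ (inp.measurableFibers_draw_fst j) Prod.mk

lemma measurableFibers_separated (S : inp.nbrs → Report q) :
    MeasurableFibers fun r => inp.Separated r S :=
  .forall_prop fun u => .forall_prop fun j => (inp.measurableFibers_updateCount.comp (j < ·)).bind
    (g := fun b r => b → ∀ a ∈ (S u).log, a.1 ≠ dyadicCell (S u).prec (inp.time r j)) fun b =>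
      (inp.measurableFibers_dyadicCell (S u).prec j).comp fun z => b → ∀ a ∈ (S u).log, a.1 ≠ z

lemma measurableFibers_possible (S : inp.nbrs → Report q) (j : ℕ) (σ : inp.nbrs → Fin q) :
    MeasurableFibers fun r => inp.Possible r S j σ :=
  .forall_prop fun u => (inp.measurableFibers_dyadicCell (S u).prec j).comp
    fun z => σ u ∈ (S u).possible z

lemma measurableFibers_resolve (R : Report q) (S : inp.nbrs → Report q) :
    MeasurableFibers fun r => inp.resolve r R S := by
  have h1 : MeasurableFibers fun r => R.outcomes.length < inp.updateCount r ∧ inp.Separated r S :=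
    (inp.measurableFibers_updateCount.comp (R.outcomes.length < ·)).comp₂
      (inp.measurableFibers_separated S) And
  have h2 : MeasurableFibers fun r => ∀ σ, inp.Possible r S R.outcomes.length σ →
      inp.Accepts r R.outcomes.length R.current σ :=
    .forall_prop fun σ => (inp.measurableFibers_possible S _ σ).comp₂
      (inp.measurableFibers_accepts _ _ σ) fun a b => a → b
  have h3 : MeasurableFibers fun r => ∀ σ, inp.Possible r S R.outcomes.length σ →
      ¬ inp.Accepts r R.outcomes.length R.current σ :=
    .forall_prop fun σ => (inp.measurableFibers_possible S _ σ).comp₂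
      (inp.measurableFibers_accepts _ _ σ) fun a b => a → ¬ b
  exact (h1.comp₂ h2 decision).comp₂ h3 fun d b => d b

lemma measurableFibers_nextReport (R : Report q) (S : inp.nbrs → Report q) :
    MeasurableFibers fun r => inp.nextReport r R S :=
  (inp.measurableFibers_updateLog _).comp₂ (inp.measurableFibers_resolve R S) fun l o =>
    ({ prec := R.prec + 1, spin := R.spin, log := l, outcomes := R.outcomes ++ o } : Report q)

end Measurability

end LocalInput

/-- The synchronous protocol; `p₀` is the initial precision. -/
def metropolisProtocol (p₀ : ℕ → ℝ≥0 → ℕ) (n q : ℕ) : SyncProtocol n q (Report q) where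
  init inp r := ⟨p₀ n inp.T, inp.init, inp.updateLog r (p₀ n inp.T), []⟩
  next inp r R S := inp.nextReport r R S
  result R := R.final
  measurable_init inp := (inp.measurableFibers_updateLog _).comp fun l =>
    ({ prec := p₀ n inp.T, spin := inp.init, log := l, outcomes := [] } : Report q)
  measurable_next inp R S := inp.measurableFibers_nextReport R S

/-! ### The updates of a single site within the whole sequence. -/

lemma settle_append {q : ℕ} (x : Fin q) {cs cs' : List (Fin q)} {as as' : List Bool}
    (h : cs.length = as.length) :
    settle x (cs ++ cs') (as ++ as') = settle (settle x cs as) cs' as' := by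
  rw [settle, List.zip_append h, List.foldl_append]
  rfl

lemma settle_nil_right {q : ℕ} (x : Fin q) (cs : List (Fin q)) : settle x cs [] = x := by
  simp [settle]

lemma settle_nil_left {q : ℕ} (x : Fin q) (as : List Bool) : settle x [] as = x := by
  simp [settle]

namespace ProposalSeq

variable {n q : ℕ} (X₀ : Fin n → Fin q) (e : ℕ → Proposal n q)

/-- The positions before `l` of the updates of `v`. -/
def positions (v : Fin n) (l : ℕ) : List ℕ := (List.range l).filter fun i => (e i).1 = v

/-- The proposed spins of the updates of `v` before `l`. -/
def spins (v : Fin n) (l : ℕ) : List (Fin q) := (positions e v l).map fun i => (e i).2.1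

/-- The outcome of an update. -/
def outcome (l : ℕ) : Bool := (e l).2.2 (trajectory X₀ e l)

/-- The outcomes of the updates of `v` before `l`. -/
def outcomes (v : Fin n) (l : ℕ) : List Bool := (positions e v l).map (outcome X₀ e)

variable {X₀ e} {v : Fin n}

lemma mem_positions {i l : ℕ} : i ∈ positions e v l ↔ i < l ∧ (e i).1 = v := by
  simp [positions]

lemma positions_succ_of_eq {l : ℕ} (h : (e l).1 = v) :
    positions e v (l + 1) = positions e v l ++ [l] := by
  simp [positions, List.range_succ, h]

lemma positions_succ_of_ne {l : ℕ} (h : (e l).1 ≠ v) :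
    positions e v (l + 1) = positions e v l := by
  simp [positions, List.range_succ, h]

lemma exists_positions_append {b l : ℕ} (h : b ≤ l) :
    ∃ L, positions e v l = positions e v b ++ L ∧ ∀ i ∈ L, b ≤ i ∧ i < l ∧ (e i).1 = v := by
  induction l, h using Nat.le_induction with
  | base => exact ⟨[], by simp, by simp⟩
  | succ l hbl ih =>
    obtain ⟨L, h1, h2⟩ := ih
    by_cases hl : (e l).1 = v
    · refine ⟨L ++ [l], by rw [positions_succ_of_eq hl, h1, List.append_assoc], fun i hi => ?_⟩
      rcases List.mem_append.1 hi with hi | hi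
      · have := h2 i hi; exact ⟨this.1, by omega, this.2.2⟩
      · obtain rfl := List.mem_singleton.1 hi
        exact ⟨hbl, by omega, hl⟩
    · refine ⟨L, by rw [positions_succ_of_ne hl, h1], fun i hi => ?_⟩
      have := h2 i hi; exact ⟨this.1, by omega, this.2.2⟩

lemma length_positions_mono {b l : ℕ} (h : b ≤ l) :
    (positions e v b).length ≤ (positions e v l).length := by
  obtain ⟨L, h1, -⟩ := exists_positions_append (e := e) (v := v) h
  simp [h1]

lemma length_positions_lt {b l : ℕ} (h : b < l) (hb : (e b).1 = v) :
    (positions e v b).length < (positions e v l).length := by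
  refine lt_of_lt_of_le ?_ (length_positions_mono (Nat.succ_le_of_lt h))
  rw [Nat.succ_eq_add_one, positions_succ_of_eq hb]; simp

lemma positions_eq_of_length_eq {b l : ℕ}
    (h : (positions e v b).length = (positions e v l).length) :
    positions e v b = positions e v l := by
  wlog hbl : b ≤ l generalizing b l
  · exact (this h.symm (by omega)).symm
  obtain ⟨L, h1, -⟩ := exists_positions_append (e := e) (v := v) hbl
  rw [h1] at h ⊢
  have : L = [] := List.length_eq_zero_iff.1 (by simp at h; simp [h])
  simp [this]

lemma exists_length_positions_eq {j l : ℕ} (h : j < (positions e v l).length) :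
    ∃ i < l, (e i).1 = v ∧ (positions e v i).length = j := by
  induction l with
  | zero => simp [positions] at h
  | succ l ih =>
    by_cases hl : (e l).1 = v
    · rw [positions_succ_of_eq hl, List.length_append, List.length_singleton] at h
      rcases (Nat.lt_succ_iff.1 h).lt_or_eq with h | h
      · obtain ⟨i, h1, h2⟩ := ih h
        exact ⟨i, by omega, h2⟩
      · exact ⟨l, by omega, hl, h.symm⟩
    · rw [positions_succ_of_ne hl] at h
      obtain ⟨i, h1, h2⟩ := ih h
      exact ⟨i, by omega, h2⟩

@[simp] lemma length_spins (l : ℕ) : (spins e v l).length = (positions e v l).length := by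
  simp [spins]

@[simp] lemma length_outcomes (l : ℕ) :
    (outcomes X₀ e v l).length = (positions e v l).length := by
  simp [outcomes]

lemma settle_spins_outcomes (l : ℕ) :
    settle (X₀ v) (spins e v l) (outcomes X₀ e v l) = trajectory X₀ e l v := by
  induction l with
  | zero => simp [spins, positions, settle_nil_left, trajectory]
  | succ l ih =>
    by_cases hl : (e l).1 = v
    · rw [spins, outcomes, positions_succ_of_eq hl, List.map_append, List.map_append,
        settle_append _ (by simp)]
      change settle (settle (X₀ v) (spins e v l) (outcomes X₀ e v l)) _ _ = _
      rw [ih, trajectory]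
      subst hl
      rw [Proposal.apply_self]
      rfl
    · rw [spins, outcomes, positions_succ_of_ne hl, trajectory, Proposal.apply_of_ne _ _ hl]
      exact ih

/-- Outcomes beyond the updates before `l` are dropped by the `zip` in `settle`, so knowing too much
does no harm. -/
lemma settle_spins_of_le {b l : ℕ} (h : (positions e v l).length ≤ (positions e v b).length) :
    settle (X₀ v) (spins e v l) (outcomes X₀ e v b) = trajectory X₀ e l v := by
  obtain ⟨b', hb', hlb⟩ : ∃ b', positions e v b' = positions e v b ∧ l ≤ b' := by
    rcases le_total l b with hlb | hbl
    · exact ⟨b, rfl, hlb⟩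
    · exact ⟨l, positions_eq_of_length_eq (le_antisymm h (length_positions_mono hbl)), le_rfl⟩
  obtain ⟨L, h1, -⟩ := exists_positions_append (e := e) (v := v) hlb
  have h2 : outcomes X₀ e v b = outcomes X₀ e v l ++ L.map (outcome X₀ e) := by
    rw [outcomes, ← hb', h1, List.map_append]; rfl
  rw [h2, ← List.append_nil (spins e v l), settle_append _ (by simp), settle_spins_outcomes,
    settle_nil_left]

lemma settle_spins_of_ge {b l : ℕ} (h : b ≤ l) :
    settle (X₀ v) (spins e v l) (outcomes X₀ e v b) = trajectory X₀ e b v := by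
  obtain ⟨L, h1, -⟩ := exists_positions_append (e := e) (v := v) h
  rw [spins, h1, List.map_append, ← List.append_nil (outcomes X₀ e v b),
    settle_append _ (by simp [outcomes]), settle_nil_right]
  exact settle_spins_outcomes b

lemma trajectory_mem_cons {b l : ℕ} (h : b ≤ l) :
    trajectory X₀ e l v ∈ trajectory X₀ e b v ::
      (spins e v l).drop (positions e v b).length := by
  induction l, h using Nat.le_induction with
  | base => simp
  | succ l hbl ih =>
    by_cases hl : (e l).1 = v
    · have h1 : spins e v (l + 1) = spins e v l ++ [(e l).2.1] := by
        simp [spins, positions_succ_of_eq hl]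
      rw [h1, List.drop_append_of_le_length (by simpa using length_positions_mono hbl),
        ← List.cons_append]
      subst hl
      rw [trajectory, Proposal.apply_self]
      split_ifs
      · simp
      · exact List.mem_append_left _ ih
    · have h1 : spins e v (l + 1) = spins e v l := by simp [spins, positions_succ_of_ne hl]
      rwa [h1, trajectory, Proposal.apply_of_ne _ _ hl]

/-- The spins that are possible for a node just before the `l`-th update when the outcomes of its
updates before `b` are known. -/
lemma trajectory_mem_possible (b l : ℕ) :
    trajectory X₀ e l v ∈ settle (X₀ v) (spins e v l) (outcomes X₀ e v b) ::
      (spins e v l).drop (outcomes X₀ e v b).length := by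
  rcases le_total l b with h | h
  · rw [settle_spins_of_le (length_positions_mono h)]
    simp
  · rw [settle_spins_of_ge h, length_outcomes]
    exact trajectory_mem_cons h

/-- A node that knows at least the outcomes in `D` excludes at least as much. If `i` is the first
update of `v` before `l` with unknown outcome, the settled spin is the one before `i`, and the other
possible spins are proposals of `i` or later updates, none of which is in `D`. -/
lemma possible_subset_candidates {D : Set ℕ} {b l : ℕ}
    (hD : ∀ i < l, i ∈ D → (e i).1 = v → (positions e v i).length < (positions e v b).length)
    {x : Fin q} (hx : x ∈ settle (X₀ v) (spins e v l) (outcomes X₀ e v b) ::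
      (spins e v l).drop (outcomes X₀ e v b).length) : x ∈ candidates X₀ e D l v := by
  rcases le_or_gt (positions e v l).length (positions e v b).length with h | h
  · rw [settle_spins_of_le h, List.drop_eq_nil_of_le (by simpa using h)] at hx
    exact Or.inl (List.mem_singleton.1 hx)
  · obtain ⟨i, hil, hiv, hib⟩ := exists_length_positions_eq h
    have hpos := positions_eq_of_length_eq hib
    have hout : outcomes X₀ e v b = outcomes X₀ e v i := by rw [outcomes, ← hpos]; rfl
    rw [hout, settle_spins_of_ge hil.le] at hx
    rcases List.mem_cons.1 hx with hx | hx
    · exact Or.inr ⟨i, hil, hiv, fun hi => absurd (hD i hil hi hiv) (by omega), Or.inl hx⟩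
    · obtain ⟨L, h1, h2⟩ := exists_positions_append (e := e) (v := v) hil.le
      rw [spins, h1, List.map_append, List.drop_left' (by simp)] at hx
      obtain ⟨j, hj, rfl⟩ := List.mem_map.1 hx
      obtain ⟨h3, h4, h5⟩ := h2 j hj
      refine Or.inr ⟨j, h4, h5, fun hj' => absurd (hD j h4 hj' h5) ?_, Or.inr rfl⟩
      have := length_positions_mono (e := e) (v := v) h3
      omega

end ProposalSeq

/-! ### Soundness of the reports and of the resolution rule. -/

namespace MetropolisChain

open ProposalSeq

variable {n q : ℕ} (M : MetropolisChain n q) (T : ℝ≥0) (X₀ : Fin n → Fin q)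

/-- The local input of node `v`. -/
abbrev localInput (v : Fin n) : LocalInput n q :=
  ⟨M.G.neighborSet v, T, X₀ v, M.ν v, M.f v⟩

/-- The updates of all nodes, in order of time, are `e 0, …, e (N - 1)`, at the times
`τ 0, …, τ (N - 1)`. -/
structure IsTimeline (ω : Fin n → Tape) (N : ℕ) (e : ℕ → Proposal n q) (τ : ℕ → unitInterval) :
    Prop where
  count : ∀ v, (M.localInput T X₀ v).updateCount (ω v) = (positions e v N).length
  strictMonoOn : StrictMonoOn τ (Set.Iio N)
  time_eq : ∀ l < N, (M.localInput T X₀ (e l).1).time (ω (e l).1)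
    (positions e (e l).1 l).length = τ l
  draw_eq : ∀ l < N, M.proposal (e l).1 ((M.localInput T X₀ (e l).1).draw (ω (e l).1)
    (positions e (e l).1 l).length) = e l

namespace IsTimeline

variable {M T X₀} {ω : Fin n → Tape} {N : ℕ} {e : ℕ → Proposal n q} {τ : ℕ → unitInterval}

lemma updateLog_eq (h : M.IsTimeline T X₀ ω N e τ) (v : Fin n) (p : ℕ) :
    (M.localInput T X₀ v).updateLog (ω v) p =
      (positions e v N).map fun l => (dyadicCell p (τ l), (e l).2.1) := by
  rw [LocalInput.updateLog, h.count]
  suffices H : ∀ N' ≤ N, (List.range (positions e v N').length).map (fun j =>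
      (dyadicCell p ((M.localInput T X₀ v).time (ω v) j),
        ((M.localInput T X₀ v).draw (ω v) j).1)) =
      (positions e v N').map fun l => (dyadicCell p (τ l), (e l).2.1) from H N le_rfl
  intro N' hN'
  induction N' with
  | zero => simp [positions]
  | succ l ih =>
    by_cases hl : (e l).1 = v
    · subst hl
      have h1 := congrArg (fun p : Proposal n q => p.2.1) (h.draw_eq l hN')
      change ((M.localInput T X₀ (e l).1).draw _ _).1 = _ at h1
      rw [positions_succ_of_eq rfl, List.length_append, List.length_singleton, List.range_succ,
        List.map_append, List.map_append, ih (by omega), List.map_singleton, List.map_singleton,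
        h.time_eq l hN', h1]
    · rw [positions_succ_of_ne hl]
      exact ih (by omega)

lemma monotone_time (h : M.IsTimeline T X₀ ω N e τ) {i l : ℕ} (hil : i ≤ l) (hl : l < N) :
    τ i ≤ τ l :=
  h.strictMonoOn.monotoneOn (hil.trans_lt hl) hl hil

lemma exists_eq (h : M.IsTimeline T X₀ ω N e τ) {v : Fin n} {j : ℕ}
    (hj : j < (M.localInput T X₀ v).updateCount (ω v)) :
    ∃ l < N, (e l).1 = v ∧ (positions e v l).length = j ∧
      (M.localInput T X₀ v).time (ω v) j = τ l := by
  rw [h.count] at hj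
  obtain ⟨l, hl, rfl, rfl⟩ := exists_length_positions_eq hj
  exact ⟨l, hl, rfl, rfl, h.time_eq l hl⟩

end IsTimeline

/-- What a node reports when it knows the outcomes of its updates before `b`. -/
structure SoundReport (ω : Fin n → Tape) (N : ℕ) (e : ℕ → Proposal n q) (v : Fin n) (S : Report q)
    (b : ℕ) : Prop where
  spin : S.spin = X₀ v
  log : S.log = (M.localInput T X₀ v).updateLog (ω v) S.prec
  le : b ≤ N
  outcomes : S.outcomes = outcomes X₀ e v b

namespace SoundReport

variable {M T X₀} {ω : Fin n → Tape} {N : ℕ} {e : ℕ → Proposal n q} {τ : ℕ → unitInterval}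
  {v : Fin n} {S : Report q} {b : ℕ}

lemma map_log (hS : M.SoundReport T X₀ ω N e v S b) (h : M.IsTimeline T X₀ ω N e τ) :
    S.log.map Prod.snd = spins e v N := by
  rw [hS.log, h.updateLog_eq, List.map_map]
  rfl

lemma length_log (hS : M.SoundReport T X₀ ω N e v S b) (h : M.IsTimeline T X₀ ω N e τ) :
    S.log.length = (positions e v N).length := by
  rw [hS.log, h.updateLog_eq, List.length_map]

lemma current_eq (hS : M.SoundReport T X₀ ω N e v S b) (h : M.IsTimeline T X₀ ω N e τ) :
    S.current = trajectory X₀ e b v := by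
  rw [Report.current, hS.spin, hS.map_log h, hS.outcomes, settle_spins_of_ge hS.le]

/-- Cells are monotone in time. Separation makes the inequality strict for earlier updates, so
comparing cells amounts to comparing times. -/
lemma proposalsBefore_eq (hS : M.SoundReport T X₀ ω N e v S b) (h : M.IsTimeline T X₀ ω N e τ)
    {l : ℕ} (hl : l < N) (hsep : ∀ a ∈ S.log, a.1 ≠ dyadicCell S.prec (τ l)) :
    S.proposalsBefore (dyadicCell S.prec (τ l)) = spins e v l := by
  rw [hS.log, h.updateLog_eq] at hsep
  rw [Report.proposalsBefore, hS.log, h.updateLog_eq, List.filter_map, List.map_map, spins]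
  obtain ⟨L, h1, h2⟩ := exists_positions_append (e := e) (v := v) hl.le
  have h3 : (positions e v N).filter ((fun a : ℕ × Fin q => decide (a.1 < dyadicCell S.prec (τ l)))
      ∘ fun l => (dyadicCell S.prec (τ l), (e l).2.1)) = positions e v l := by
    rw [h1, List.filter_append, List.filter_eq_self.2, List.filter_eq_nil_iff.2, List.append_nil]
    · intro i hi
      obtain ⟨h3, h4, -⟩ := h2 i hi
      simpa using dyadicCell_mono S.prec (h.monotone_time h3 h4)
    · intro i hi
      have hil := (mem_positions.1 hi).1
      simp only [Function.comp, decide_eq_true_eq]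
      refine lt_of_le_of_ne (dyadicCell_mono _ (h.monotone_time hil.le hl)) ?_
      refine hsep (dyadicCell S.prec (τ i), (e i).2.1) (List.mem_map.2 ⟨i, ?_, rfl⟩)
      rw [h1]
      exact List.mem_append_left _ hi
  rw [h3]
  rfl

lemma possible_eq (hS : M.SoundReport T X₀ ω N e v S b) (h : M.IsTimeline T X₀ ω N e τ)
    {l : ℕ} (hl : l < N) (hsep : ∀ a ∈ S.log, a.1 ≠ dyadicCell S.prec (τ l)) :
    S.possible (dyadicCell S.prec (τ l)) =
      settle (X₀ v) (spins e v l) (ProposalSeq.outcomes X₀ e v b) ::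
        (spins e v l).drop (ProposalSeq.outcomes X₀ e v b).length := by
  rw [Report.possible, hS.proposalsBefore_eq h hl hsep, hS.spin, hS.outcomes]

lemma final_eq (hS : M.SoundReport T X₀ ω N e v S b) (h : M.IsTimeline T X₀ ω N e τ)
    (hb : (positions e v N).length ≤ S.outcomes.length) :
    S.final = some (trajectory X₀ e N v) := by
  rw [Report.final, if_pos (by rwa [hS.length_log h]), hS.current_eq h]
  rw [hS.outcomes, length_outcomes] at hb
  rw [← settle_spins_of_ge (X₀ := X₀) hS.le, settle_spins_of_le hb]

end SoundReport

section Resolve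

variable {M T X₀} {ω : Fin n → Tape} {N : ℕ} {e : ℕ → Proposal n q} {τ : ℕ → unitInterval}

lemma accepts_iff (h : M.IsTimeline T X₀ ω N e τ) {l : ℕ} (hl : l < N) (X : Fin n → Fin q) :
    (M.localInput T X₀ (e l).1).Accepts (ω (e l).1) (positions e (e l).1 l).length (X (e l).1)
      (fun u => X u) ↔ (e l).2.2 X = true := by
  conv_rhs => rw [← h.draw_eq l hl]
  simp [LocalInput.Accepts, proposal]

variable {l : ℕ} {R : Report q} {S : Fin n → Report q} {b : Fin n → ℕ}

/-- The next update is resolved correctly, if at all, and it is resolved if it is determined by the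
known outcomes. -/
lemma resolve_eq (h : M.IsTimeline T X₀ ω N e τ) (hl : l < N)
    (hR : M.SoundReport T X₀ ω N e (e l).1 R l)
    (hS : ∀ u, M.SoundReport T X₀ ω N e u (S u) (b u))
    (hsep : (M.localInput T X₀ (e l).1).Separated (ω (e l).1) fun u => S u) :
    ((M.localInput T X₀ (e l).1).resolve (ω (e l).1) R (fun u => S u) = [] ∨
      (M.localInput T X₀ (e l).1).resolve (ω (e l).1) R (fun u => S u) = [outcome X₀ e l]) ∧
    ∀ D : Set ℕ, (∀ u, ∀ i < l, i ∈ D → (e i).1 = u → (positions e u i).length <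
        (positions e u (b u)).length) → ¬ (e l).Ambiguous (box X₀ e D l) →
      (M.localInput T X₀ (e l).1).resolve (ω (e l).1) R (fun u => S u) = [outcome X₀ e l] := by
  set v := (e l).1 with hv
  set inp := M.localInput T X₀ v with hinp
  have hlen : R.outcomes.length = (positions e v l).length := by rw [hR.outcomes, length_outcomes]
  have hlt : (positions e v l).length < inp.updateCount (ω v) := by
    rw [h.count]; exact length_positions_lt hl rfl
  have hposs : ∀ u : M.G.neighborSet v, (S u).possible (dyadicCell (S u).prec (inp.time (ω v)
      (positions e v l).length)) = settle (X₀ u) (spins e u l) (outcomes X₀ e u (b u)) ::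
        (spins e u l).drop (outcomes X₀ e u (b u)).length := by
    intro u
    have h1 := hsep u _ hlt
    have h2 : inp.time (ω v) (positions e v l).length = τ l := h.time_eq l hl
    rw [h2] at h1 ⊢
    exact (hS u).possible_eq h hl h1
  have hpossible : ∀ σ : M.G.neighborSet v → Fin q, inp.Possible (ω v) (fun u => S u)
      R.outcomes.length σ ↔ ∀ u : M.G.neighborSet v,
        σ u ∈ settle (X₀ u) (spins e u l) (outcomes X₀ e u (b u)) ::
        (spins e u l).drop (outcomes X₀ e u (b u)).length := by
    intro σ
    refine forall_congr' fun u => ?_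
    rw [hlen]
    exact iff_of_eq (congrArg (σ u ∈ ·) (hposs u))
  -- The true spins of the neighbours are never excluded, so a decision on which all possible spins
  -- agree is the right one.
  have hself : inp.Possible (ω v) (fun u => S u) R.outcomes.length
      fun u => trajectory X₀ e l u :=
    (hpossible _).2 fun u => trajectory_mem_possible (b u) l
  have haccepts := accepts_iff h hl
  rw [← hv] at haccepts
  have hcur : R.current = trajectory X₀ e l v := hR.current_eq h
  have htraj := haccepts (trajectory X₀ e l)
  have hp : R.outcomes.length < inp.updateCount (ω v) ∧ inp.Separated (ω v) fun u => S u :=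
    ⟨hlen ▸ hlt, hsep⟩
  have key : ∀ o, inp.resolve (ω v) R (fun u => S u) = o → o = [outcome X₀ e l] ∨ (o = [] ∧
      (∃ σ, inp.Possible (ω v) (fun u => S u) R.outcomes.length σ ∧
        ¬ inp.Accepts (ω v) R.outcomes.length R.current σ) ∧
      (∃ σ, inp.Possible (ω v) (fun u => S u) R.outcomes.length σ ∧
        inp.Accepts (ω v) R.outcomes.length R.current σ)) := by
    rintro o rfl
    rw [LocalInput.resolve, decision, if_pos hp]
    split_ifs with h1 h2
    · have h3 := h1 _ hself
      rw [hlen, hcur] at h3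
      exact Or.inl (by rw [outcome, htraj.1 h3])
    · have h3 := h2 _ hself
      rw [hlen, hcur, htraj] at h3
      exact Or.inl (by rw [outcome, Bool.eq_false_iff.2 h3])
    · right
      push Not at h1 h2
      exact ⟨rfl, h1, h2⟩
  refine ⟨?_, fun D hD hamb => ?_⟩
  · rcases key _ rfl with h1 | h1
    exacts [Or.inr h1, Or.inl h1.1]
  · rcases key _ rfl with h1 | ⟨-, ⟨σ, hσ, hσ'⟩, ⟨τ', hτ, hτ'⟩⟩
    · exact h1
    exfalso
    classical
    -- Possible spins of the neighbours, completed by the true spins elsewhere, form a state in the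
    -- box. Two of them with opposite decisions would make the update ambiguous.
    have hbox : ∀ σ : M.G.neighborSet v → Fin q, inp.Possible (ω v) (fun u => S u)
        R.outcomes.length σ → ∃ X ∈ box X₀ e D l, X v = trajectory X₀ e l v ∧
          (fun u : M.G.neighborSet v => X u) = σ := by
      intro σ hσ
      refine ⟨fun u => if hu : u ∈ M.G.neighborSet v then σ ⟨u, hu⟩ else trajectory X₀ e l u,
        fun u => ?_, ?_, ?_⟩
      · by_cases hu : u ∈ M.G.neighborSet v
        · simp only [hu, dif_pos]
          exact possible_subset_candidates (hD u) ((hpossible σ).1 hσ ⟨u, hu⟩)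
        · simp only [hu, dif_neg, not_false_eq_true]
          exact Or.inl rfl
      · simp
      · funext u
        simp
    obtain ⟨X, hX, hXv, hXσ⟩ := hbox σ hσ
    obtain ⟨Y, hY, hYv, hYσ⟩ := hbox τ' hτ
    have h1 := haccepts X
    have h2 := haccepts Y
    rw [hXσ, hXv, ← hcur, ← hlen] at h1
    rw [hYσ, hYv, ← hcur, ← hlen] at h2
    exact hamb ⟨Y, hY, X, hX, h2.1 hτ', by
      rw [h1] at hσ'; simpa using hσ'⟩

end Resolve

end MetropolisChain

/-! ### Progress of the protocol. -/

lemma metropolisProtocol_done_iff {p₀ : ℕ → ℝ≥0 → ℕ} {n q : ℕ} {S : Report q} :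
    (metropolisProtocol p₀ n q).Done S ↔ S.log.length ≤ S.outcomes.length := by
  change S.final.isSome ↔ _
  rw [Report.final]
  split_ifs with h <;> simp [h]

namespace MetropolisChain

open ProposalSeq

variable {n q : ℕ} {M : MetropolisChain n q} {T : ℝ≥0} {X₀ : Fin n → Fin q}
  {ω : Fin n → Tape} {N : ℕ} {e : ℕ → Proposal n q} {τ : ℕ → unitInterval}

/-- The cut-off of a report matters only up to the updates of `v`, so it can be moved to the next
update to be resolved. -/
lemma SoundReport.exists_next {v : Fin n} {S : Report q} {b : ℕ}
    (hS : M.SoundReport T X₀ ω N e v S b) (h : S.outcomes.length < (positions e v N).length) :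
    ∃ l < N, (e l).1 = v ∧ (positions e v l).length = S.outcomes.length ∧
      M.SoundReport T X₀ ω N e v S l := by
  obtain ⟨l, hl, hlv, hlen⟩ := exists_length_positions_eq h
  refine ⟨l, hl, hlv, hlen, hS.spin, hS.log, hl.le, ?_⟩
  rw [hS.outcomes, length_outcomes] at hlen
  rw [hS.outcomes, ProposalSeq.outcomes, ← positions_eq_of_length_eq hlen]
  rfl

lemma resolve_eq_nil {n q : ℕ} {inp : LocalInput n q} {r : Tape} {R : Report q}
    {S : inp.nbrs → Report q} (h : ¬ inp.Separated r S) : inp.resolve r R S = [] := by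
  rw [LocalInput.resolve, decision, if_neg fun h' => h h'.2]

lemma SoundReport.nextReport {v : Fin n} {R : Report q} {b : ℕ}
    (hR : M.SoundReport T X₀ ω N e v R b) (h : M.IsTimeline T X₀ ω N e τ)
    (hlt : R.outcomes.length < (positions e v N).length) {S : Fin n → Report q} {c : Fin n → ℕ}
    (hS : ∀ u, M.SoundReport T X₀ ω N e u (S u) (c u)) :
    ∃ b', M.SoundReport T X₀ ω N e v
      ((M.localInput T X₀ v).nextReport (ω v) R fun u => S u) b' := by
  obtain ⟨l, hl, rfl, hlen, hR'⟩ := hR.exists_next hlt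
  by_cases hsep : (M.localInput T X₀ (e l).1).Separated (ω (e l).1) fun u => S u
  · rcases (resolve_eq h hl hR' hS hsep).1 with h1 | h1
    · exact ⟨l, hR'.spin, rfl, hR'.le, by rw [LocalInput.nextReport, h1]; simpa using hR'.outcomes⟩
    · refine ⟨l + 1, hR'.spin, rfl, hl, ?_⟩
      rw [LocalInput.nextReport, h1]
      simp only [hR'.outcomes]
      rw [ProposalSeq.outcomes, ProposalSeq.outcomes, positions_succ_of_eq rfl, List.map_append]
      rfl
  · exact ⟨l, hR'.spin, rfl, hR'.le, by
      rw [LocalInput.nextReport, resolve_eq_nil hsep]; simpa using hR'.outcomes⟩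

variable (M T X₀ ω) in
/-- The states of the synchronous protocol. -/
abbrev report (p₀ : ℕ → ℝ≥0 → ℕ) (k : ℕ) (v : Fin n) : Report q :=
  (metropolisProtocol p₀ n q).state (M.localInput T X₀) ω k v

variable {p₀ : ℕ → ℝ≥0 → ℕ}

lemma report_succ_of_done {k : ℕ} {v : Fin n}
    (hd : (metropolisProtocol p₀ n q).Done (M.report T X₀ ω p₀ k v)) :
    M.report T X₀ ω p₀ (k + 1) v = M.report T X₀ ω p₀ k v :=
  hd.state_succ

lemma report_succ_of_not_done {k : ℕ} {v : Fin n}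
    (hd : ¬ (metropolisProtocol p₀ n q).Done (M.report T X₀ ω p₀ k v)) :
    M.report T X₀ ω p₀ (k + 1) v = (M.localInput T X₀ v).nextReport (ω v)
      (M.report T X₀ ω p₀ k v) fun u => M.report T X₀ ω p₀ k u := by
  rw [report, SyncProtocol.state, if_neg hd]
  rfl

lemma SoundReport.done_iff {v : Fin n} {S : Report q} {b : ℕ}
    (hS : M.SoundReport T X₀ ω N e v S b) (h : M.IsTimeline T X₀ ω N e τ) :
    (metropolisProtocol p₀ n q).Done S ↔ (positions e v N).length ≤ S.outcomes.length := by
  rw [metropolisProtocol_done_iff, hS.length_log h]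

lemma exists_soundReport (h : M.IsTimeline T X₀ ω N e τ) (k : ℕ) (v : Fin n) :
    ∃ b, M.SoundReport T X₀ ω N e v (M.report T X₀ ω p₀ k v) b := by
  induction k generalizing v with
  | zero => exact ⟨0, rfl, rfl, Nat.zero_le _, rfl⟩
  | succ k ih =>
    by_cases hd : (metropolisProtocol p₀ n q).Done (M.report T X₀ ω p₀ k v)
    · rw [report_succ_of_done hd]
      exact ih v
    · choose c hc using ih
      rw [report_succ_of_not_done hd]
      rw [(hc v).done_iff h, not_le] at hd
      exact (hc v).nextReport h hd hc

lemma prec_report (k : ℕ) (v : Fin n)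
    (hd : ¬ (metropolisProtocol p₀ n q).Done (M.report T X₀ ω p₀ k v)) :
    (M.report T X₀ ω p₀ k v).prec = p₀ n T + k := by
  induction k with
  | zero => rfl
  | succ k ih =>
    have hd' : ¬ (metropolisProtocol p₀ n q).Done (M.report T X₀ ω p₀ k v) := fun hd' =>
      hd (by rwa [report_succ_of_done hd'])
    rw [report_succ_of_not_done hd', LocalInput.nextReport]
    change (M.report T X₀ ω p₀ k v).prec + 1 = _
    rw [ih hd', add_assoc]

/-- At precision `p`, the update times of `u` and `v` are in different cells. -/
def CellsDiffer (e : ℕ → Proposal n q) (τ : ℕ → unitInterval) (N p : ℕ) (u v : Fin n) : Prop :=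
  ∀ i < N, ∀ j < N, (e i).1 = u → (e j).1 = v → dyadicCell p (τ i) ≠ dyadicCell p (τ j)

lemma CellsDiffer.mono {p p' : ℕ} {u v : Fin n} (h : CellsDiffer e τ N p u v) (hp : p ≤ p') :
    CellsDiffer e τ N p' u v :=
  fun i hi j hj h1 h2 => dyadicCell_ne_of_le hp (h i hi j hj h1 h2)

lemma CellsDiffer.symm {p : ℕ} {u v : Fin n} (h : CellsDiffer e τ N p u v) :
    CellsDiffer e τ N p v u :=
  fun i hi j hj h1 h2 => (h j hj i hi h2 h1).symm

lemma separated_iff (h : M.IsTimeline T X₀ ω N e τ) {S : Fin n → Report q} {c : Fin n → ℕ}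
    (hS : ∀ u, M.SoundReport T X₀ ω N e u (S u) (c u)) (v : Fin n) :
    ((M.localInput T X₀ v).Separated (ω v) fun u => S u) ↔
      ∀ u, M.G.Adj v u → CellsDiffer e τ N (S u).prec u v := by
  constructor
  · intro hsep u hu i hi j hj hiu hjv
    subst hjv
    have h1 : (positions e (e j).1 j).length <
        (M.localInput T X₀ (e j).1).updateCount (ω (e j).1) := by
      rw [h.count]; exact length_positions_lt hj rfl
    have h2 := hsep ⟨u, hu⟩ _ h1 (dyadicCell (S u).prec (τ i), (e i).2.1) (by
      change _ ∈ (S u).log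
      rw [(hS u).log, h.updateLog_eq]
      exact List.mem_map.2 ⟨i, mem_positions.2 ⟨hi, hiu⟩, rfl⟩)
    rwa [h.time_eq j hj] at h2
  · intro hd u j hj a ha
    have ha' : a ∈ (S u).log := ha
    rw [(hS u).log, h.updateLog_eq] at ha'
    obtain ⟨i, hi, rfl⟩ := List.mem_map.1 ha'
    obtain ⟨l, hl, hlv, -, hlt⟩ := h.exists_eq hj
    obtain ⟨hiN, hiu⟩ := mem_positions.1 hi
    rw [hlt]
    exact hd u u.2 i hiN l hl hiu hlv

/-- A node that has resolved some updates knows that its update times differ from those of the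
neighbours that are not done. -/
lemma cellsDiffer_report (h : M.IsTimeline T X₀ ω N e τ) (k : ℕ) {u v : Fin n}
    (huv : M.G.Adj u v) (ho : (M.report T X₀ ω p₀ k u).outcomes ≠ [])
    (hd : ¬ (metropolisProtocol p₀ n q).Done (M.report T X₀ ω p₀ k v)) :
    CellsDiffer e τ N (M.report T X₀ ω p₀ k u).prec u v := by
  induction k with
  | zero => exact absurd rfl ho
  | succ k ih =>
    have hd' : ¬ (metropolisProtocol p₀ n q).Done (M.report T X₀ ω p₀ k v) := fun hd' =>
      hd (by rwa [report_succ_of_done hd'])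
    by_cases hu : (metropolisProtocol p₀ n q).Done (M.report T X₀ ω p₀ k u)
    · rw [report_succ_of_done hu] at ho ⊢
      exact ih ho hd'
    rw [report_succ_of_not_done hu] at ho ⊢
    change CellsDiffer e τ N ((M.report T X₀ ω p₀ k u).prec + 1) u v
    by_cases ho' : (M.report T X₀ ω p₀ k u).outcomes = []
    · choose c hc using fun u => exists_soundReport (p₀ := p₀) h k u
      have hsep : (M.localInput T X₀ u).Separated (ω u) fun w => M.report T X₀ ω p₀ k w := by
        by_contra hsep
        apply ho
        change (M.report T X₀ ω p₀ k u).outcomes ++ (M.localInput T X₀ u).resolve (ω u) _ _ = []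
        rw [resolve_eq_nil hsep, ho']
        rfl
      have h1 := ((separated_iff h hc u).1 hsep v huv).symm
      -- Both nodes are still active, so they have the same precision, and what `u` checked for the
      -- times of `v` also holds at its own precision.
      rw [prec_report k v hd', ← prec_report k u hu] at h1
      exact h1.mono (Nat.le_succ _)
    · exact (ih ho' hd').mono (Nat.le_succ _)

/-- The protocol makes as much progress as the resolution of the sequence of updates, once the
precision is high enough. -/
lemma length_positions_lt_of_mem_resolved (h : M.IsTimeline T X₀ ω N e τ) {r : ℕ}
    (hr : ∀ i < N, ∀ j < N, i ≠ j →
      dyadicCell (p₀ n T + r) (τ i) ≠ dyadicCell (p₀ n T + r) (τ j))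
    (k : ℕ) {i : ℕ} (hi : i < N) (hres : i ∈ resolved X₀ e k) :
    (positions e (e i).1 i).length < (M.report T X₀ ω p₀ (r + k) (e i).1).outcomes.length := by
  induction k generalizing i with
  | zero => exact absurd hres (Set.notMem_empty i)
  | succ k ih =>
    choose c hc using fun u => exists_soundReport (p₀ := p₀) h (r + k) u
    rw [← add_assoc]
    by_cases hd : (metropolisProtocol p₀ n q).Done (M.report T X₀ ω p₀ (r + k) (e i).1)
    · rw [report_succ_of_done hd]
      rw [(hc _).done_iff h] at hd
      exact (length_positions_lt hi rfl).trans_le hd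
    have hd' := hd
    rw [(hc _).done_iff h, not_le] at hd'
    rw [report_succ_of_not_done hd]
    change _ < ((M.report T X₀ ω p₀ (r + k) (e i).1).outcomes ++
      (M.localInput T X₀ (e i).1).resolve (ω (e i).1) _ _).length
    rw [List.length_append]
    by_contra! hlt
    obtain ⟨l, hl, hlv, hlen, hl'⟩ := (hc (e i).1).exists_next hd'
    -- The next update in line is `i` itself: the earlier ones at its site are already resolved by
    -- induction, and `i` is not yet.
    obtain rfl : l = i := by
      rcases lt_trichotomy l i with hli | rfl | hli
      · have := ih hl (hres.1 l hli hlv)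
        rw [hlv] at this
        omega
      · rfl
      · have := length_positions_lt hli (rfl : (e i).1 = (e i).1)
        omega
    have hsep : (M.localInput T X₀ (e l).1).Separated (ω (e l).1)
        fun w => M.report T X₀ ω p₀ (r + k) w := by
      rw [separated_iff h hc]
      intro u hu
      -- A neighbour that is done keeps its last precision, which may be low. Either it has no
      -- updates at all, or it has itself checked the separation before resolving one.
      by_cases hud : (metropolisProtocol p₀ n q).Done (M.report T X₀ ω p₀ (r + k) u)
      · by_cases huo : (M.report T X₀ ω p₀ (r + k) u).outcomes = []
        · rw [(hc u).done_iff h, huo] at hud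
          intro a ha b hb hau
          have := length_positions_lt ha hau
          simp at hud
          simp [hud] at this
        · exact cellsDiffer_report h (r + k) hu.symm huo hd
      · rw [prec_report _ _ hud, ← add_assoc]
        intro a ha b hb hau hbv
        refine dyadicCell_ne_of_le (Nat.le_add_right _ _) (hr a ha b hb ?_)
        rintro rfl
        exact hu.ne (hbv.symm.trans hau)
    have := (resolve_eq h hl hl' hc hsep).2 (resolved X₀ e k) (fun u a ha hmem hau => by
      have := ih (ha.trans hl) hmem
      rw [hau, (hc u).outcomes, length_outcomes] at this
      exact this) hres.2
    rw [this, List.length_singleton] at hlt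
    omega

/-- After `r` rounds the precision suffices for all updates, and the next `k` rounds keep pace with
`resolved`. -/
theorem done_and_final_eq (h : M.IsTimeline T X₀ ω N e τ) {r k : ℕ}
    (hr : ∀ i < N, ∀ j < N, i ≠ j →
      dyadicCell (p₀ n T + r) (τ i) ≠ dyadicCell (p₀ n T + r) (τ j))
    (hres : ∀ i < N, i ∈ resolved X₀ e k) (v : Fin n) :
    (M.report T X₀ ω p₀ (r + k) v).final = some (trajectory X₀ e N v) := by
  obtain ⟨b, hb⟩ := exists_soundReport (p₀ := p₀) h (r + k) v
  refine hb.final_eq h ?_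
  by_contra! hlt
  obtain ⟨l, hl, rfl, hlen, -⟩ := hb.exists_next hlt
  have := length_positions_lt_of_mem_resolved h hr k hl (hres l hl)
  omega

end MetropolisChain

/-! ### The timeline obtained from a merge. -/

namespace MetropolisChain

open ProposalSeq

variable {n q : ℕ} {M : MetropolisChain n q} {T : ℝ≥0} {X₀ : Fin n → Fin q}
  {ω : Fin n → Tape} {N : ℕ} {s : Fin N → Fin n} {i : Fin N → ℕ}

variable (ω) in
/-- The times of the updates of all nodes that a merge puts in order. -/
def mergedTimes (s : Fin N → Fin n) (i : Fin N → ℕ) (l : ℕ) : unitInterval :=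
  if h : l < N then timeAt ω (s ⟨l, h⟩, i ⟨l, h⟩) else 0

lemma mergedTimes_val (l : Fin N) : mergedTimes ω s i l = timeAt ω (s l, i l) := by
  simp [mergedTimes]

variable [NeZero n]

variable (M X₀ ω) in
/-- The updates of all nodes that a merge puts in order. -/
def mergedProposals (s : Fin N → Fin n) (i : Fin N → ℕ) : ℕ → Proposal n q :=
  extend X₀ fun j => M.proposal (s j) (drawSample (M.ν (s j)) (ω (s j) (2 * i j + 2)))

lemma mergedProposals_val (l : Fin N) : mergedProposals M X₀ ω s i l =
    M.proposal (s l) (drawSample (M.ν (s l)) (ω (s l) (2 * i l + 2))) := by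
  simp [mergedProposals, extend]

lemma mergedProposals_fst (l : Fin N) : (mergedProposals M X₀ ω s i l).1 = s l := by
  rw [mergedProposals_val]; rfl

lemma length_positions_mergedProposals (v : Fin n) {l : ℕ} (hl : l ≤ N) :
    (positions (mergedProposals M X₀ ω s i) v l).length =
      (Finset.univ.filter fun j : Fin N => (j : ℕ) < l ∧ s j = v).card := by
  rw [← List.toFinset_card_of_nodup (l := positions _ v l) (List.nodup_range.filter _),
    ← Finset.card_map Fin.valEmbedding]
  congr 1
  ext a
  simp only [List.mem_toFinset, Finset.mem_map, Finset.mem_filter, Finset.mem_univ, true_and,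
    Fin.valEmbedding_apply]
  constructor
  · intro ha
    obtain ⟨h1, h2⟩ := mem_positions.1 ha
    refine ⟨⟨a, by omega⟩, ⟨h1, ?_⟩, rfl⟩
    rw [← h2]
    exact (mergedProposals_fst (⟨a, by omega⟩ : Fin N)).symm
  · rintro ⟨j, ⟨h1, h2⟩, rfl⟩
    exact mem_positions.2 ⟨h1, by rw [mergedProposals_fst, h2]⟩

variable {cnt : unitInterval → ℕ}

lemma updateRank_eq (h : IsMerge cnt ω s i) (l : Fin N) :
    updateRank (ω (s l)) (cnt (ω (s l) 0)) (i l) =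
      (positions (mergedProposals M X₀ ω s i) (s l) l).length := by
  rw [length_positions_mergedProposals _ l.2.le, updateRank, ← Finset.card_filter]
  symm
  refine Finset.card_bij (fun j _ => i j) ?_ ?_ ?_
  · intro j hj
    obtain ⟨h1, h2⟩ := (Finset.mem_filter.1 hj).2
    have h3 := h.lt_mult j
    rw [← h.count, h2] at h3
    refine Finset.mem_filter.2 ⟨Finset.mem_range.2 h3, ?_⟩
    have := h.strictMono (show j < l from h1)
    simp only [timeAt] at this
    rwa [h2] at this
  · intro j hj j' hj' hjj
    have h2 := ((Finset.mem_filter.1 hj).2).2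
    have h2' := ((Finset.mem_filter.1 hj').2).2
    exact h.injective (Prod.ext (h2.trans h2'.symm) hjj)
  · intro a ha
    obtain ⟨h1, h2⟩ := Finset.mem_filter.1 ha
    obtain ⟨j, hj, rfl⟩ := h.exists_eq (Finset.mem_range.1 h1)
    refine ⟨j, Finset.mem_filter.2 ⟨Finset.mem_univ _, ?_, hj⟩, rfl⟩
    refine h.strictMono.lt_iff_lt.1 ?_
    simp only [timeAt]
    rwa [hj]

lemma sortedIndex_eq (h : IsMerge cnt ω s i) (l : Fin N) :
    sortedIndex (ω (s l)) (cnt (ω (s l) 0))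
      (positions (mergedProposals M X₀ ω s i) (s l) l).length = i l := by
  have : {a | a < cnt (ω (s l) 0) ∧ updateRank (ω (s l)) (cnt (ω (s l) 0)) a =
      (positions (mergedProposals M X₀ ω s i) (s l) l).length} = {i l} := by
    ext a
    constructor
    · rintro ⟨h1, h2⟩
      obtain ⟨j, hj, rfl⟩ := h.exists_eq h1
      rw [← hj, updateRank_eq (M := M) (X₀ := X₀) h j, hj] at h2
      rcases lt_trichotomy j l with hjl | rfl | hjl
      · have := length_positions_lt (e := mergedProposals M X₀ ω s i) hjl (mergedProposals_fst j)
        rw [hj] at this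
        omega
      · rfl
      · have := length_positions_lt (e := mergedProposals M X₀ ω s i) hjl (mergedProposals_fst l)
        omega
    · rintro rfl
      exact ⟨by rw [h.count]; exact h.lt_mult l, updateRank_eq h l⟩
  rw [sortedIndex, this, csInf_singleton]

/-- At each site, the rank of an update by time is its rank in the global order. Local sorting thus
agrees with the merge, which no node knows. -/
theorem isTimeline_merged (h : IsMerge (poissonSample (updateRate n T)) ω s i) :
    M.IsTimeline T X₀ ω N (mergedProposals M X₀ ω s i) (mergedTimes ω s i) where
  count v := by
    change poissonSample (updateRate n T) (ω v 0) = _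
    rw [h.count, length_positions_mergedProposals v le_rfl, mult, Fintype.card_subtype]
    simp
  strictMonoOn l hl l' hl' hll := by
    have := h.strictMono (show (⟨l, hl⟩ : Fin N) < ⟨l', hl'⟩ from hll)
    exact (mergedTimes_val ⟨l, hl⟩).trans_lt (this.trans_eq (mergedTimes_val ⟨l', hl'⟩).symm)
  time_eq l hl := by
    have h1 := mergedProposals_fst (M := M) (X₀ := X₀) (ω := ω) (s := s) (i := i) ⟨l, hl⟩
    have h2 := sortedIndex_eq (M := M) (X₀ := X₀) h ⟨l, hl⟩
    have h3 := mergedTimes_val (ω := ω) (s := s) (i := i) ⟨l, hl⟩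
    simp only at h1 h2 h3
    rw [h1, h3, LocalInput.time]
    change ω _ (2 * sortedIndex (ω _) (poissonSample (updateRate n T) (ω _ 0)) _ + 1) = _
    rw [h2]
    rfl
  draw_eq l hl := by
    have h1 := mergedProposals_fst (M := M) (X₀ := X₀) (ω := ω) (s := s) (i := i) ⟨l, hl⟩
    have h2 := sortedIndex_eq (M := M) (X₀ := X₀) h ⟨l, hl⟩
    have h3 := mergedProposals_val (M := M) (X₀ := X₀) (ω := ω) (s := s) (i := i) ⟨l, hl⟩
    simp only at h1 h2 h3
    rw [h1, h3, LocalInput.draw]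
    change M.proposal _ (drawSample _ (ω _ (2 * sortedIndex (ω _)
      (poissonSample (updateRate n T) (ω _ 0)) _ + 2))) = _
    rw [h2]

end MetropolisChain

/-! ### Collisions of update times -/

section Collision

variable {n : ℕ} (cnt : unitInterval → ℕ)

/-- Two updates happen in the same cell of the grid of precision `p`. -/
def Collision (p : ℕ) (ω : Fin n → Tape) : Prop :=
  ∃ x y : Fin n × ℕ, x ≠ y ∧ x.2 < cnt (ω x.1 0) ∧ y.2 < cnt (ω y.1 0) ∧
    dyadicCell p (timeAt ω x) = dyadicCell p (timeAt ω y)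

variable {cnt}

lemma Collision.anti {p p' : ℕ} (h : p ≤ p') {ω : Fin n → Tape} (hc : Collision cnt p' ω) :
    Collision cnt p ω := by
  obtain ⟨x, y, hxy, hx, hy, he⟩ := hc
  exact ⟨x, y, hxy, hx, hy, by
    by_contra hne
    exact dyadicCell_ne_of_le h hne he⟩

lemma exists_not_collision {ω : Fin n → Tape} (hω : Function.Injective (timeAt ω)) :
    ∃ p, ¬ Collision cnt p ω := by
  classical
  let F : Finset (Fin n × ℕ) := Finset.univ.biUnion fun v =>
    (Finset.range (cnt (ω v 0))).image fun a => (v, a)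
  have hF : ∀ x : Fin n × ℕ, x.2 < cnt (ω x.1 0) → x ∈ F := fun x hx =>
    Finset.mem_biUnion.2 ⟨x.1, Finset.mem_univ _, Finset.mem_image.2
      ⟨x.2, Finset.mem_range.2 hx, rfl⟩⟩
  have hp : ∀ z : (Fin n × ℕ) × (Fin n × ℕ), ∃ p, z.1 ≠ z.2 →
      dyadicCell p (timeAt ω z.1) ≠ dyadicCell p (timeAt ω z.2) := by
    intro z
    by_cases hz : z.1 = z.2
    · exact ⟨0, fun h => absurd hz h⟩
    · obtain ⟨p, hp⟩ := exists_dyadicCell_ne (hω.ne hz)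
      exact ⟨p, fun _ => hp⟩
  choose f hf using hp
  refine ⟨(F ×ˢ F).sup f, ?_⟩
  rintro ⟨x, y, hxy, hx, hy, he⟩
  exact dyadicCell_ne_of_le (Finset.le_sup (Finset.mem_product.2 ⟨hF x hx, hF y hy⟩))
    (hf (x, y) hxy) he

lemma measurable_dyadicCell (p : ℕ) : Measurable (dyadicCell p) :=
  Nat.measurable_floor.comp (measurable_const.mul measurable_subtype_coe)

lemma measurable_timeAt (x : Fin n × ℕ) : Measurable fun ω => timeAt ω x :=
  (measurable_pi_apply _).comp (measurable_pi_apply _)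

lemma measurableSet_collision (hcnt : Measurable cnt) (p : ℕ) :
    MeasurableSet {ω : Fin n → Tape | Collision cnt p ω} := by
  have hc : ∀ x : Fin n × ℕ, MeasurableSet {ω : Fin n → Tape | x.2 < cnt (ω x.1 0)} := fun x =>
    measurableSet_lt measurable_const
      (hcnt.comp ((measurable_pi_apply _).comp (measurable_pi_apply _)))
  refine .congr (s := ⋃ x : Fin n × ℕ, ⋃ y : Fin n × ℕ, ⋃ _ : x ≠ y,
    {ω | x.2 < cnt (ω x.1 0)} ∩ ({ω | y.2 < cnt (ω y.1 0)} ∩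
      {ω | dyadicCell p (timeAt ω x) = dyadicCell p (timeAt ω y)})) ?_ ?_
  · refine .iUnion fun x => .iUnion fun y => .iUnion fun _ => (hc x).inter ((hc y).inter ?_)
    exact measurableSet_eq_fun ((measurable_dyadicCell p).comp (measurable_timeAt x))
      ((measurable_dyadicCell p).comp (measurable_timeAt y))
  · ext ω
    simp only [Set.mem_iUnion, Set.mem_inter_iff, Collision, exists_prop, Set.mem_ofPred_eq]

/-- Collisions become rarer with growing precision and almost surely disappear, so continuity from
above applies. The precision need not be explicit, since the length of a report affects neither the
message size nor the running time. -/
lemma exists_measure_collision_le (hcnt : Measurable cnt) {ε : ℝ≥0∞} (hε : 0 < ε) :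
    ∃ p, tapeMeasure n {ω | Collision cnt p ω} ≤ ε := by
  have h1 : Filter.Tendsto (fun p => tapeMeasure n {ω | Collision cnt p ω}) Filter.atTop
      (nhds (tapeMeasure n (⋂ p, {ω | Collision cnt p ω}))) :=
    tendsto_measure_iInter_atTop (fun p => (measurableSet_collision hcnt p).nullMeasurableSet)
      (fun p p' h ω hω => Collision.anti h hω) ⟨0, measure_ne_top _ _⟩
  have h2 : tapeMeasure n (⋂ p, {ω | Collision cnt p ω}) = 0 := by
    refine measure_mono_null ?_ (ae_injective_timeAt n)
    intro ω hω hinj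
    obtain ⟨p, hp⟩ := exists_not_collision (cnt := cnt) hinj
    exact hp (Set.mem_iInter.1 hω p)
  rw [h2] at h1
  obtain ⟨p, hp⟩ := (h1.eventually (gt_mem_nhds hε)).exists
  exact ⟨p, hp.le⟩

lemma inv_four_mul_pos (n : ℕ) : 0 < (4 * n : ℝ≥0∞)⁻¹ :=
  ENNReal.inv_pos.2 (ENNReal.mul_ne_top (by simp) (by simp))

/-- A precision at which a collision is unlikely. -/
def initialPrecision (n : ℕ) (T : ℝ≥0) : ℕ :=
  (exists_measure_collision_le (n := n) (measurable_poissonSample (updateRate n T))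
    (inv_four_mul_pos n)).choose

lemma measure_collision_le (n : ℕ) (T : ℝ≥0) :
    tapeMeasure n {ω | Collision (poissonSample (updateRate n T)) (initialPrecision n T) ω} ≤
      (4 * n : ℝ≥0∞)⁻¹ :=
  (exists_measure_collision_le (n := n) (measurable_poissonSample (updateRate n T))
    (inv_four_mul_pos n)).choose_spec

end Collision

/-! ### Measurability and law of the output. -/

namespace MeasurableFibers

variable {Ω Ω' β : Type*} [MeasurableSpace Ω] [MeasurableSpace Ω']

lemma comp_measurable {f : Ω → β} (hf : MeasurableFibers f) {g : Ω' → Ω} (hg : Measurable g) :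
    MeasurableFibers fun r => f (g r) := fun b => hg (hf b)

lemma pi {ι : Type*} [Countable ι] {f : ι → Ω → β} (hf : ∀ i, MeasurableFibers (f i)) :
    MeasurableFibers fun r i => f i r := fun b => by
  rw [show {r | (fun i => f i r) = b} = ⋂ i, {r | f i r = b i} by ext; simp [funext_iff]]
  exact MeasurableSet.iInter fun i => hf i (b i)

lemma measurable [Countable β] [MeasurableSpace β] {f : Ω → β} (hf : MeasurableFibers f) :
    Measurable f := measurable_to_countable' fun b => hf b

end MeasurableFibers

lemma SyncProtocol.measurableFibers_state {n q : ℕ} {α : Type} [Countable α]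
    (P : SyncProtocol n q α) (inp : Fin n → LocalInput n q) (k : ℕ) (v : Fin n) :
    MeasurableFibers fun ω => P.state inp ω k v := by
  classical
  induction k generalizing v with
  | zero => exact (P.measurable_init (inp v)).comp_measurable (measurable_pi_apply v)
  | succ k ih =>
    refine (MeasurableFibers.pi ih).bind (g := fun S ω => if P.Done (S v) then S v
      else P.next (inp v) (ω v) (S v) fun u => S u) fun S => ?_
    by_cases h : P.Done (S v)
    · simpa only [h, if_true] using .const _
    · simpa only [h, if_false] using
        (P.measurable_next (inp v) (S v) fun u => S u).comp_measurable (measurable_pi_apply v)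

/-- The generating function of the Poisson distribution. -/
lemma tsum_poissonMeasure_mul_pow (r : ℝ≥0) {y : ℝ} (hy : 0 ≤ y) :
    ∑' k, ProbabilityTheory.poissonMeasure r {k} * ENNReal.ofReal (y ^ k) =
      ENNReal.ofReal (Real.exp (r * (y - 1))) := by
  have h1 : HasSum (fun k : ℕ => Real.exp (-r) * ((r * y) ^ k / k.factorial))
      (Real.exp (-r) * Real.exp (r * y)) := by
    have := NormedSpace.expSeries_div_hasSum_exp (r * y : ℝ)
    rw [← Real.exp_eq_exp_ℝ] at this
    exact this.mul_left _
  have h2 : ∀ k : ℕ, ProbabilityTheory.poissonMeasure r {k} * ENNReal.ofReal (y ^ k) =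
      ENNReal.ofReal (Real.exp (-r) * ((r * y) ^ k / k.factorial)) := by
    intro k
    rw [ProbabilityTheory.poissonMeasure_singleton, ← ENNReal.ofReal_mul (by positivity)]
    congr 1
    rw [mul_pow]
    ring
  simp_rw [h2]
  rw [← ENNReal.ofReal_tsum_of_nonneg (fun k => by positivity) h1.summable, h1.tsum_eq,
    ← Real.exp_add]
  congr 2
  ring

namespace MetropolisChain

open ProposalSeq

variable {n q : ℕ}

/-- The total number of updates. -/
def totalUpdates (T : ℝ≥0) (ω : Fin n → Tape) : ℕ := ∑ v, poissonSample (updateRate n T) (ω v 0)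

lemma measurable_totalUpdates (T : ℝ≥0) : Measurable (totalUpdates (n := n) T) :=
  Finset.measurable_sum _ fun v _ => (measurable_poissonSample _).comp
    ((measurable_pi_apply 0).comp (measurable_pi_apply v))

variable (M : MetropolisChain n q) (T : ℝ≥0) (X₀ : Fin n → Fin q)

open Classical in
/-- The output of the protocol. -/
def protocolOutput (p₀ : ℕ → ℝ≥0 → ℕ) (ω : Fin n → Tape) (v : Fin n) : Fin q :=
  (M.report T X₀ ω p₀ (sInf {k | (M.report T X₀ ω p₀ k v).final.isSome}) v).final.getD (X₀ v)

lemma measurable_protocolOutput (p₀ : ℕ → ℝ≥0 → ℕ) :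
    Measurable (M.protocolOutput T X₀ p₀) := by
  refine measurable_pi_lambda _ fun v => MeasurableFibers.measurable ?_
  have h := fun k => (metropolisProtocol p₀ n q).measurableFibers_state (M.localInput T X₀) k v
  refine (MeasurableFibers.sInf_nat (p := fun k ω => (M.report T X₀ ω p₀ k v).final.isSome)
    fun k => (h k).comp fun R => (R.final.isSome : Prop)).bind
    (g := fun k ω => (M.report T X₀ ω p₀ k v).final.getD (X₀ v)) fun k => ?_
  exact (h k).comp fun R => R.final.getD (X₀ v)

variable {M T X₀} {p₀ : ℕ → ℝ≥0 → ℕ} {ω : Fin n → Tape}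

lemma protocolOutput_eq {k : ℕ} {v : Fin n} {x : Fin q}
    (h : (M.report T X₀ ω p₀ k v).final = some x) : M.protocolOutput T X₀ p₀ ω v = x := by
  have hk : k ∈ {k | (M.report T X₀ ω p₀ k v).final.isSome} := by
    change (M.report T X₀ ω p₀ k v).final.isSome
    rw [h]; rfl
  have hd : (metropolisProtocol p₀ n q).Done (M.report T X₀ ω p₀
      (sInf {k | (M.report T X₀ ω p₀ k v).final.isSome}) v) := Nat.sInf_mem ⟨k, hk⟩
  rw [report, hd.state_eq (Nat.sInf_le hk)] at h
  rw [protocolOutput, h, Option.getD_some]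

lemma exists_cells_differ {N : ℕ} {τ : ℕ → unitInterval} (hτ : StrictMonoOn τ (Set.Iio N)) (p : ℕ) :
    ∃ r, ∀ i < N, ∀ j < N, i ≠ j → dyadicCell (p + r) (τ i) ≠ dyadicCell (p + r) (τ j) := by
  have hr : ∀ z : ℕ × ℕ, ∃ r, z.1 < N → z.2 < N → z.1 ≠ z.2 →
      dyadicCell r (τ z.1) ≠ dyadicCell r (τ z.2) := by
    intro z
    by_cases hz : z.1 < N ∧ z.2 < N ∧ z.1 ≠ z.2
    · obtain ⟨r, hr⟩ := exists_dyadicCell_ne (hτ.injOn.ne hz.1 hz.2.1 hz.2.2)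
      exact ⟨r, fun _ _ _ => hr⟩
    · exact ⟨0, fun h1 h2 h3 => absurd ⟨h1, h2, h3⟩ hz⟩
  choose f hf using hr
  refine ⟨(Finset.range N ×ˢ Finset.range N).sup f, fun i hi j hj hij => ?_⟩
  refine dyadicCell_ne_of_le (le_trans ?_ (Nat.le_add_left _ p)) (hf (i, j) hi hj hij)
  exact Finset.le_sup (Finset.mem_product.2 ⟨Finset.mem_range.2 hi, Finset.mem_range.2 hj⟩)

lemma IsTimeline.exists_final_eq {N : ℕ} {e : ℕ → Proposal n q} {τ : ℕ → unitInterval}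
    (h : M.IsTimeline T X₀ ω N e τ) :
    ∃ k, ∀ v, (M.report T X₀ ω p₀ k v).final = some (trajectory X₀ e N v) := by
  obtain ⟨r, hr⟩ := exists_cells_differ h.strictMonoOn (p₀ n T)
  exact ⟨r + N, done_and_final_eq h hr fun i hi => mem_resolved_of_lt hi⟩

/-- An exponential moment bound: if the conditional probability given the number `k` of updates is
at most `c * y ^ k`, the Poisson generating function sums it up. Both tail estimates use it. -/
lemma tapeMeasure_mem_le (T : ℝ≥0) (E : ℕ → Set (Fin n → Tape)) {c y : ℝ} (hc : 0 ≤ c) (hy : 0 ≤ y)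
    (h : ∀ k, tapeMeasure n ({ω | totalUpdates T ω = k} ∩ E k) ≤
      ProbabilityTheory.poissonMeasure (n * updateRate n T) {k} * ENNReal.ofReal (c * y ^ k)) :
    tapeMeasure n {ω | ω ∈ E (totalUpdates T ω)} ≤
      ENNReal.ofReal (c * Real.exp (n * updateRate n T * (y - 1))) := by
  calc tapeMeasure n {ω | ω ∈ E (totalUpdates T ω)}
      ≤ tapeMeasure n (⋃ k, {ω | totalUpdates T ω = k} ∩ E k) :=
        measure_mono fun ω hω => Set.mem_iUnion.2 ⟨totalUpdates T ω, rfl, hω⟩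
    _ ≤ ∑' k, tapeMeasure n ({ω | totalUpdates T ω = k} ∩ E k) := measure_iUnion_le _
    _ ≤ ∑' k, ENNReal.ofReal c * (ProbabilityTheory.poissonMeasure (n * updateRate n T) {k} *
          ENNReal.ofReal (y ^ k)) := by
        refine ENNReal.tsum_le_tsum fun k => (h k).trans_eq ?_
        rw [ENNReal.ofReal_mul hc, mul_left_comm]
    _ = _ := by
        rw [ENNReal.tsum_mul_left, tsum_poissonMeasure_mul_pow _ hy, ← ENNReal.ofReal_mul hc]
        push_cast
        rfl

variable [NeZero n] {k : ℕ} {s : Fin k → Fin n} {i : Fin k → ℕ}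

lemma protocolOutput_eq_trajectory (h : IsMerge (poissonSample (updateRate n T)) ω s i) :
    M.protocolOutput T X₀ p₀ ω = trajectory X₀ (mergedProposals M X₀ ω s i) k := by
  obtain ⟨m, hm⟩ := (isTimeline_merged (M := M) (X₀ := X₀) h).exists_final_eq (p₀ := p₀)
  funext v
  exact protocolOutput_eq (hm v)

/-- Conditioned on their number, the updates are independent. -/
lemma tapeMeasure_totalUpdates_inter (A : Set (Fin k → Proposal n q)) (B : Set (Fin n → Tape))
    (hB : ∀ ω (s : Fin k → Fin n) (i : Fin k → ℕ), IsMerge (poissonSample (updateRate n T)) ω s i →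
      (ω ∈ B ↔ (fun j => M.proposal (s j) (drawSample (M.ν (s j)) (ω (s j) (2 * i j + 2)))) ∈ A)) :
    tapeMeasure n ({ω | totalUpdates T ω = k} ∩ B) =
      ProbabilityTheory.poissonMeasure (n * updateRate n T) {k} *
        Measure.pi (fun _ : Fin k => M.proposalLaw) A :=
  tapeMeasure_superposition (smp := fun v u => M.proposal v (drawSample (M.ν v) u))
    (κ := M.proposalAt) (measurable_poissonSample _) (map_poissonSample _)
    (fun v => (M.measurable_proposal v).comp (measurable_drawSample _))
    (fun v => by
      rw [proposalAt, drawLaw, ← map_drawSample,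
        Measure.map_map (M.measurable_proposal v) (measurable_drawSample _)]
      rfl)
    A.to_countable.measurableSet hB

/-- This is the superposition theorem with draws from a one-point space. -/
lemma tapeMeasure_totalUpdates (T : ℝ≥0) (k : ℕ) :
    tapeMeasure n {ω | totalUpdates T ω = k} =
      ProbabilityTheory.poissonMeasure (n * updateRate n T) {k} := by
  have := tapeMeasure_superposition (n := n) (smp := fun _ _ => ()) (κ := fun _ => Measure.dirac ())
    (measurable_poissonSample (updateRate n T)) (map_poissonSample _)
    (fun _ => measurable_const) (fun _ => by simp [Measure.map_const]) (k := k) (A := Set.univ)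
    MeasurableSet.univ (B := Set.univ) fun _ _ _ _ => by simp
  have hdirac : (n : ℝ≥0∞)⁻¹ • ∑ _v : Fin n, Measure.dirac () = Measure.dirac () := by
    rw [Finset.sum_const, Finset.card_univ, Fintype.card_fin, ← Nat.cast_smul_eq_nsmul ℝ≥0∞,
      smul_smul, ENNReal.inv_mul_cancel (by simp [NeZero.ne n]) (by simp), one_smul]
  rw [hdirac, measure_univ, mul_one, Set.inter_univ] at this
  exact this

variable (M T X₀ p₀) in
/-- The output is a sample of the chain after `totalUpdates` steps. -/
theorem tapeMeasure_output (k : ℕ) (σ : Fin n → Fin q) :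
    tapeMeasure n {ω | totalUpdates T ω = k ∧ M.protocolOutput T X₀ p₀ ω = σ} =
      tapeMeasure n {ω | totalUpdates T ω = k} * M.law X₀ k σ := by
  rw [tapeMeasure_totalUpdates, ← pi_trajectory_eq_law M X₀ le_rfl σ]
  refine tapeMeasure_totalUpdates_inter _ {ω | M.protocolOutput T X₀ p₀ ω = σ} fun ω s i h => ?_
  change M.protocolOutput T X₀ p₀ ω = σ ↔ _
  rw [protocolOutput_eq_trajectory h]
  rfl

end MetropolisChain

namespace Run

variable {n q : ℕ} {R : Run n q}

/-- The message bound is claimed for all tapes, including those on which the protocol may not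
terminate and `Invariant` is not available; hence this separate induction. -/
lemma chan_eq_nil_of_not_adj {s : Config n} (hs : R.Reachable s) {u v : Fin n}
    (h : ¬ R.M.G.Adj u v) : s.chan u v = [] := by
  induction hs with
  | refl => simp [start, emit, h]
  | tail _ hstep ih =>
    obtain ⟨-, a, b, p, rest, hab, -, rfl⟩ := hstep
    have hne : ¬ (u = a ∧ v = b) := by
      rintro ⟨rfl, rfl⟩
      rw [ih] at hab
      exact List.cons_ne_nil _ _ hab.symm
    have hupd : ∀ c : Fin n → Fin n → List Packet, c u v = [] →
        Function.update c a (Function.update (c a) b rest) u v = [] := by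
      intro c hc
      by_cases hu : u = a
      · subst hu
        rw [Function.update_self, Function.update_of_ne fun hv => hne ⟨rfl, hv⟩, hc]
      · rw [Function.update_of_ne hu, hc]
    unfold deliver
    dsimp only
    split_ifs
    · exact hupd _ ih
    · simpa [emit, h] using hupd _ ih

end Run

/-! ### Tail bounds -/

lemma coe_updateRate (n : ℕ) (T : ℝ≥0) : (updateRate n T : ℝ) = 4 * (T + Real.log n) := by
  simp [updateRate, Real.coe_toNNReal _ (Real.log_natCast_nonneg n)]

lemma ofReal_exp_le_inv {n : ℕ} (hn : 2 ≤ n) {a : ℝ} (ha : a ≤ -(3 * Real.log n)) :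
    ENNReal.ofReal (Real.exp a) ≤ (4 * n : ℝ≥0∞)⁻¹ := by
  have hn' : (2 : ℝ) ≤ n := by exact_mod_cast hn
  have h1 : (4 * n : ℝ≥0∞)⁻¹ = ENNReal.ofReal ((4 * n : ℝ)⁻¹) := by
    rw [ENNReal.ofReal_inv_of_pos (by positivity), ENNReal.ofReal_mul (by norm_num),
      ENNReal.ofReal_natCast]
    norm_num
  rw [h1]
  refine ENNReal.ofReal_le_ofReal ((Real.exp_le_exp.2 ha).trans ?_)
  rw [Real.exp_neg, show 3 * Real.log n = Real.log ((n : ℝ) ^ 3) by simp,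
    Real.exp_log (by positivity)]
  refine inv_anti₀ (by positivity) ?_
  nlinarith [mul_le_mul hn' hn' (by norm_num) (by linarith)]

lemma choose_mul_pow_le (k m : ℕ) {x : ℝ} (hx : 0 ≤ x) : k.choose m * x ^ m ≤ (1 + x) ^ k := by
  rw [add_comm, add_pow]
  by_cases hm : m ≤ k
  · refine le_trans (by simp [mul_comm]) (Finset.single_le_sum
      (f := fun m => x ^ m * 1 ^ (k - m) * (k.choose m : ℝ)) (fun i _ => by positivity)
      (Finset.mem_range.2 (Nat.lt_succ_of_le hm)))
  · rw [Nat.choose_eq_zero_of_lt (not_le.1 hm)]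
    simp only [Nat.cast_zero, zero_mul]
    exact Finset.sum_nonneg fun i _ => by positivity

namespace MetropolisChain

open ProposalSeq

variable {n q : ℕ} [NeZero n]

/-- Chernoff bound: the indicator of `k < n T` is at most `exp (n T) * exp (-1) ^ k`. As `exp (-1) -
1 ≤ -1/2` and the mean is `4 n (T + log n)`, the exponent is at most `n T - 2 n (T + log n) ≤ -3 log
n`. -/
lemma tapeMeasure_totalUpdates_lt_le (hn : 2 ≤ n) (T : ℝ≥0) :
    tapeMeasure n {ω | (totalUpdates T ω : ℝ) < n * T} ≤ (4 * n : ℝ≥0∞)⁻¹ := by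
  refine (tapeMeasure_mem_le T (fun k => {_ω | (k : ℝ) < n * T}) (Real.exp_pos (n * T)).le
    (Real.exp_pos (-1)).le fun k => ?_).trans ?_
  · by_cases hk : (k : ℝ) < n * T
    · refine (measure_mono Set.inter_subset_left).trans ?_
      rw [tapeMeasure_totalUpdates]
      refine le_mul_of_one_le_right' ?_
      rw [ENNReal.one_le_ofReal, ← Real.exp_nat_mul, ← Real.exp_add]
      exact Real.one_le_exp (by linarith)
    · simp [hk]
  · rw [← Real.exp_add]
    refine ofReal_exp_le_inv hn ?_
    rw [coe_updateRate]
    have h1 : Real.exp (-1) ≤ 1 / 2 := by have := Real.exp_neg_one_lt_d9; linarith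
    have hn' : (2 : ℝ) ≤ n := by exact_mod_cast hn
    have hlog := Real.log_natCast_nonneg n
    have hT : (0 : ℝ) ≤ T := T.2
    have h2 : (n : ℝ) * (4 * (T + Real.log n)) * (Real.exp (-1) - 1) ≤
        n * (4 * (T + Real.log n)) * (-(1 / 2)) := by
      gcongr
      linarith
    nlinarith [mul_le_mul_of_nonneg_right hn' hlog, mul_nonneg (Nat.cast_nonneg (α := ℝ) n) hT]

/-- Not all of the updates are resolved after `L` rounds. -/
def Unresolved (M : MetropolisChain n q) (T : ℝ≥0) (X₀ : Fin n → Fin q) (L k : ℕ) :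
    Set (Fin n → Tape) :=
  {ω | ∃ (s : Fin k → Fin n) (i : Fin k → ℕ), IsMerge (poissonSample (updateRate n T)) ω s i ∧
    ∃ j < k, j ∉ resolved X₀ (mergedProposals M X₀ ω s i) L}

/-- With `a = (1 + 2 * C) * exp 2`, the binomial coefficient is at most `(n / a) ^ (L + 1) * (1 + a
/ n) ^ k`. The factor `exp 2` in `a` leaves `c ≤ n * exp (-2 L)`, and averaging over the Poisson
number costs `exp (4 a (T + log n))`. For `L ≥ (2 a + 2) (T + log n)` the total exponent is at most
`-3 log n`. -/
lemma tapeMeasure_unresolved_le {M : MetropolisChain n q} {C : ℝ} (hC : 0 < C) (hL : M.Lipschitz C)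
    (T : ℝ≥0) (X₀ : Fin n → Fin q) (hn : 2 ≤ n) {L : ℕ}
    (hL' : (2 * ((1 + 2 * C) * Real.exp 2) + 2) * (T + Real.log n) ≤ L) :
    tapeMeasure n {ω | ω ∈ M.Unresolved T X₀ L (totalUpdates T ω)} ≤ (4 * n : ℝ≥0∞)⁻¹ := by
  set a : ℝ := (1 + 2 * C) * Real.exp 2 with ha
  have ha1 : 1 ≤ a := by
    have : 1 ≤ Real.exp 2 := Real.one_le_exp (by norm_num)
    nlinarith
  have hn0 : (0 : ℝ) < n := by have : 0 < n := by omega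
                               exact_mod_cast this
  have hx : 0 < a / n := by positivity
  set c : ℝ := ((1 + 2 * C) / n) ^ L * (a / n)⁻¹ ^ (L + 1) with hc
  refine (tapeMeasure_mem_le T (M.Unresolved T X₀ L) (c := c) (y := 1 + a / n) (by positivity)
    (by positivity) fun k => ?_).trans ?_
  · rw [tapeMeasure_totalUpdates_inter (M := M) {x | ∃ j < k, j ∉ resolved X₀ (extend X₀ x) L}
      (M.Unresolved T X₀ L k)]
    · gcongr
      refine (pi_exists_notMem_resolved_le hC hL X₀ k L).trans ?_
      rw [← ENNReal.ofReal_pow (by positivity), ← ENNReal.ofReal_natCast,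
        ← ENNReal.ofReal_mul (by positivity)]
      refine ENNReal.ofReal_le_ofReal ?_
      rw [hc, mul_assoc]
      refine mul_le_mul_of_nonneg_left ?_ (by positivity)
      have h1 := choose_mul_pow_le k (L + 1) hx.le
      rw [inv_pow, inv_mul_eq_div, le_div_iff₀ (by positivity)]
      exact h1
    · intro ω s i h
      constructor
      · rintro ⟨s', i', h', hj⟩
        obtain ⟨rfl, rfl⟩ := h.unique h'
        exact hj
      · intro hj
        exact ⟨s, i, h, hj⟩
  · have h1 : c ≤ Real.exp (Real.log n - 2 * L) := by
      have h2 : c = n / a * Real.exp (-2) ^ L := by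
        rw [hc, ha, pow_succ, ← mul_assoc, ← mul_pow, Real.exp_neg]
        have : (1 + 2 * C) / n * ((1 + 2 * C) * Real.exp 2 / n)⁻¹ = (Real.exp 2)⁻¹ := by
          field_simp
        rw [this, inv_div, mul_comm]
      rw [h2, ← Real.exp_nat_mul, sub_eq_add_neg, Real.exp_add, Real.exp_log hn0]
      have h3 : (L : ℝ) * -2 = -(2 * L) := by ring
      rw [h3]
      gcongr
      exact div_le_self hn0.le ha1
    calc _ ≤ ENNReal.ofReal (Real.exp (Real.log n - 2 * L) *
            Real.exp (n * updateRate n T * (1 + a / n - 1))) := by gcongr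
      _ ≤ _ := by
          rw [← Real.exp_add]
          refine ofReal_exp_le_inv hn ?_
          have h4 : (n : ℝ) * updateRate n T * (1 + a / n - 1) = 4 * (T + Real.log n) * a := by
            rw [coe_updateRate]
            field_simp
            ring
          rw [h4]
          have hT : (0 : ℝ) ≤ T := T.2
          nlinarith

/-! ### The algorithm -/

lemma report_of_not_collision {M : MetropolisChain n q} {T : ℝ≥0} {X₀ : Fin n → Fin q}
    {p₀ : ℕ → ℝ≥0 → ℕ} {ω : Fin n → Tape} {L : ℕ} (hω : Function.Injective (timeAt ω))
    (hcol : ¬ Collision (poissonSample (updateRate n T)) (p₀ n T) ω)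
    (hres : ω ∉ M.Unresolved T X₀ L (totalUpdates T ω)) (v : Fin n) :
    (M.report T X₀ ω p₀ L v).final = some (M.protocolOutput T X₀ p₀ ω v) := by
  obtain ⟨s, i, h⟩ := exists_isMerge (cnt := poissonSample (updateRate n T)) hω rfl
  -- Without a collision the initial precision already separates all times, so no round is lost.
  have h1 := done_and_final_eq (M := M) (X₀ := X₀) (p₀ := p₀) (r := 0) (k := L)
    (isTimeline_merged h) ?_ ?_ v
  · rw [zero_add] at h1
    rw [h1, protocolOutput_eq_trajectory h]
  · intro j hj l hl hjl heq
    rw [mergedTimes_val (⟨j, hj⟩ : Fin _), mergedTimes_val (⟨l, hl⟩ : Fin _)] at heq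
    refine hcol ⟨_, _, fun hxy => hjl (congrArg Fin.val (h.injective hxy)), ?_, ?_, heq⟩
    · rw [h.count]; exact h.lt_mult _
    · rw [h.count]; exact h.lt_mult _
  · intro j hj
    by_contra hj'
    exact hres ⟨s, i, h, j, hj, hj'⟩

end MetropolisChain

/-- The algorithm: the metropolis protocol, run asynchronously. -/
def metropolisAlgorithm : DistAlgorithm :=
  SyncProtocol.toAlgorithm fun n q => metropolisProtocol initialPrecision n q

lemma Run.executes_metropolisProtocol {n q : ℕ} (M : MetropolisChain n q) (X₀ : Fin n → Fin q)
    (T : ℝ≥0) (ω : Fin n → Tape) (delay : Fin n → Fin n → ℕ → ℝ≥0) :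
    (Run.mk metropolisAlgorithm M X₀ T ω delay).Executes
      (metropolisProtocol initialPrecision n q) :=
  ⟨fun _ _ _ _ => rfl, fun _ _ _ => rfl⟩

lemma Run.halts_of_final_eq {n q : ℕ} {M : MetropolisChain n q} {X₀ : Fin n → Fin q} {T : ℝ≥0}
    {ω : Fin n → Tape} {m : ℕ} {x : Fin n → Fin q}
    (h : ∀ v, (M.report T X₀ ω initialPrecision m v).final = some (x v))
    (delay : Fin n → Fin n → ℕ → ℝ≥0) :
    (Run.mk metropolisAlgorithm M X₀ T ω delay).AlwaysHalts ∧
      ∀ s, (Run.mk metropolisAlgorithm M X₀ T ω delay).Final s →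
        (∀ v, (Run.mk metropolisAlgorithm M X₀ T ω delay).output s v = some (x v)) ∧
        s.now ≤ (m + 2) * s.timeUnit := by
  have hR := Run.executes_metropolisProtocol M X₀ T ω delay
  have hd : ∀ v, (metropolisProtocol initialPrecision n q).Done
      ((Run.mk metropolisAlgorithm M X₀ T ω delay).syncState
        (metropolisProtocol initialPrecision n q) m v) := fun v => by
    change (M.report T X₀ ω initialPrecision m v).final.isSome
    rw [h]; rfl
  refine ⟨hR.alwaysHalts hd, fun s hs => ?_⟩
  obtain ⟨h1, h2⟩ := hR.of_final hd hs
  exact ⟨fun v => (h1 v).trans (h v), h2⟩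

end

theorem theorem2 :
    ∃ (alg : DistAlgorithm) (B : ℝ), ∀ C : ℝ, 0 < C → ∃ K : ℝ,
      ∀ (n q : ℕ) [NeZero n] (M : MetropolisChain n q), M.Lipschitz C →
      ∀ (T : ℝ≥0) (X₀ : Fin n → Fin q),
        ∃ (N : (Fin n → Tape) → ℕ) (out : (Fin n → Tape) → Fin n → Fin q),
          Measurable N ∧ Measurable out ∧
          -- given `N = k`, the output is distributed as the state `X_k` of the chain
          (∀ (k : ℕ) (σ : Fin n → Fin q),
            tapeMeasure n {ω | N ω = k ∧ out ω = σ} =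
              tapeMeasure n {ω | N ω = k} * M.law X₀ k σ) ∧
          -- almost surely, under every schedule, the algorithm terminates and outputs `out`
          (∀ᵐ ω ∂(tapeMeasure n), ∀ delay : Fin n → Fin n → ℕ → ℝ≥0,
            (Run.mk alg M X₀ T ω delay).AlwaysHalts ∧
            ∀ s, (Run.mk alg M X₀ T ω delay).Final s →
              ∀ v, (Run.mk alg M X₀ T ω delay).output s v = some (out ω v)) ∧
          -- with high probability, `N ≥ n T` and the running time is `O(T + log n)` time units
          (∀ delay : Fin n → Fin n → ℕ → ℝ≥0,
            tapeMeasure n {ω | (N ω : ℝ) < n * T ∨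
              ∃ s, (Run.mk alg M X₀ T ω delay).Final s ∧
                K * (T + Real.log n) * s.timeUnit < s.now} ≤ (n : ℝ≥0∞)⁻¹) ∧
          -- every message has `O(log n + log ⌈T⌉ + log q)` bits
          (∀ (ω : Fin n → Tape) (delay : Fin n → Fin n → ℕ → ℝ≥0) (s : Config n),
            (Run.mk alg M X₀ T ω delay).Reachable s → ∀ u v, ∀ p ∈ s.chan u v,
              (p.body.length : ℝ) ≤
                B * (Real.log n + Real.log (max 1 ⌈T⌉₊ : ℕ) + Real.log q)) := by
  -- With `a = (1 + 2 * C) * exp 2`, resolution takes `L = ⌈(2 a + 2) (T + log n)⌉` rounds. The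
  -- synchronizer adds 2 and rounding up at most 1, and `3 ≤ 6 (T + log n)` for `n ≥ 2`. The factor
  -- 2 for messages comes from `1 ≤ 2 log 2`.
  refine ⟨metropolisAlgorithm, 2, fun C hC => ⟨2 * ((1 + 2 * C) * Real.exp 2) + 8, ?_⟩⟩
  intro n q _ M hL T X₀
  have hterm : ∀ ω : Fin n → Tape, Function.Injective (timeAt ω) → ∃ m, ∀ v,
      (M.report T X₀ ω initialPrecision m v).final =
        some (M.protocolOutput T X₀ initialPrecision ω v) := by
    intro ω hω
    obtain ⟨s, i, h⟩ := exists_isMerge (cnt := poissonSample (updateRate n T)) hω rfl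
    rw [MetropolisChain.protocolOutput_eq_trajectory h]
    exact (MetropolisChain.isTimeline_merged h).exists_final_eq
  refine ⟨MetropolisChain.totalUpdates T, M.protocolOutput T X₀ initialPrecision,
    MetropolisChain.measurable_totalUpdates T, M.measurable_protocolOutput T X₀ _,
    M.tapeMeasure_output T X₀ _, ?_, fun delay => ?_, ?_⟩
  · filter_upwards [ae_injective_timeAt n] with ω hω delay
    obtain ⟨m, hm⟩ := hterm ω hω
    obtain ⟨h1, h2⟩ := Run.halts_of_final_eq hm delay
    exact ⟨h1, fun s hs => (h2 s hs).1⟩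
  · rcases Nat.lt_or_ge n 2 with hn | hn
    · obtain rfl : n = 1 := by have := NeZero.pos n; omega
      simpa using prob_le_one
    set a : ℝ := (1 + 2 * C) * Real.exp 2 with ha
    have ha0 : 0 ≤ a := by positivity
    have hn' : (2 : ℝ) ≤ n := by exact_mod_cast hn
    set L : ℕ := ⌈(2 * a + 2) * (T + Real.log n)⌉₊ with hLdef
    have hlog : 1 / 2 ≤ Real.log n := by
      have := Real.log_le_log (by norm_num) hn'
      have := Real.log_two_gt_d9
      linarith
    have hT : (0 : ℝ) ≤ T := T.2
    have hLle : (L : ℝ) + 2 ≤ (2 * a + 8) * (T + Real.log n) := by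
      have := Nat.ceil_lt_add_one (a := (2 * a + 2) * (T + Real.log n)) (by positivity)
      nlinarith
    calc _ ≤ tapeMeasure n ({ω | (MetropolisChain.totalUpdates T ω : ℝ) < n * T} ∪
          ({ω | Collision (poissonSample (updateRate n T)) (initialPrecision n T) ω} ∪
            {ω | ω ∈ M.Unresolved T X₀ L (MetropolisChain.totalUpdates T ω)})) := by
          refine measure_mono_ae ?_
          filter_upwards [ae_injective_timeAt n] with ω hω
          intro hbad
          by_contra hgood
          change ¬ (ω ∈ {ω | _} ∪ ({ω | _} ∪ {ω | _})) at hgood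
          simp only [Set.mem_union, not_or] at hgood
          obtain ⟨h1, h2, h3⟩ := hgood
          rcases hbad with hbad | ⟨s, hs, hbad⟩
          · exact h1 hbad
          have h4 := ((Run.halts_of_final_eq
            (MetropolisChain.report_of_not_collision hω h2 h3) delay).2 s hs).2
          have h5 : (s.now : ℝ) ≤ (L + 2) * s.timeUnit := by exact_mod_cast h4
          have h6 := mul_le_mul_of_nonneg_right hLle s.timeUnit.2
          exact absurd (h5.trans h6) (not_le.2 hbad)
      -- The three failures are too few updates, a collision of cells, and slow resolution.
      _ ≤ (4 * n : ℝ≥0∞)⁻¹ + ((4 * n : ℝ≥0∞)⁻¹ + (4 * n : ℝ≥0∞)⁻¹) := by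
          refine (measure_union_le _ _).trans (add_le_add
            (MetropolisChain.tapeMeasure_totalUpdates_lt_le hn T)
            ((measure_union_le _ _).trans (add_le_add (measure_collision_le n T) ?_)))
          exact MetropolisChain.tapeMeasure_unresolved_le hC hL T X₀ hn (Nat.le_ceil _)
      _ ≤ (n : ℝ≥0∞)⁻¹ := by
          rw [ENNReal.mul_inv (by simp) (by simp), ← add_mul, ← add_mul]
          refine mul_le_of_le_one_left' ?_
          rw [← ENNReal.toReal_le_toReal (by simp) (by simp), ENNReal.toReal_add (by simp) (by simp),
            ENNReal.toReal_add (by simp) (by simp)]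
          norm_num
  · intro ω delay s hs u v p hp
    -- A message in transit needs an edge, so `n ≥ 2`, and `2 log n` already exceeds one bit.
    have hadj : M.G.Adj u v := by
      by_contra h
      rw [Run.chan_eq_nil_of_not_adj hs h] at hp
      exact absurd hp List.not_mem_nil
    have hlen : (p.body.length : ℝ) ≤ 1 := by
      exact_mod_cast (Run.executes_metropolisProtocol M X₀ T ω delay).length_body_le_one hs hp
    have hn : 2 ≤ n := by
      have := u.2
      have := v.2
      have : (u : ℕ) ≠ v := fun h => hadj.ne (Fin.ext h)
      omega
    have h1 := Real.log_le_log (by norm_num) (show (2 : ℝ) ≤ n by exact_mod_cast hn)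
    have h2 := Real.log_two_gt_d9
    have h3 := Real.log_natCast_nonneg (max 1 ⌈T⌉₊)
    have h4 := Real.log_natCast_nonneg q
    linarith
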